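/- Let $\Gamma$ be a group with a finite symmetric generating set $S$. For a unitary representation $\pi$ of $\Gamma$ on a complex Hilbert space $\mathcal H$ put $\kappa(\Gamma,S,\pi)=\inf_{\|\xi\|=1}\max_{s\in S}\|\pi(s)\xi-\xi\|$ (an infimum over the empty set is $+\infty$), and let the Kazhdan constant $\kappa(\Gamma,S)$ be the infimum of $\kappa(\Gamma,S,\pi)$ over all $\pi$ without non-zero invariant vectors. In the group ring $\mathbb R[\Gamma]$ let $\Delta=|S|-\sum_{s\in S}s$, $(\sum_g r_g g)^*=\sum_g r_g g^{-1}$ and $\|\sum_g c_g g\|_1=\sum_g|c_g|$; the augmentation ideal consists of the $\sum_g c_g g$ with $\sum_g c_g=0$. The ball of radius $d$ is the set of all products of at most $d$ elements of $S$. A number $\varepsilon>0$ is called a spectral gap for $(\Gamma,S)$ if $\Delta^2-\varepsilon\Delta=\sum_{i=1}^n b_i^*b_i$ for some $b_1,\dots,b_n\in\mathbb R[\Gamma]$. Let $E_n\subset \mathrm{SL}(n,\mathbb Z)$ be the set of all elementary matrices with a single off-diagonal entry, equal to $1$ or $-1$. Let $(n,\varepsilon,\kappa_0)$ be either $(3,\,0.278648,\,0.2155)$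 or $(4,\,1.29562,\,0.3285)$, and let $\Gamma=\mathrm{SL}(n,\mathbb Z)$, $S=E_n$. Then: 1. (Approximate decomposition.) With $d=2$ and $D=2$, there are $\varepsilon_0>0$ and $b_1,\dots,b_m\in\mathbb R[\Gamma]$ supported in the ball of radius $d$ such that $\sum_i b_i^*b_i$ lies in the augmentation ideal, the error $c=\Delta^2-\varepsilon_0\Delta-\sum_{i=1}^m b_i^*b_i$ is supported in the ball of radius $2^D$, and $\varepsilon_0-2^{2D-1}\|c\|_1\ge\varepsilon$. 2. (Spectral gap.) $\varepsilon$ is a spectral gap for $(\Gamma,S)$, that is, $\Delta^2-\varepsilon\Delta$ is exactly a finite sum of elements $b_i^*b_i$ with $b_i\in\mathbb R[\Gamma]$. 3. (Kazhdan constant.) $\kappa(\Gamma,S)\ge\sqrt{2\varepsilon/|S|}$, and $\kappa(\Gamma,S)\ge\kappa_0$. In particular $\kappa(\mathrm{SL}(3,\mathbb Z),E_3)\ge 0.2155$ and $\kappa(\mathrm{SL}(4,\mathbb Z),E_4)\ge 0.3285$. -/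

import Mathlib

universe u v

noncomputable section

namespace KazhdanBounds

variable {Γ : Type v} [Group Γ]

/-- The unitary representation `π` of the discrete group `Γ` on the Hilbert space `H` has no
non-zero invariant vector. -/
def NoInvariantVectors {H : Type u} [NormedAddCommGroup H] [InnerProductSpace ℂ H]
    [CompleteSpace H] (π : Γ →* unitary (H →L[ℂ] H)) : Prop :=
  ∀ ξ : H, (∀ g : Γ, (π g : H →L[ℂ] H) ξ = ξ) → ξ = 0

/-- `κ(Γ, S, π) = inf_{‖ξ‖ = 1} max_{s ∈ S} ‖π(s) ξ - ξ‖`. It takes values in `[0, ∞]`, so that the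
zero Hilbert space, which has no unit vector, gives the infimum `∞` of the empty set. -/
def repKazhdanConstant (S : Finset Γ) {H : Type u} [NormedAddCommGroup H] [InnerProductSpace ℂ H]
    [CompleteSpace H] (π : Γ →* unitary (H →L[ℂ] H)) : ENNReal :=
  ⨅ (ξ : H) (_ : ‖ξ‖ = 1), ⨆ s ∈ S, ENNReal.ofReal ‖(π s : H →L[ℂ] H) ξ - ξ‖

/-- The (optimal) Kazhdan constant `κ(Γ, S)`: the infimum of `κ(Γ, S, π)` over all unitary
representations `π` of `Γ` on complex Hilbert spaces (in the universe `u`) without non-zero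
invariant vectors. -/
def kazhdanConstant (S : Finset Γ) : ENNReal :=
  ⨅ (H : Type u) (_ : NormedAddCommGroup H) (_ : InnerProductSpace ℂ H) (_ : CompleteSpace H)
    (π : Γ →* unitary (H →L[ℂ] H)) (_ : NoInvariantVectors π), repKazhdanConstant S π

/-- The unnormalized Laplacian `Δ = |S| - ∑_{s ∈ S} s` in the real group ring. -/
def laplacian (S : Finset Γ) : MonoidAlgebra ℝ Γ :=
  MonoidAlgebra.single 1 (S.card : ℝ) - ∑ s ∈ S, MonoidAlgebra.single s 1

/-- The `*`-operation `(∑ r_g g)^* = ∑ r_g g⁻¹` on the real group ring. -/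
def adj (a : MonoidAlgebra ℝ Γ) : MonoidAlgebra ℝ Γ :=
  MonoidAlgebra.mapDomain (fun g : Γ => g⁻¹) a

/-- The augmentation `∑ c_g g ↦ ∑ c_g`. -/
def augmentation (a : MonoidAlgebra ℝ Γ) : ℝ := a.coeff.sum fun _ r => r

/-- The norm `‖∑ c_g g‖₁ = ∑ |c_g|`. -/
def l1Norm (a : MonoidAlgebra ℝ Γ) : ℝ := a.coeff.sum fun _ r => |r|

/-- The elements of `Γ` that are products of at most `d` elements of `S`. -/
def wordBall (S : Finset Γ) (d : ℕ) : Set Γ :=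
  {g | ∃ l : List Γ, l.length ≤ d ∧ (∀ s ∈ l, s ∈ S) ∧ l.prod = g}

/-- All group elements with non-zero coefficient in `a` are products of at most `d` elements
of `S`. -/
def SupportedInBall (S : Finset Γ) (d : ℕ) (a : MonoidAlgebra ℝ Γ) : Prop :=
  ∀ g : Γ, a.coeff g ≠ 0 → g ∈ wordBall S d

/-- `ε > 0` is a spectral gap of the Laplacian (in the sense of Ozawa): the identity
`Δ² - ε Δ = ∑ b_i^* b_i` holds exactly for some `b_1, …, b_n` in the real group ring. -/
def IsSpectralGap (S : Finset Γ) (ε : ℝ) : Prop :=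
  0 < ε ∧ ∃ (n : ℕ) (b : Fin n → MonoidAlgebra ℝ Γ),
    laplacian S ^ 2 - ε • laplacian S = ∑ i, adj (b i) * b i

/-- The value `ε` is certified for `S` by an approximate sum-of-squares decomposition with
support range `d` and error exponent `D`: there are `ε₀ > 0` and `b_1, …, b_m` supported in the
ball of radius `d`, with `∑ b_i^* b_i` in the augmentation ideal, such that the error
`c = Δ² - ε₀ Δ - ∑ b_i^* b_i` is supported in the ball of radius `2 ^ D` and
`ε ≤ ε₀ - 2 ^ (2 D - 1) ‖c‖₁`. -/
def IsCertifiedGap (S : Finset Γ) (d D : ℕ) (ε : ℝ) : Prop :=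
  ∃ (ε₀ : ℝ) (m : ℕ) (b : Fin m → MonoidAlgebra ℝ Γ) (c : MonoidAlgebra ℝ Γ),
    0 < ε₀ ∧
    (∀ i, SupportedInBall S d (b i)) ∧
    augmentation (∑ i, adj (b i) * b i) = 0 ∧
    c = laplacian S ^ 2 - ε₀ • laplacian S - ∑ i, adj (b i) * b i ∧
    SupportedInBall S (2 ^ D) c ∧
    ε ≤ ε₀ - 2 ^ (2 * D - 1) * l1Norm c

/-- The set `E_n` of all elementary `n × n` matrices with a single off-diagonal entry, equal to
`1` or `-1`, as a finite subset of `SL(n, ℤ)`. -/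
def elementaryMatrices (n : ℕ) : Finset (Matrix.SpecialLinearGroup (Fin n) ℤ) :=
  (Finset.univ : Finset ({p : Fin n × Fin n // p.1 ≠ p.2} × ℤˣ)).image
    fun x => Matrix.SpecialLinearGroup.transvection x.1.2 (x.2 : ℤ)

end KazhdanBounds

end

open KazhdanBounds

/-!
# Spectral gaps and Kazhdan constants of `SL(3, ℤ)` and `SL(4, ℤ)`

**From a certified gap to the Kazhdan constant.** In the order on hermitian elements of the group
ring given by the cone of sums of squares `b^* b`, the parallelogram law shows that
`(1 - gh)^* (1 - gh) ≤ 2 (1 - g)^* (1 - g) + 2 (1 - h)^* (1 - h)`. Hence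
`(1 - g)^* (1 - g) ≤ 4 ^ D Δ` for `g` in the ball of radius `2 ^ D`, and a hermitian error `c` in
the augmentation ideal that is supported there satisfies `c + 2 ^ (2 D - 1) ‖c‖₁ Δ ≥ 0`
(`add_smul_laplacian_mem`). This turns an approximate decomposition into an exact one
(`IsCertifiedGap.isSpectralGap`). In a unitary representation without invariant vectors, the image
`T` of `Δ` is a positive operator with trivial kernel, since the elementary matrices generate
`SL(n, ℤ)` by Gaussian elimination (`closure_elementaryMatrices`). A spectral gap gives
`T ^ 2 ≥ ε T`, which implies `T ≥ ε` because `√T` has dense range (`le_re_inner_of_sq_ge`). As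
`2 Δ` is the sum of the squares `(1 - s)^* (1 - s)`, every unit vector is moved by at least
`√(2 ε / |S|)` by some generator (`IsSpectralGap.le_kazhdanConstant`).

**The shape of the approximate decompositions.** Signed permutations of the coordinates and the
inverse transpose form a finite group of automorphisms of `SL(n, ℤ)` that preserves the elementary
matrices, hence also `Δ`. It suffices to decompose `Δ² - ε₀ Δ` after symmetrization over the
automorphisms that preserve the generators and over the involution
(`isCertifiedGap_of_symmetrize`). After this symmetrization an element of the group ring is a
combination of orbit sums, one for each class of group elements under the automorphisms and the
inversion, and the coefficients bound the `ℓ¹`-norm of the error.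

The vectors `b` are combinations of differences `g - 1` with `g` in the ball of radius `2`. They
are projected to the common eigenspaces of a few automorphisms that are involutions and that
commute modulo one of them, which acts trivially there (`mul_isotypic`). These projections are
orthogonal up to a factor for the symmetrized form (`symForm_isotypic`), so that one Gram matrix
for each character describes a sum of squares (`exists_squares_of_pairForm`). The Gram matrices
are given by integral factors, which makes them positive semidefinite by construction. They are
indexed by the representatives of orbits of the chosen automorphisms in the ball of radius `2`,
which are listed in `orbitRepsThree` and `orbitRepsFour`; the value of `ε₀` is `0.28` for `n = 3`
and `1.306` for `n = 4`.

**The computation.** The coefficients of the error are computed with exact integers, in a form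
that the kernel evaluates quickly. An element `g` is represented by its key, the vector
`g (1, 256, 256², …)` with residues modulo `2 ^ 32` as entries, packed in one natural number. A
letter acts on keys by a few operations on natural numbers (`IsKey.rowOp`), and a key determines a
matrix with small entries (`IsKey.eq`). For each product `g⁻¹ h` that occurs in the sum of
squares, the certificate has a witness: the class of the product and an automorphism that moves
the representative of this class to it or to its inverse. The coefficients of all classes are
accumulated in a single integer, as balanced digits in base `2 ^ 96`, and then the sum of their
absolute values is read off (`absDigits_sumTerms`). The lemma `isCertifiedGap_of_frame` says that
a certificate that passes these tests proves a gap.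
-/

noncomputable section

namespace KazhdanBounds

section

variable {Γ : Type v} [Group Γ]

set_option linter.unusedSectionVars false

/-! ### The involution, the augmentation and the norm of the real group ring -/

lemma adj_single (g : Γ) (r : ℝ) :
    adj (MonoidAlgebra.single g r) = MonoidAlgebra.single g⁻¹ r := by
  simp [adj]

lemma adj_add (a b : MonoidAlgebra ℝ Γ) : adj (a + b) = adj a + adj b :=
  MonoidAlgebra.mapDomain_add _ _ _

lemma adj_smul (r : ℝ) (a : MonoidAlgebra ℝ Γ) : adj (r • a) = r • adj a :=
  MonoidAlgebra.mapDomain_smul _ _ _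

lemma adj_zero : adj (0 : MonoidAlgebra ℝ Γ) = 0 := MonoidAlgebra.mapDomain_zero _

lemma adj_neg (a : MonoidAlgebra ℝ Γ) : adj (-a) = -adj a := by
  rw [← neg_one_smul ℝ a, adj_smul, neg_one_smul]

lemma adj_sub (a b : MonoidAlgebra ℝ Γ) : adj (a - b) = adj a - adj b := by
  rw [sub_eq_add_neg, adj_add, adj_neg, sub_eq_add_neg]

lemma adj_sum {ι : Type*} (s : Finset ι) (f : ι → MonoidAlgebra ℝ Γ) :
    adj (∑ i ∈ s, f i) = ∑ i ∈ s, adj (f i) := by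
  classical
  induction s using Finset.induction_on with
  | empty => simp [adj_zero]
  | insert i s hi ih => rw [Finset.sum_insert hi, Finset.sum_insert hi, adj_add, ih]

lemma adj_one : adj (1 : MonoidAlgebra ℝ Γ) = 1 := by
  rw [MonoidAlgebra.one_def, adj_single, inv_one]

lemma adj_adj (a : MonoidAlgebra ℝ Γ) : adj (adj a) = a := by
  induction a using MonoidAlgebra.induction_linear with
  | zero => simp [adj_zero]
  | add x y hx hy => rw [adj_add, adj_add, hx, hy]
  | single g r => rw [adj_single, adj_single, inv_inv]

lemma adj_mul (a b : MonoidAlgebra ℝ Γ) : adj (a * b) = adj b * adj a := by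
  induction a using MonoidAlgebra.induction_linear with
  | zero => simp [adj_zero]
  | add x y hx hy => rw [add_mul, adj_add, hx, hy, adj_add, mul_add]
  | single g r =>
    induction b using MonoidAlgebra.induction_linear with
    | zero => simp [adj_zero]
    | add x y hx hy => rw [mul_add, adj_add, hx, hy, adj_add, add_mul]
    | single h s =>
      simp only [adj_single, MonoidAlgebra.single_mul_single, mul_inv_rev, mul_comm]

lemma augmentation_single (g : Γ) (r : ℝ) : augmentation (MonoidAlgebra.single g r) = r := by
  simp [augmentation]

lemma augmentation_add (a b : MonoidAlgebra ℝ Γ) :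
    augmentation (a + b) = augmentation a + augmentation b := by
  unfold augmentation
  rw [MonoidAlgebra.coeff_add, Finsupp.sum_add_index'] <;> simp

lemma augmentation_zero : augmentation (0 : MonoidAlgebra ℝ Γ) = 0 := by
  simp [augmentation]

lemma augmentation_mul (a b : MonoidAlgebra ℝ Γ) :
    augmentation (a * b) = augmentation a * augmentation b := by
  induction a using MonoidAlgebra.induction_linear with
  | zero => simp [augmentation_zero]
  | add x y hx hy => rw [add_mul, augmentation_add, hx, hy, augmentation_add, add_mul]
  | single g r =>
    induction b using MonoidAlgebra.induction_linear with
    | zero => simp [augmentation_zero]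
    | add x y hx hy => rw [mul_add, augmentation_add, hx, hy, augmentation_add, mul_add]
    | single h s => simp only [augmentation_single, MonoidAlgebra.single_mul_single]

/-- The augmentation as a ring homomorphism. -/
def augmentationHom : MonoidAlgebra ℝ Γ →+* ℝ where
  toFun := augmentation
  map_one' := by rw [MonoidAlgebra.one_def, augmentation_single]
  map_mul' := augmentation_mul
  map_zero' := augmentation_zero
  map_add' := augmentation_add

lemma augmentation_smul (r : ℝ) (a : MonoidAlgebra ℝ Γ) :
    augmentation (r • a) = r * augmentation a := by
  induction a using MonoidAlgebra.induction_linear with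
  | zero => simp [augmentation_zero]
  | add x y hx hy => rw [smul_add, augmentation_add, hx, hy, augmentation_add, mul_add]
  | single g s => simp [augmentation_single]

lemma augmentation_sum {ι : Type*} (s : Finset ι) (f : ι → MonoidAlgebra ℝ Γ) :
    augmentation (∑ i ∈ s, f i) = ∑ i ∈ s, augmentation (f i) :=
  map_sum augmentationHom f s

lemma augmentation_sub (a b : MonoidAlgebra ℝ Γ) :
    augmentation (a - b) = augmentation a - augmentation b :=
  map_sub augmentationHom a b

lemma l1Norm_single (g : Γ) (r : ℝ) : l1Norm (MonoidAlgebra.single g r) = |r| := by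
  simp [l1Norm]

lemma l1Norm_zero : l1Norm (0 : MonoidAlgebra ℝ Γ) = 0 := by simp [l1Norm]

lemma l1Norm_eq_sum {a : MonoidAlgebra ℝ Γ} {s : Finset Γ} (h : a.coeff.support ⊆ s) :
    l1Norm a = ∑ g ∈ s, |a.coeff g| :=
  Finsupp.sum_of_support_subset _ h _ (by simp)

lemma l1Norm_add_le (a b : MonoidAlgebra ℝ Γ) : l1Norm (a + b) ≤ l1Norm a + l1Norm b := by
  classical
  have ha : a.coeff.support ⊆ a.coeff.support ∪ b.coeff.support := Finset.subset_union_left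
  have hb : b.coeff.support ⊆ a.coeff.support ∪ b.coeff.support := Finset.subset_union_right
  have hab : (a + b).coeff.support ⊆ a.coeff.support ∪ b.coeff.support := Finsupp.support_add
  rw [l1Norm_eq_sum ha, l1Norm_eq_sum hb, l1Norm_eq_sum hab, ← Finset.sum_add_distrib]
  exact Finset.sum_le_sum fun g _ => abs_add_le _ _

lemma l1Norm_smul (r : ℝ) (a : MonoidAlgebra ℝ Γ) : l1Norm (r • a) = |r| * l1Norm a := by
  have h : (r • a).coeff.support ⊆ a.coeff.support := Finsupp.support_smul
  rw [l1Norm_eq_sum h, l1Norm_eq_sum (subset_refl _), Finset.mul_sum]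
  exact Finset.sum_congr rfl fun g _ => by simp [abs_mul]

lemma l1Norm_sum_le {ι : Type*} (s : Finset ι) (f : ι → MonoidAlgebra ℝ Γ) :
    l1Norm (∑ i ∈ s, f i) ≤ ∑ i ∈ s, l1Norm (f i) := by
  classical
  induction s using Finset.induction_on with
  | empty => simp [l1Norm_zero]
  | insert i s hi ih =>
    rw [Finset.sum_insert hi, Finset.sum_insert hi]
    exact (l1Norm_add_le _ _).trans (by gcongr)

/-! ### Supports -/

lemma wordBall_mono (S : Finset Γ) {d e : ℕ} (h : d ≤ e) : wordBall S d ⊆ wordBall S e := by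
  rintro g ⟨l, hl, hS, rfl⟩
  exact ⟨l, hl.trans h, hS, rfl⟩

lemma one_mem_wordBall (S : Finset Γ) (d : ℕ) : (1 : Γ) ∈ wordBall S d :=
  ⟨[], by simp, by simp, rfl⟩

lemma mul_mem_wordBall {S : Finset Γ} {d e : ℕ} {g h : Γ} (hg : g ∈ wordBall S d)
    (hh : h ∈ wordBall S e) : g * h ∈ wordBall S (d + e) := by
  obtain ⟨l, hl, hS, rfl⟩ := hg
  obtain ⟨l', hl', hS', rfl⟩ := hh
  refine ⟨l ++ l', by simp; omega, ?_, by simp⟩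
  intro s hs
  rcases List.mem_append.1 hs with h | h
  exacts [hS s h, hS' s h]

lemma inv_mem_wordBall {S : Finset Γ} (hS : ∀ s ∈ S, s⁻¹ ∈ S) {d : ℕ} {g : Γ}
    (hg : g ∈ wordBall S d) : g⁻¹ ∈ wordBall S d := by
  obtain ⟨l, hl, hlS, rfl⟩ := hg
  refine ⟨(l.map fun x => x⁻¹).reverse, by simpa using hl, ?_, by rw [List.prod_inv_reverse]⟩
  intro s hs
  simp only [List.mem_reverse, List.mem_map] at hs
  obtain ⟨t, ht, rfl⟩ := hs
  exact hS t (hlS t ht)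

lemma mem_wordBall_one {S : Finset Γ} {s : Γ} (hs : s ∈ S) : s ∈ wordBall S 1 :=
  ⟨[s], by simp, by simpa using hs, by simp⟩

lemma SupportedInBall.mono {S : Finset Γ} {d e : ℕ} {a : MonoidAlgebra ℝ Γ}
    (ha : SupportedInBall S d a) (h : d ≤ e) : SupportedInBall S e a :=
  fun g hg => wordBall_mono S h (ha g hg)

lemma supportedInBall_zero (S : Finset Γ) (d : ℕ) :
    SupportedInBall S d (0 : MonoidAlgebra ℝ Γ) := by
  intro g hg
  simp at hg

lemma supportedInBall_single {S : Finset Γ} {d : ℕ} {g : Γ} (hg : g ∈ wordBall S d) (r : ℝ) :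
    SupportedInBall S d (MonoidAlgebra.single g r) := by
  classical
  intro h hh
  rw [MonoidAlgebra.coeff_single, Finsupp.single_apply] at hh
  by_cases e : g = h
  · exact e ▸ hg
  · simp [e] at hh

lemma SupportedInBall.add {S : Finset Γ} {d : ℕ} {a b : MonoidAlgebra ℝ Γ}
    (ha : SupportedInBall S d a) (hb : SupportedInBall S d b) : SupportedInBall S d (a + b) := by
  intro g hg
  by_cases h : a.coeff g = 0
  · refine hb g fun h' => hg ?_
    simp [h, h']
  · exact ha g h

lemma SupportedInBall.smul {S : Finset Γ} {d : ℕ} {a : MonoidAlgebra ℝ Γ}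
    (ha : SupportedInBall S d a) (r : ℝ) : SupportedInBall S d (r • a) := by
  intro g hg
  refine ha g fun h => hg ?_
  simp [h]

lemma SupportedInBall.sub {S : Finset Γ} {d : ℕ} {a b : MonoidAlgebra ℝ Γ}
    (ha : SupportedInBall S d a) (hb : SupportedInBall S d b) : SupportedInBall S d (a - b) := by
  have := ha.add (hb.smul (-1))
  rwa [neg_one_smul, ← sub_eq_add_neg] at this

lemma SupportedInBall.sum {S : Finset Γ} {d : ℕ} {ι : Type*} {s : Finset ι}
    {f : ι → MonoidAlgebra ℝ Γ} (h : ∀ i ∈ s, SupportedInBall S d (f i)) :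
    SupportedInBall S d (∑ i ∈ s, f i) := by
  classical
  induction s using Finset.induction_on with
  | empty => simpa using supportedInBall_zero S d
  | insert i s hi ih =>
    rw [Finset.sum_insert hi]
    exact (h i (Finset.mem_insert_self i s)).add
      (ih fun j hj => h j (Finset.mem_insert_of_mem hj))

lemma eq_sum_single (a : MonoidAlgebra ℝ Γ) :
    a = ∑ g ∈ a.coeff.support, MonoidAlgebra.single g (a.coeff g) :=
  (MonoidAlgebra.sum_coeff_single a).symm

lemma SupportedInBall.adj {S : Finset Γ} (hS : ∀ s ∈ S, s⁻¹ ∈ S) {d : ℕ}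
    {a : MonoidAlgebra ℝ Γ} (ha : SupportedInBall S d a) :
    SupportedInBall S d (KazhdanBounds.adj a) := by
  rw [eq_sum_single a, adj_sum]
  refine .sum fun g hg => ?_
  rw [adj_single]
  exact supportedInBall_single (inv_mem_wordBall hS (ha g (by simpa using hg))) _

lemma SupportedInBall.mul {S : Finset Γ} {d e : ℕ} {a b : MonoidAlgebra ℝ Γ}
    (ha : SupportedInBall S d a) (hb : SupportedInBall S e b) :
    SupportedInBall S (d + e) (a * b) := by
  rw [eq_sum_single a, eq_sum_single b, Finset.sum_mul_sum]
  refine .sum fun g hg => .sum fun h hh => ?_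
  rw [MonoidAlgebra.single_mul_single]
  exact supportedInBall_single (mul_mem_wordBall (ha g (by simpa using hg))
    (hb h (by simpa using hh))) _

lemma supportedInBall_laplacian (S : Finset Γ) : SupportedInBall S 1 (laplacian S) :=
  (supportedInBall_single (one_mem_wordBall S 1) _).sub
    (.sum fun _ hs => supportedInBall_single (mem_wordBall_one hs) _)

end

section

variable {Γ : Type v} [Group Γ]

/-! ### Sums of hermitian squares -/

/-- The convex cone of sums of hermitian squares `∑ bᵢ^* bᵢ` in the real group ring. -/
def sosCone (Γ : Type v) [Group Γ] : AddSubmonoid (MonoidAlgebra ℝ Γ) :=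
  AddSubmonoid.closure (Set.range fun b => adj b * b)

lemma adj_mul_self_mem (b : MonoidAlgebra ℝ Γ) : adj b * b ∈ sosCone Γ :=
  AddSubmonoid.subset_closure ⟨b, rfl⟩

lemma exists_fin_of_mem_sosCone {a : MonoidAlgebra ℝ Γ} (ha : a ∈ sosCone Γ) :
    ∃ (n : ℕ) (b : Fin n → MonoidAlgebra ℝ Γ), a = ∑ i, adj (b i) * b i := by
  obtain ⟨l, hl, rfl⟩ := AddSubmonoid.exists_list_of_mem_closure ha
  choose f hf using hl
  refine ⟨l.length, fun i => f (l.get i) (l.get_mem i), ?_⟩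
  conv_lhs => rw [← List.ofFn_get l, List.sum_ofFn]
  exact Finset.sum_congr rfl fun i _ => (hf _ _).symm

lemma smul_mem_sosCone {a : MonoidAlgebra ℝ Γ} (ha : a ∈ sosCone Γ) {r : ℝ} (hr : 0 ≤ r) :
    r • a ∈ sosCone Γ := by
  induction ha using AddSubmonoid.closure_induction with
  | mem x hx =>
    obtain ⟨b, rfl⟩ := hx
    have : r • (adj b * b) = adj (√r • b) * (√r • b) := by
      rw [adj_smul, smul_mul_smul_comm, Real.mul_self_sqrt hr]
    exact this ▸ adj_mul_self_mem _
  | zero => simp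
  | add x y _ _ hx hy => rw [smul_add]; exact (sosCone Γ).add_mem hx hy

/-- The hermitian square `(1 - g)^* (1 - g) = 2 - g - g⁻¹`. -/
def diffSq (g : Γ) : MonoidAlgebra ℝ Γ :=
  adj (1 - MonoidAlgebra.single g 1) * (1 - MonoidAlgebra.single g 1)

lemma diffSq_eq (g : Γ) :
    diffSq g = (2 : ℝ) • 1 - MonoidAlgebra.single g 1 - MonoidAlgebra.single g⁻¹ 1 := by
  have h : MonoidAlgebra.single g⁻¹ (1 : ℝ) * MonoidAlgebra.single g 1 = 1 := by
    rw [MonoidAlgebra.single_mul_single, inv_mul_cancel, mul_one, MonoidAlgebra.one_def]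
  rw [diffSq, adj_sub, adj_one, adj_single, mul_sub, sub_mul, sub_mul, h, two_smul]
  simp only [one_mul, mul_one]
  abel

lemma diffSq_inv (g : Γ) : diffSq g⁻¹ = diffSq g := by
  rw [diffSq_eq, diffSq_eq, inv_inv]; abel

lemma diffSq_one : diffSq (1 : Γ) = 0 := by
  simp [diffSq, ← MonoidAlgebra.one_def]

lemma diffSq_mem (g : Γ) : diffSq g ∈ sosCone Γ := adj_mul_self_mem _

/-- The parallelogram law, as an inequality in the order given by the cone of sums of squares:
`(1 - gh)^* (1 - gh) ≤ 2 (1 - g)^* (1 - g) + 2 (1 - h)^* (1 - h)`. -/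
lemma two_smul_add_sub_diffSq_mul_mem (g h : Γ) :
    (2 : ℝ) • diffSq g + (2 : ℝ) • diffSq h - diffSq (g * h) ∈ sosCone Γ := by
  -- `1 - gh = p + q` for `p = 1 - g` and `q = g (1 - h)`, and
  -- `2 p^* p + 2 q^* q - (p + q)^* (p + q) = (p - q)^* (p - q)`
  set p : MonoidAlgebra ℝ Γ := 1 - MonoidAlgebra.single g 1 with hp
  set q : MonoidAlgebra ℝ Γ := MonoidAlgebra.single g 1 * (1 - MonoidAlgebra.single h 1) with hq
  have h1 : diffSq g = adj p * p := rfl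
  have h2 : diffSq h = adj q * q := by
    have e : MonoidAlgebra.single g⁻¹ (1 : ℝ) * MonoidAlgebra.single g 1 = 1 := by
      rw [MonoidAlgebra.single_mul_single, inv_mul_cancel, mul_one, MonoidAlgebra.one_def]
    rw [hq, adj_mul, adj_single, mul_assoc, ← mul_assoc (MonoidAlgebra.single g⁻¹ 1), e, one_mul,
      diffSq]
  have h3 : diffSq (g * h) = adj (p + q) * (p + q) := by
    have : p + q = 1 - MonoidAlgebra.single (g * h) 1 := by
      rw [hp, hq, mul_sub, mul_one, MonoidAlgebra.single_mul_single, mul_one]; abel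
    rw [this, diffSq]
  have h4 : (2 : ℝ) • diffSq g + (2 : ℝ) • diffSq h - diffSq (g * h) = adj (p - q) * (p - q) := by
    rw [h1, h2, h3, adj_add, adj_sub p q, two_smul, two_smul]
    clear_value p q
    noncomm_ring
  exact h4 ▸ adj_mul_self_mem _

section Laplacian

variable {S : Finset Γ} (hS : ∀ s ∈ S, s⁻¹ ∈ S)
include hS

lemma sum_single_inv :
    ∑ s ∈ S, MonoidAlgebra.single s⁻¹ (1 : ℝ) = ∑ s ∈ S, MonoidAlgebra.single s (1 : ℝ) :=
  Finset.sum_bij (fun s _ => s⁻¹) hS (fun _ _ _ _ h => inv_injective h)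
    (fun b hb => ⟨b⁻¹, hS b hb, inv_inv b⟩) (fun _ _ => rfl)

lemma two_smul_laplacian : (2 : ℝ) • laplacian S = ∑ s ∈ S, diffSq s := by
  simp only [diffSq_eq, Finset.sum_sub_distrib, sum_single_inv hS, Finset.sum_const, laplacian]
  rw [smul_sub, MonoidAlgebra.one_def, MonoidAlgebra.smul_single, MonoidAlgebra.smul_single,
    two_smul, sub_sub, two_smul]
  congr 1
  simp [← Nat.cast_smul_eq_nsmul ℝ, mul_two]

lemma adj_laplacian : adj (laplacian S) = laplacian S := by
  simp only [laplacian, adj_sub, adj_sum, adj_single, sum_single_inv hS, inv_one]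

lemma laplacian_mem : laplacian S ∈ sosCone Γ := by
  have : laplacian S = (1 / 2 : ℝ) • ∑ s ∈ S, diffSq s := by
    rw [← two_smul_laplacian hS, smul_smul]; norm_num
  rw [this]
  exact smul_mem_sosCone (sum_mem fun s _ => diffSq_mem s) (by norm_num)

variable (hS2 : ∀ s ∈ S, s ≠ s⁻¹)
include hS2

/-- Since `s ≠ s⁻¹`, the square `(1 - s)^* (1 - s)` occurs twice in `2 Δ`. -/
lemma laplacian_sub_diffSq_mem {s : Γ} (hs : s ∈ S) : laplacian S - diffSq s ∈ sosCone Γ := by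
  classical
  have hs' : s⁻¹ ∈ S.erase s := Finset.mem_erase.2 ⟨(hS2 s hs).symm, hS s hs⟩
  have h : laplacian S - diffSq s = (1 / 2 : ℝ) • ∑ t ∈ (S.erase s).erase s⁻¹, diffSq t := by
    have h1 : (2 : ℝ) • laplacian S = diffSq s + (diffSq s + ∑ t ∈ (S.erase s).erase s⁻¹, diffSq t)
        := by
      rw [two_smul_laplacian hS, ← Finset.add_sum_erase S _ hs, ← Finset.add_sum_erase _ _ hs',
        diffSq_inv]
    have h2 : laplacian S = (1 / 2 : ℝ) • (2 : ℝ) • laplacian S := by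
      rw [smul_smul]; norm_num
    rw [h2, h1, ← add_assoc, smul_add, ← two_smul ℝ (diffSq s), smul_smul]
    norm_num
  rw [h]
  exact smul_mem_sosCone (sum_mem fun s _ => diffSq_mem s) (by norm_num)

/-- In the order given by the cone of sums of squares, `(1 - g)^* (1 - g) ≤ 4 ^ D Δ` for every
product `g` of at most `2 ^ D` generators: each halving of a word costs a factor `4`. -/
lemma laplacian_smul_sub_diffSq_mem (D : ℕ) {g : Γ} (hg : g ∈ wordBall S (2 ^ D)) :
    (4 ^ D : ℝ) • laplacian S - diffSq g ∈ sosCone Γ := by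
  induction D generalizing g with
  | zero =>
    obtain ⟨l, hl, hlS, rfl⟩ := hg
    match l, hl, hlS with
    | [], _, _ => simpa [diffSq_one] using laplacian_mem hS
    | [s], _, hlS => simpa using laplacian_sub_diffSq_mem hS hS2 (hlS s (by simp))
  | succ D ih =>
    obtain ⟨l, hl, hlS, rfl⟩ := hg
    have h1 := ih (g := (l.take (2 ^ D)).prod)
      ⟨_, by simp, fun s hs => hlS s (List.mem_of_mem_take hs), rfl⟩
    have h2 := ih (g := (l.drop (2 ^ D)).prod)
      ⟨_, by simp [pow_succ] at hl ⊢; omega, fun s hs => hlS s (List.mem_of_mem_drop hs), rfl⟩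
    have h3 := two_smul_add_sub_diffSq_mul_mem (l.take (2 ^ D)).prod (l.drop (2 ^ D)).prod
    rw [List.prod_take_mul_prod_drop] at h3
    have := add_mem (add_mem (smul_mem_sosCone h1 (zero_le_two (α := ℝ)))
      (smul_mem_sosCone h2 (zero_le_two (α := ℝ)))) h3
    convert this using 1
    rw [smul_sub, smul_sub, smul_smul, pow_succ,
      show (4 ^ D * 4 : ℝ) = 2 * 4 ^ D + 2 * 4 ^ D by ring, add_smul]
    abel

/-- A hermitian element of the augmentation ideal supported in the ball of radius `2 ^ D` is
absorbed by a multiple of the Laplacian proportional to its `ℓ¹`-norm. -/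
lemma add_smul_laplacian_mem {D : ℕ} (hD : 1 ≤ D) {c : MonoidAlgebra ℝ Γ} (hc : adj c = c)
    (hc0 : augmentation c = 0) (hsupp : SupportedInBall S (2 ^ D) c) :
    c + (2 ^ (2 * D - 1) * l1Norm c) • laplacian S ∈ sosCone Γ := by
  have hsum : ∑ g ∈ c.coeff.support, c.coeff g = 0 := hc0
  have hadj : c = ∑ g ∈ c.coeff.support, MonoidAlgebra.single g⁻¹ (c.coeff g) := by
    conv_lhs => rw [← hc, eq_sum_single c, adj_sum]
    simp only [adj_single]
  have h1 : c = -((1 / 2 : ℝ) • ∑ g ∈ c.coeff.support, c.coeff g • diffSq g) := by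
    have : ∑ g ∈ c.coeff.support, c.coeff g • diffSq g = -(c + c) := by
      conv_rhs => enter [1, 1]; rw [eq_sum_single c]
      conv_rhs => enter [1, 2]; rw [hadj]
      simp only [diffSq_eq, smul_sub, Finset.sum_sub_distrib, MonoidAlgebra.smul_single,
        smul_eq_mul, mul_one]
      rw [← Finset.sum_smul, hsum, zero_smul]
      abel
    rw [this, smul_neg, neg_neg, ← two_smul ℝ c, smul_smul]
    norm_num
  have h2 : c + (2 ^ (2 * D - 1) * l1Norm c) • laplacian S
      = (1 / 2 : ℝ) • ∑ g ∈ c.coeff.support,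
        ((|c.coeff g| * 4 ^ D) • laplacian S - c.coeff g • diffSq g) := by
    conv_lhs => enter [1]; rw [h1]
    rw [Finset.sum_sub_distrib, smul_sub, ← Finset.sum_smul, ← Finset.sum_mul, smul_smul,
      ← sub_eq_neg_add]
    congr 2
    have : (4 : ℝ) ^ D = 2 * 2 ^ (2 * D - 1) := by
      rw [← pow_succ', show 2 * D - 1 + 1 = 2 * D by omega, pow_mul]; norm_num
    rw [this, l1Norm, Finsupp.sum]
    ring
  rw [h2]
  refine smul_mem_sosCone (sum_mem fun g hg => ?_) (by norm_num)
  have hg' : g ∈ wordBall S (2 ^ D) := hsupp g (by simpa using hg)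
  rcases le_total 0 (c.coeff g) with h | h
  · have := smul_mem_sosCone (laplacian_smul_sub_diffSq_mem hS hS2 D hg') h
    rwa [smul_sub, smul_smul, show c.coeff g * 4 ^ D = |c.coeff g| * 4 ^ D by
      rw [abs_of_nonneg h]] at this
  · have := smul_mem_sosCone (add_mem (smul_mem_sosCone (laplacian_mem hS)
      (pow_nonneg (zero_le_four (α := ℝ)) D)) (diffSq_mem g)) (neg_nonneg.2 h)
    rwa [smul_add, smul_smul, neg_smul (c.coeff g) (diffSq g), ← sub_eq_add_neg,
      ← abs_of_nonpos h] at this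

/-- The error of an approximate decomposition is absorbed by a part of `ε₀ Δ`, which turns the
approximate decomposition into an exact one with the smaller constant `ε`. -/
lemma IsCertifiedGap.isSpectralGap {d D : ℕ} (hD : 1 ≤ D) {ε : ℝ} (hε : 0 < ε)
    (h : IsCertifiedGap S d D ε) : IsSpectralGap S ε := by
  obtain ⟨ε₀, m, b, c, -, -, haug, hc, hsupp, hle⟩ := h
  refine ⟨hε, exists_fin_of_mem_sosCone ?_⟩
  have hadj : adj c = c := by
    rw [hc, adj_sub, adj_sub, adj_smul, adj_sum, sq, adj_mul, adj_laplacian hS]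
    simp only [adj_mul, adj_adj]
  have hlap : augmentation (laplacian S) = 0 := by
    rw [laplacian, augmentation_sub, augmentation_sum, augmentation_single]
    simp [augmentation_single]
  have hc0 : augmentation c = 0 := by
    rw [hc, augmentation_sub, augmentation_sub, augmentation_smul, haug, sq, augmentation_mul, hlap]
    simp
  have h1 := add_smul_laplacian_mem hS hS2 hD hadj hc0 hsupp
  have h2 : ∑ i, adj (b i) * b i ∈ sosCone Γ := sum_mem fun i _ => adj_mul_self_mem _
  have h3 := smul_mem_sosCone (laplacian_mem hS)
    (show 0 ≤ ε₀ - ε - 2 ^ (2 * D - 1) * l1Norm c by linarith)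
  convert add_mem (add_mem h1 h2) h3 using 1
  rw [sub_smul (ε₀ - ε), sub_smul]
  nth_rw 1 [hc]
  abel

end Laplacian

end

section

variable {Γ : Type v} [Group Γ]

/-! ### From a spectral gap to the Kazhdan constant -/

section Hilbert

variable {H : Type u} [NormedAddCommGroup H] [InnerProductSpace ℂ H] [CompleteSpace H]

open ContinuousLinearMap in
/-- If a positive operator `T` has trivial kernel and `ε T ≤ T ^ 2`, then `ε ≤ T`. On the range of
`√T`, which is dense, the second inequality is the first one conjugated by `√T`. -/
lemma le_re_inner_of_sq_ge (T : H →L[ℂ] H) (hT : T.IsPositive) (hker : ∀ ξ, T ξ = 0 → ξ = 0)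
    (ε : ℝ) (hsq : ∀ ξ, ε * RCLike.re (inner ℂ (T ξ) ξ) ≤ ‖T ξ‖ ^ 2) (ξ : H) :
    ε * ‖ξ‖ ^ 2 ≤ RCLike.re (inner ℂ (T ξ) ξ) := by
  have hT0 : 0 ≤ T := (nonneg_iff_isPositive T).2 hT
  set R := CFC.sqrt T with hR
  have hRR : R * R = T := CFC.sqrt_mul_sqrt_self T hT0
  have hRsa : adjoint R = R := by
    have := (nonneg_iff_isPositive R).1 (CFC.sqrt_nonneg T)
    exact this.isSelfAdjoint.adjoint_eq
  have happ : ∀ η, R (R η) = T η := fun η => by rw [← hRR]; rfl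
  have hinner : ∀ η, RCLike.re (inner ℂ (T η) η) = ‖R η‖ ^ 2 := fun η => by
    rw [← happ, ← hRsa, adjoint_inner_left, hRsa]
    exact inner_self_eq_norm_sq (𝕜 := ℂ) _
  rw [hinner]
  have hdense : Dense (Set.range R) := by
    have h1 : (R : H →ₗ[ℂ] H).rangeᗮ = ⊥ := by
      rw [orthogonal_range, hRsa, Submodule.eq_bot_iff]
      intro η hη
      refine hker η ?_
      rw [← happ, show R η = 0 from hη, map_zero]
    have h2 := Submodule.topologicalClosure_eq_top_iff.2 h1
    rw [← Submodule.dense_iff_topologicalClosure_eq_top] at h2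
    rwa [LinearMap.coe_range] at h2
  have hclosed : IsClosed {ξ : H | ε * ‖ξ‖ ^ 2 ≤ ‖R ξ‖ ^ 2} :=
    isClosed_le (by fun_prop) (by fun_prop)
  refine hclosed.closure_subset_iff.2 ?_ (hdense ξ)
  rintro _ ⟨η, rfl⟩
  have := hsq η
  rwa [hinner, ← happ] at this

/-- The action of the real group ring on a unitary representation. -/
def groupRingRep (π : Γ →* unitary (H →L[ℂ] H)) : MonoidAlgebra ℝ Γ →ₐ[ℝ] (H →L[ℂ] H) :=
  MonoidAlgebra.lift ℝ (H →L[ℂ] H) Γ ((unitary (H →L[ℂ] H)).subtype.comp π)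

variable (π : Γ →* unitary (H →L[ℂ] H))

lemma groupRingRep_single (g : Γ) (r : ℝ) :
    groupRingRep π (MonoidAlgebra.single g r) = r • (π g : H →L[ℂ] H) := by
  simp [groupRingRep, MonoidAlgebra.lift_single]

lemma groupRingRep_adj (a : MonoidAlgebra ℝ Γ) :
    groupRingRep π (adj a) = star (groupRingRep π a) := by
  induction a using MonoidAlgebra.induction_linear with
  | zero => simp [adj_zero]
  | add x y hx hy => rw [adj_add, map_add, hx, hy, map_add, star_add]
  | single g r =>
    rw [adj_single, groupRingRep_single, groupRingRep_single, star_smul, map_inv]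
    simp [← Unitary.star_eq_inv]

lemma re_inner_groupRingRep_sq (b : MonoidAlgebra ℝ Γ) (ξ : H) :
    RCLike.re (inner ℂ (groupRingRep π (adj b * b) ξ) ξ) = ‖groupRingRep π b ξ‖ ^ 2 := by
  rw [map_mul, groupRingRep_adj, ContinuousLinearMap.star_eq_adjoint, mul_apply_eq_comp,
    ContinuousLinearMap.adjoint_inner_left]
  exact inner_self_eq_norm_sq (𝕜 := ℂ) _

/-- The quadratic form of `2 Δ` is the sum of the squared displacements. -/
lemma re_inner_groupRingRep_laplacian {S : Finset Γ} (hS : ∀ s ∈ S, s⁻¹ ∈ S) (ξ : H) :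
    2 * RCLike.re (inner ℂ (groupRingRep π (laplacian S) ξ) ξ)
      = ∑ s ∈ S, ‖(π s : H →L[ℂ] H) ξ - ξ‖ ^ 2 := by
  have h1 : ∀ s, RCLike.re (inner ℂ (groupRingRep π (diffSq s) ξ) ξ)
      = ‖(π s : H →L[ℂ] H) ξ - ξ‖ ^ 2 := fun s => by
    rw [diffSq, re_inner_groupRingRep_sq, map_sub, map_one, groupRingRep_single, one_smul,
      norm_sub_rev ((π s : H →L[ℂ] H) ξ)]
    rfl
  simp only [← h1]
  have h2 : ∀ a : MonoidAlgebra ℝ Γ, RCLike.re (inner ℂ (groupRingRep π ((2 : ℝ) • a) ξ) ξ)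
      = 2 * RCLike.re (inner ℂ (groupRingRep π a ξ) ξ) := fun a => by
    rw [two_smul, map_add, add_apply, inner_add_left, map_add, two_mul]
  rw [← h2, two_smul_laplacian hS, map_sum, sum_apply, sum_inner, map_sum]

/-- A spectral gap `ε` gives `∑ ‖π(s)ξ - ξ‖² ≥ 2 ε ‖ξ‖²` in every representation without invariant
vectors. -/
lemma IsSpectralGap.le_sum_norm_sq {S : Finset Γ} (hS : ∀ s ∈ S, s⁻¹ ∈ S)
    (hgen : Subgroup.closure (S : Set Γ) = ⊤) {ε : ℝ} (h : IsSpectralGap S ε)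
    (hπ : NoInvariantVectors π) (ξ : H) :
    2 * ε * ‖ξ‖ ^ 2 ≤ ∑ s ∈ S, ‖(π s : H →L[ℂ] H) ξ - ξ‖ ^ 2 := by
  obtain ⟨-, n, b, hb⟩ := h
  set T := groupRingRep π (laplacian S) with hTdef
  have hsum : ∀ ξ, 2 * RCLike.re (inner ℂ (T ξ) ξ)
      = ∑ s ∈ S, ‖(π s : H →L[ℂ] H) ξ - ξ‖ ^ 2 := re_inner_groupRingRep_laplacian π hS
  have hsa : ContinuousLinearMap.adjoint T = T := by
    rw [← ContinuousLinearMap.star_eq_adjoint, hTdef, ← groupRingRep_adj, adj_laplacian hS]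
  have hpos : T.IsPositive := by
    rw [ContinuousLinearMap.isPositive_def]
    refine ⟨(ContinuousLinearMap.isSelfAdjoint_iff'.2 hsa).isSymmetric, fun η => ?_⟩
    have h1 := hsum η
    have h2 : 0 ≤ ∑ s ∈ S, ‖(π s : H →L[ℂ] H) η - η‖ ^ 2 := by positivity
    rw [ContinuousLinearMap.reApplyInnerSelf_apply]
    linarith
  have hker : ∀ η, T η = 0 → η = 0 := by
    intro η hη
    have h1 := hsum η
    rw [hη, inner_zero_left, map_zero, mul_zero] at h1
    have h2 : ∀ s ∈ S, (π s : H →L[ℂ] H) η = η := fun s hs => by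
      have := (Finset.sum_eq_zero_iff_of_nonneg (fun _ _ => by positivity)).1 h1.symm s hs
      rwa [sq_eq_zero_iff, norm_eq_zero, sub_eq_zero] at this
    refine hπ η fun g => ?_
    have hg : g ∈ Subgroup.closure (S : Set Γ) := hgen ▸ Subgroup.mem_top g
    induction hg using Subgroup.closure_induction with
    | mem s hs => exact h2 s hs
    | one => simp
    | mul x y _ _ hx hy =>
      rw [map_mul, Submonoid.coe_mul, mul_apply_eq_comp, hy, hx]
    | inv x _ hx =>
      have h3 : ((π x⁻¹ : H →L[ℂ] H) * (π x : H →L[ℂ] H)) η = η := by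
        rw [← Submonoid.coe_mul, ← map_mul, inv_mul_cancel, map_one]; rfl
      rwa [mul_apply_eq_comp, hx] at h3
  have hsq : ∀ η, ε * RCLike.re (inner ℂ (T η) η) ≤ ‖T η‖ ^ 2 := by
    intro η
    have h1 : ‖T η‖ ^ 2 - ε * RCLike.re (inner ℂ (T η) η) = ∑ i, ‖groupRingRep π (b i) η‖ ^ 2 := by
      simp only [← re_inner_groupRingRep_sq]
      rw [← map_sum, ← sum_inner, ← sum_apply, ← map_sum, ← hb, map_sub, map_smul,
        sub_apply, inner_sub_left, map_sub, smul_apply,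
        ← hTdef]
      congr 1
      · have := re_inner_groupRingRep_sq π (laplacian S) η
        rw [adj_laplacian hS, ← sq] at this
        exact this.symm
      · rw [← Complex.coe_smul, inner_smul_left]
        simp
    have h2 : 0 ≤ ∑ i, ‖groupRingRep π (b i) η‖ ^ 2 := by positivity
    linarith
  have := le_re_inner_of_sq_ge T hpos hker ε hsq ξ
  have := hsum ξ
  linarith

end Hilbert

/-- For a unit vector the sum in `IsSpectralGap.le_sum_norm_sq` is at most `|S|` times its largest
term. -/
lemma IsSpectralGap.le_kazhdanConstant {S : Finset Γ} (hS : ∀ s ∈ S, s⁻¹ ∈ S)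
    (hgen : Subgroup.closure (S : Set Γ) = ⊤) {ε : ℝ} (h : IsSpectralGap S ε) :
    ENNReal.ofReal (√(2 * ε / S.card)) ≤ kazhdanConstant.{u} S := by
  unfold kazhdanConstant repKazhdanConstant
  refine le_iInf fun H => le_iInf fun _ => le_iInf fun _ => le_iInf fun _ => le_iInf fun π =>
    le_iInf fun hπ => le_iInf fun ξ => le_iInf fun hξ => ?_
  rcases S.eq_empty_or_nonempty with rfl | hne
  · simp
  have h1 := h.le_sum_norm_sq π hS hgen hπ ξ
  rw [hξ] at h1
  have hcard : (0 : ℝ) < S.card := by exact_mod_cast hne.card_pos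
  obtain ⟨s, hs, hle⟩ : ∃ s ∈ S, 2 * ε / S.card ≤ ‖(π s : H →L[ℂ] H) ξ - ξ‖ ^ 2 := by
    refine Finset.exists_le_of_sum_le hne ?_
    rw [Finset.sum_const, nsmul_eq_mul, mul_div_cancel₀ _ hcard.ne']
    linarith
  refine le_trans (ENNReal.ofReal_le_ofReal ?_) (le_iSup₂ (f := fun s (_ : s ∈ S) =>
    ENNReal.ofReal ‖(π s : H →L[ℂ] H) ξ - ξ‖) s hs)
  exact Real.sqrt_le_iff.2 ⟨norm_nonneg _, hle⟩

end

section

/-! ### Elementary matrices generate the special linear group over the integers -/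

open Matrix Matrix.SpecialLinearGroup

variable {n : ℕ}

lemma mem_elementaryMatrices {g : SpecialLinearGroup (Fin n) ℤ} :
    g ∈ elementaryMatrices n ↔
      ∃ (i j : Fin n) (h : i ≠ j) (a : ℤˣ), SpecialLinearGroup.transvection h (a : ℤ) = g := by
  simp only [elementaryMatrices, Finset.mem_image, Finset.mem_univ, true_and]
  constructor
  · rintro ⟨⟨⟨⟨i, j⟩, h⟩, a⟩, rfl⟩
    exact ⟨i, j, h, a, rfl⟩
  · rintro ⟨i, j, h, a, rfl⟩
    exact ⟨⟨⟨⟨i, j⟩, h⟩, a⟩, rfl⟩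

lemma inv_mem_elementaryMatrices {g : SpecialLinearGroup (Fin n) ℤ}
    (hg : g ∈ elementaryMatrices n) : g⁻¹ ∈ elementaryMatrices n := by
  obtain ⟨i, j, h, a, rfl⟩ := mem_elementaryMatrices.1 hg
  refine mem_elementaryMatrices.2 ⟨i, j, h, -a, ?_⟩
  rw [transvection_inv, Units.val_neg]

lemma transvection_apply_same {i j : Fin n} (h : i ≠ j) (a : ℤ) :
    (SpecialLinearGroup.transvection h a).1 i j = a := by
  rw [transvection_coe]
  simp [Matrix.one_apply_ne h]

lemma transvection_injective_right {i j : Fin n} (h : i ≠ j) :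
    Function.Injective fun a : ℤ => SpecialLinearGroup.transvection h a := fun a b hab => by
  have := transvection_apply_same h a
  rwa [show SpecialLinearGroup.transvection h a = SpecialLinearGroup.transvection h b from hab,
    transvection_apply_same, eq_comm] at this

lemma ne_inv_of_mem_elementaryMatrices {g : SpecialLinearGroup (Fin n) ℤ}
    (hg : g ∈ elementaryMatrices n) : g ≠ g⁻¹ := by
  obtain ⟨i, j, h, a, rfl⟩ := mem_elementaryMatrices.1 hg
  rw [transvection_inv]
  intro e
  have := transvection_injective_right h e
  have := a.ne_zero
  omega

lemma card_elementaryMatrices :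
    (elementaryMatrices n).card = Fintype.card ({p : Fin n × Fin n // p.1 ≠ p.2} × ℤˣ) := by
  rw [elementaryMatrices, Finset.card_image_of_injective _ ?_, Finset.card_univ]
  rintro ⟨⟨⟨i, j⟩, h⟩, a⟩ ⟨⟨⟨k, l⟩, h'⟩, b⟩ e
  have h1 := transvection_apply_same h (a : ℤ)
  have e' : SpecialLinearGroup.transvection h (a : ℤ) =
    SpecialLinearGroup.transvection h' (b : ℤ) := e
  have hij : i = k ∧ j = l := by
    by_contra hne
    rw [e'] at h1
    change (Matrix.transvection k l (b : ℤ)) i j = a at h1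
    rw [Matrix.transvection, Matrix.add_apply, Matrix.one_apply_ne h, zero_add,
      Matrix.single_apply_of_ne (h := by tauto)] at h1
    exact a.ne_zero h1.symm
  obtain ⟨rfl, rfl⟩ := hij
  have := Units.ext (transvection_injective_right h e')
  subst this
  rfl

lemma transvection_mem_closure {i j : Fin n} (h : i ≠ j) (a : ℤ) :
    SpecialLinearGroup.transvection h a ∈
      Subgroup.closure (elementaryMatrices n : Set (SpecialLinearGroup (Fin n) ℤ)) := by
  have h1 : ∀ e : ℤˣ, SpecialLinearGroup.transvection h (e : ℤ) ∈
      Subgroup.closure (elementaryMatrices n : Set (SpecialLinearGroup (Fin n) ℤ)) := fun e =>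
    Subgroup.subset_closure (mem_elementaryMatrices.2 ⟨i, j, h, e, rfl⟩)
  induction a using Int.induction_on with
  | zero => rw [transvection_coeff_zero]; exact Subgroup.one_mem _
  | succ k ih => rw [transvection_add]; exact Subgroup.mul_mem _ ih (h1 1)
  | pred k ih => rw [sub_eq_add_neg, transvection_add]; exact Subgroup.mul_mem _ ih (h1 (-1))

lemma transvection_mul_apply {i j : Fin n} (h : i ≠ j) (a : ℤ)
    (M : SpecialLinearGroup (Fin n) ℤ) (r l : Fin n) :
    (SpecialLinearGroup.transvection h a * M).1 r l
      = M.1 r l + if r = i then a * M.1 j l else 0 := by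
  change (Matrix.transvection i j a * M.1) r l = _
  split_ifs with hr
  · subst hr
    exact Matrix.transvection_mul_apply_same _ _ _ _ _
  · rw [add_zero]
    exact Matrix.transvection_mul_apply_of_ne _ _ _ _ hr _ _

/-- If the columns of `M ∈ SL(n, ℤ)` before column `k` are standard basis vectors and column `k` is
supported in the rows before `k` and in row `r`, then its entry in row `r` is a unit. -/
lemma isUnit_of_column (M : SpecialLinearGroup (Fin n) ℤ) (k r : Fin n)
    (hM : ∀ l < k, ∀ i, M.1 i l = if i = l then 1 else 0)
    (hr : ∀ i, k ≤ i → i ≠ r → M.1 i k = 0) : IsUnit (M.1 r k) := by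
  have hinv : (M⁻¹).1 * M.1 = 1 := congrArg Subtype.val (inv_mul_cancel M)
  have h1 : ∀ i < k, (M⁻¹).1 k i = 0 := fun i hi => by
    have := congrFun (congrFun hinv k) i
    rw [Matrix.mul_apply, Matrix.one_apply_ne hi.ne'] at this
    simpa [hM i hi] using this
  have h2 := congrFun (congrFun hinv k) k
  rw [Matrix.mul_apply, Matrix.one_apply_eq, Finset.sum_eq_single r] at h2
  · exact IsUnit.of_mul_eq_one_right _ h2
  · intro i _ hi
    rcases lt_or_ge i k with hik | hik
    · rw [h1 i hik, zero_mul]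
    · rw [hr i hik hi, mul_zero]
  · simp

/-- Gaussian elimination by integral row operations, one column after the other. -/
lemma mem_closure_of_columns (k : ℕ) (M : SpecialLinearGroup (Fin n) ℤ)
    (hM : ∀ l : Fin n, (l : ℕ) < k → ∀ i, M.1 i l = if i = l then 1 else 0) :
    M ∈ Subgroup.closure (elementaryMatrices n : Set (SpecialLinearGroup (Fin n) ℤ)) := by
  by_cases hk : n ≤ k
  · have : M = 1 := by
      ext i l
      rw [hM l (l.2.trans_le hk) i]
      simp [Matrix.one_apply]
    exact this ▸ Subgroup.one_mem _
  obtain ⟨K, rfl⟩ : ∃ K : Fin n, (K : ℕ) = k := ⟨⟨k, by omega⟩, rfl⟩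
  -- an elementary row operation whose source row is `K` or below keeps the first columns
  have hkeep : ∀ (M : SpecialLinearGroup (Fin n) ℤ) {i j : Fin n} (h : i ≠ j) (a : ℤ),
      (∀ l : Fin n, l < K → ∀ i, M.1 i l = if i = l then 1 else 0) → K ≤ j →
      ∀ l : Fin n, l < K → ∀ r, (SpecialLinearGroup.transvection h a * M).1 r l
        = if r = l then 1 else 0 := by
    intro M i j h a hM hj l hl r
    rw [transvection_mul_apply, hM l hl j, if_neg (hl.trans_le hj).ne', mul_zero, ite_self,
      add_zero, hM l hl]
  have hcancel : ∀ (M : SpecialLinearGroup (Fin n) ℤ) {i j : Fin n} (h : i ≠ j) (a : ℤ),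
      SpecialLinearGroup.transvection h a * M ∈
        Subgroup.closure (elementaryMatrices n : Set (SpecialLinearGroup (Fin n) ℤ)) →
      M ∈ Subgroup.closure (elementaryMatrices n : Set (SpecialLinearGroup (Fin n) ℤ)) :=
    fun M i j h a hmem => (Subgroup.mul_mem_cancel_left _ (transvection_mem_closure h a)).1 hmem
  have hnext : ∀ M : SpecialLinearGroup (Fin n) ℤ,
      (∀ l : Fin n, l < K → ∀ i, M.1 i l = if i = l then 1 else 0) →
      (∀ i, M.1 i K = if i = K then 1 else 0) →
      M ∈ Subgroup.closure (elementaryMatrices n : Set (SpecialLinearGroup (Fin n) ℤ)) := by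
    intro M hM hMK
    refine mem_closure_of_columns (K + 1) M fun l hl i => ?_
    rcases (Nat.lt_succ_iff.1 hl).lt_or_eq with h | h
    · exact hM l h i
    · rw [Fin.ext h]; exact hMK i
  replace hM : ∀ l : Fin n, l < K → ∀ i, M.1 i l = if i = l then 1 else 0 := hM
  induction hν : ∑ i, (M.1 i K).natAbs using Nat.strong_induction_on generalizing M with
  | _ ν ih =>
  subst hν
  by_cases hred : ∃ i j : Fin n, i ≠ j ∧ K ≤ j ∧ M.1 j K ≠ 0 ∧
      (M.1 j K).natAbs ≤ (M.1 i K).natAbs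
  · -- subtracting row `j` from row `i`, or adding it, decreases the entry in row `i`
    obtain ⟨i, j, hij, hj, hne, hle⟩ := hred
    obtain ⟨a, ha⟩ : ∃ a : ℤ, (M.1 i K + a * M.1 j K).natAbs < (M.1 i K).natAbs := by
      rcases le_total 0 (M.1 i K) with h1 | h1 <;> rcases le_total 0 (M.1 j K) with h2 | h2
      · exact ⟨-1, by omega⟩
      · exact ⟨1, by omega⟩
      · exact ⟨1, by omega⟩
      · exact ⟨-1, by omega⟩
    refine hcancel M hij a (ih _ ?_ _ (hkeep M hij a hM hj) rfl)
    refine Finset.sum_lt_sum (fun r _ => ?_) ⟨i, Finset.mem_univ i, ?_⟩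
    · rw [transvection_mul_apply]
      split_ifs with hr
      · rw [hr]; exact ha.le
      · rw [add_zero]
    · rw [transvection_mul_apply, if_pos rfl]; exact ha
  push Not at hred
  -- column `K` is now a unit multiple of a basis vector
  obtain ⟨r, hr, hrne⟩ : ∃ r, K ≤ r ∧ M.1 r K ≠ 0 := by
    by_contra! h
    exact (isUnit_of_column M K K hM fun i hi _ => h i hi).ne_zero (h K le_rfl)
  have hbelow : ∀ i, K ≤ i → i ≠ r → M.1 i K = 0 := by
    intro i hi hir
    by_contra hne
    exact lt_asymm (hred i r hir hr hrne) (hred r i hir.symm hi hne)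
  have hunit := isUnit_of_column M K r hM hbelow
  have hcol : ∀ i, i ≠ r → M.1 i K = 0 := by
    intro i hir
    have := hred i r hir hr hrne
    rw [Int.isUnit_iff_natAbs_eq.1 hunit] at this
    omega
  have hsq : M.1 r K * M.1 r K = 1 := Int.isUnit_mul_self hunit
  by_cases hrK : r = K
  · subst hrK
    rcases Int.isUnit_iff.1 hunit with h1 | h1
    · refine hnext M hM fun i => ?_
      split_ifs with h
      · rw [h, h1]
      · exact hcol i h
    · by_cases hlast : ∃ r' : Fin n, r < r'
      · obtain ⟨r', hr'⟩ := hlast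
        have h0 := hcol r' hr'.ne'
        -- the entries in the rows `r` and `r'` change from `(-1, 0)` to `(-1, 1)`, `(1, 1)` and
        -- `(1, 0)`
        refine hcancel M hr'.ne' (-1) (hcancel _ hr'.ne 2 (hcancel _ hr'.ne' (-1)
          (hnext _ (hkeep _ _ _ (hkeep _ _ _ (hkeep _ _ _ hM le_rfl) hr'.le) le_rfl) fun i => ?_)))
        by_cases hi : i = r
        · simp [transvection_mul_apply, hi, hr'.ne, h0, h1]
        by_cases hi' : i = r'
        · simp [transvection_mul_apply, hi', hr'.ne, hr'.ne', h0, h1]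
        · simp [transvection_mul_apply, hi, hi', hcol i hi]
      · exfalso
        have hdiag : M.1 = Matrix.diagonal fun i => if i = r then (-1 : ℤ) else 1 := by
          ext i l
          rcases lt_or_ge l r with hl | hl
          · rw [hM l hl i, Matrix.diagonal_apply]
            split_ifs with h3 h4 <;> simp_all
          · obtain rfl : l = r := le_antisymm (not_lt.1 fun h => hlast ⟨l, h⟩) hl
            rw [Matrix.diagonal_apply]
            split_ifs with h3
            · rw [h3, h1]
            · exact hcol i h3
        have hdet := M.2
        rw [hdiag, Matrix.det_diagonal, Finset.prod_ite_eq' Finset.univ r] at hdet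
        simp at hdet
  · -- the unit in row `r` makes the entry in row `K` equal to `1`, which then clears row `r`
    refine hcancel M (Ne.symm hrK) (M.1 r K) (hcancel _ hrK (-M.1 r K)
      (hnext _ (hkeep _ _ _ (hkeep _ _ _ hM hr) le_rfl) fun i => ?_))
    by_cases hi : i = K
    · simp [transvection_mul_apply, hi, Ne.symm hrK, hcol K (Ne.symm hrK), hsq]
    by_cases hi' : i = r
    · simp [transvection_mul_apply, hi', hrK, hcol K (Ne.symm hrK), hsq]
    · simp [transvection_mul_apply, hi, hi', hcol i hi']
termination_by n - k

lemma closure_elementaryMatrices :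
    Subgroup.closure (elementaryMatrices n : Set (SpecialLinearGroup (Fin n) ℤ)) = ⊤ :=
  (Subgroup.eq_top_iff' _).2 fun M => mem_closure_of_columns 0 M (by simp)

lemma card_elementaryMatrices_three : (elementaryMatrices 3).card = 12 := by
  rw [card_elementaryMatrices, Fintype.card_prod]; decide

lemma card_elementaryMatrices_four : (elementaryMatrices 4).card = 24 := by
  rw [card_elementaryMatrices, Fintype.card_prod]; decide

end

section

variable {Γ : Type v} [Group Γ]

/-! ### Symmetrization over a finite group of automorphisms -/

set_option linter.unusedSectionVars false

section Symmetrization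

variable {A : Type*} [Group A] [MulDistribMulAction A Γ]

/-- The action of an automorphism of `Γ` on the group ring. -/
def act (a : A) : Module.End ℝ (MonoidAlgebra ℝ Γ) :=
  MonoidAlgebra.mapDomainLinearMap ℝ ℝ fun g : Γ => a • g

lemma act_single (a : A) (g : Γ) (r : ℝ) :
    act a (MonoidAlgebra.single g r) = MonoidAlgebra.single (a • g) r :=
  MonoidAlgebra.mapDomainLinearMap_single _ _ _

lemma act_mul_apply (a b : A) (x : MonoidAlgebra ℝ Γ) : act (a * b) x = act a (act b x) := by
  induction x using MonoidAlgebra.induction_linear with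
  | zero => simp
  | add x y hx hy => simp only [map_add, hx, hy]
  | single g r => simp only [act_single, mul_smul]

lemma act_mul_end (a b : A) : act (Γ := Γ) (a * b) = act a * act b :=
  LinearMap.ext fun x => act_mul_apply a b x

lemma act_one_end : act (Γ := Γ) (1 : A) = 1 := by
  refine LinearMap.ext fun x => ?_
  induction x using MonoidAlgebra.induction_linear with
  | zero => simp
  | add x y hx hy => rw [map_add, map_add, hx, hy]
  | single g r => rw [act_single, one_smul]; rfl

lemma act_map_mul (a : A) (x y : MonoidAlgebra ℝ Γ) : act a (x * y) = act a x * act a y := by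
  induction x using MonoidAlgebra.induction_linear with
  | zero => simp
  | add x x' hx hx' => rw [add_mul, map_add, hx, hx', map_add, add_mul]
  | single g r =>
    induction y using MonoidAlgebra.induction_linear with
    | zero => simp
    | add y y' hy hy' => rw [mul_add, map_add, hy, hy', map_add, mul_add]
    | single h s =>
      simp only [act_single, MonoidAlgebra.single_mul_single, smul_mul']

lemma adj_act (a : A) (x : MonoidAlgebra ℝ Γ) : adj (act a x) = act a (adj x) := by
  induction x using MonoidAlgebra.induction_linear with
  | zero => simp [adj_zero]
  | add x y hx hy => simp only [map_add, adj_add, hx, hy]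
  | single g r => simp only [act_single, adj_single, smul_inv']

lemma augmentation_act (a : A) (x : MonoidAlgebra ℝ Γ) :
    augmentation (act a x) = augmentation x := by
  induction x using MonoidAlgebra.induction_linear with
  | zero => simp
  | add x y hx hy => simp only [map_add, augmentation_add, hx, hy]
  | single g r => simp only [act_single, augmentation_single]

/-- The involution as a linear map. -/
def adjLinear : Module.End ℝ (MonoidAlgebra ℝ Γ) where
  toFun := adj
  map_add' := adj_add
  map_smul' := adj_smul

variable [Fintype A]

variable (A) in
/-- The symmetrization `x ↦ ∑ a, a (x + x^*)` over the automorphisms in `A` and the involution. -/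
def symmetrize : Module.End ℝ (MonoidAlgebra ℝ Γ) :=
  (∑ a : A, act a) * (1 + adjLinear)

lemma symmetrize_apply (x : MonoidAlgebra ℝ Γ) :
    symmetrize A x = ∑ a : A, (act a x + act a (adj x)) := by
  rw [symmetrize, Module.End.mul_apply, LinearMap.sum_apply]
  exact Finset.sum_congr rfl fun a _ => map_add _ _ _

lemma symmetrize_adj (x : MonoidAlgebra ℝ Γ) : symmetrize A (adj x) = symmetrize A x := by
  simp only [symmetrize_apply, adj_adj, add_comm]

lemma symmetrize_act (a : A) (x : MonoidAlgebra ℝ Γ) :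
    symmetrize A (act a x) = symmetrize A x := by
  simp only [symmetrize_apply, adj_act, ← act_mul_apply]
  exact Fintype.sum_equiv (Equiv.mulRight a) _ _ fun _ => rfl

lemma symmetrize_of_invariant {x : MonoidAlgebra ℝ Γ} (hx : ∀ a : A, act a x = x)
    (hadj : adj x = x) : symmetrize A x = (2 * Fintype.card A : ℝ) • x := by
  rw [symmetrize_apply, hadj]
  simp only [hx, ← two_smul ℝ x, Finset.sum_const, Finset.card_univ]
  rw [← Nat.cast_smul_eq_nsmul ℝ, smul_smul, mul_comm]

variable (A) in
/-- The symmetrization of a group element: the sum, with multiplicities, over the orbits of `g` and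
of `g⁻¹`. It depends only on the orbit of `g` under `A` and the inversion. -/
def orbitSum (g : Γ) : MonoidAlgebra ℝ Γ := symmetrize A (MonoidAlgebra.single g 1)

lemma orbitSum_inv (g : Γ) : orbitSum A g⁻¹ = orbitSum A g := by
  rw [orbitSum, orbitSum, ← symmetrize_adj (A := A) (MonoidAlgebra.single g⁻¹ 1), adj_single,
    inv_inv]

lemma orbitSum_smul (a : A) (g : Γ) : orbitSum A (a • g) = orbitSum A g := by
  rw [orbitSum, orbitSum, ← act_single, symmetrize_act]

lemma l1Norm_orbitSum_le (g : Γ) : l1Norm (orbitSum A g) ≤ 2 * Fintype.card A := by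
  rw [orbitSum, symmetrize_apply]
  refine (l1Norm_sum_le _ _).trans ?_
  have : ∀ a ∈ (Finset.univ : Finset A), l1Norm (act a (MonoidAlgebra.single g (1 : ℝ)) +
      act a (adj (MonoidAlgebra.single g (1 : ℝ)))) ≤ 2 := fun a _ => by
    refine (l1Norm_add_le _ _).trans ?_
    rw [adj_single, act_single, act_single, l1Norm_single, l1Norm_single]
    norm_num
  refine (Finset.sum_le_card_nsmul _ _ _ this).trans ?_
  rw [nsmul_eq_mul, Finset.card_univ, mul_comm]

variable (A) in
/-- The symmetrized form `(x, y) ↦ ∑ a, a (x^* y + y^* x)`, with values in the group ring. -/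
def symForm : MonoidAlgebra ℝ Γ →ₗ[ℝ] MonoidAlgebra ℝ Γ →ₗ[ℝ] MonoidAlgebra ℝ Γ :=
  ((LinearMap.mul ℝ (MonoidAlgebra ℝ Γ)).comp adjLinear).compr₂ (symmetrize A)

lemma symForm_apply (x y : MonoidAlgebra ℝ Γ) : symForm A x y = symmetrize A (adj x * y) := rfl

lemma symForm_comm (x y : MonoidAlgebra ℝ Γ) : symForm A x y = symForm A y x := by
  rw [symForm_apply, symForm_apply, ← symmetrize_adj, adj_mul, adj_adj]

lemma symForm_act (a : A) (x y : MonoidAlgebra ℝ Γ) :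
    symForm A (act a x) (act a y) = symForm A x y := by
  rw [symForm_apply, symForm_apply, adj_act, ← act_map_mul, symmetrize_act]

lemma symForm_self (x : MonoidAlgebra ℝ Γ) :
    symForm A x x = (2 : ℝ) • ∑ a : A, adj (act a x) * act a x := by
  rw [symForm_apply, symmetrize_apply, Finset.smul_sum]
  refine Finset.sum_congr rfl fun a _ => ?_
  rw [adj_mul, adj_adj, ← two_smul ℝ, act_map_mul, adj_act]

/-- The element `g - 1` of the augmentation ideal. -/
def diff (g : Γ) : MonoidAlgebra ℝ Γ := MonoidAlgebra.single g 1 - 1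

/-- The form on two differences is a combination of four orbit sums. Only the orbit of the quotient
`g⁻¹ h` depends on more than the orbits of `g` and `h`. -/
lemma symForm_diff (g h : Γ) : symForm A (diff g) (diff h) =
    orbitSum A (g⁻¹ * h) - orbitSum A g - orbitSum A h + orbitSum A 1 := by
  rw [symForm_apply, diff, diff, adj_sub, adj_single, adj_one, mul_sub, sub_mul, sub_mul,
    MonoidAlgebra.single_mul_single, mul_one, mul_one, one_mul, one_mul, map_sub, map_sub, map_sub,
    MonoidAlgebra.one_def, ← orbitSum_inv g]
  simp only [orbitSum]
  abel

lemma act_diff (a : A) (g : Γ) : act a (diff g) = diff (a • g) := by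
  rw [diff, diff, map_sub, act_single, MonoidAlgebra.one_def, act_single, smul_one]

lemma augmentation_diff (g : Γ) : augmentation (diff g) = 0 := by
  rw [diff, augmentation_sub, MonoidAlgebra.one_def, augmentation_single, augmentation_single,
    sub_self]

end Symmetrization

/-! ### Isotypic projections of a group that is abelian on the image of one of its involutions -/

section Projection

/-- The product of the factors `1 + s t` over a list of pairs `(t, s)`. For commuting involutions
`t` and signs `s` it is, up to a power of `2`, the projection to the joint eigenspace `t = s`. -/
def isotypic {R : Type*} [Ring R] [Algebra ℝ R] (l : List (R × ℝ)) : R :=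
  (l.map fun p => 1 + p.2 • p.1).prod

variable {R : Type*} [Ring R] [Algebra ℝ R]

lemma isotypic_cons (p : R × ℝ) (l : List (R × ℝ)) :
    isotypic (p :: l) = (1 + p.2 • p.1) * isotypic l := by
  simp [isotypic]

lemma isotypic_append (l l' : List (R × ℝ)) :
    isotypic (l ++ l') = isotypic l * isotypic l' := by
  simp [isotypic]

/-- If `t` commutes with `D`, and with the members of `l` on the image of `D`, then it commutes with
`D * isotypic l`. -/
lemma commute_mul_isotypic {D t : R} {l : List (R × ℝ)} (ht : t * D = D * t)
    (hl : ∀ p ∈ l, p.1 * D = D * p.1) (hc : ∀ p ∈ l, t * p.1 * D = p.1 * t * D) :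
    t * (D * isotypic l) = D * isotypic l * t := by
  induction l with
  | nil => simpa [isotypic] using ht
  | cons q l ih =>
    have ih' := ih (fun p hp => hl p (by simp [hp])) (fun p hp => hc p (by simp [hp]))
    have hq := hl q (by simp)
    have h1 : t * (D * q.1 * isotypic l) = D * q.1 * isotypic l * t := by
      calc t * (D * q.1 * isotypic l) = t * q.1 * D * isotypic l := by
            rw [← hq]; simp only [mul_assoc]
        _ = q.1 * (t * (D * isotypic l)) := by
            rw [hc q (by simp)]; simp only [mul_assoc]
        _ = D * q.1 * isotypic l * t := by
            rw [ih', ← hq]; simp only [mul_assoc]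
    rw [isotypic_cons, add_mul, one_mul, mul_add, mul_add, ih', add_mul, smul_mul_assoc,
      mul_smul_comm, mul_smul_comm, ← mul_assoc D, h1, smul_mul_assoc]

/-- The image of `isotypic` lies in the joint eigenspace. The involutions need to commute only
modulo the first one, which acts trivially on that image. -/
lemma mul_isotypic {d : R} {l : List (R × ℝ)} (hd : d * d = 1) (hsq : ∀ p ∈ l, p.1 * p.1 = 1)
    (hs : ∀ p ∈ l, p.2 * p.2 = 1) (hcd : ∀ p ∈ l, p.1 * d = d * p.1)
    (hc : ∀ p ∈ l, ∀ q ∈ l, p.1 * q.1 = q.1 * p.1 ∨ p.1 * q.1 = q.1 * p.1 * d)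
    (p : R × ℝ) (hp : p ∈ (d, (1 : ℝ)) :: l) :
    p.1 * isotypic ((d, (1 : ℝ)) :: l) = p.2 • isotypic ((d, (1 : ℝ)) :: l) := by
  rw [isotypic_cons, one_smul]
  have hdD : d * (1 + d) = 1 + d := by rw [mul_add, mul_one, hd, add_comm]
  rcases List.mem_cons.1 hp with rfl | hp
  · rw [← mul_assoc, hdD, one_smul]
  have hD : ∀ q ∈ l, q.1 * (1 + d) = (1 + d) * q.1 := fun q hq => by
    rw [mul_add, add_mul, hcd q hq, mul_one, one_mul]
  obtain ⟨pre, post, rfl⟩ := List.append_of_mem hp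
  have h1 : p.1 * ((1 + d) * isotypic pre) = (1 + d) * isotypic pre * p.1 := by
    refine commute_mul_isotypic (hD p hp) (fun q hq => hD q (by simp [hq])) fun q hq => ?_
    rcases hc p hp q (by simp [hq]) with h | h
    · rw [h]
    · rw [h, mul_assoc, hdD]
  have h2 : p.1 * (1 + p.2 • p.1) = p.2 • (1 + p.2 • p.1) := by
    rw [mul_add, mul_one, mul_smul_comm, hsq p hp, smul_add, smul_smul, hs p hp, one_smul, add_comm]
  calc p.1 * ((1 + d) * isotypic (pre ++ p :: post))
      = p.1 * ((1 + d) * isotypic pre) * ((1 + p.2 • p.1) * isotypic post) := by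
        rw [isotypic_append, isotypic_cons]; simp only [mul_assoc]
    _ = (1 + d) * isotypic pre * (p.1 * (1 + p.2 • p.1)) * isotypic post := by
        rw [h1]; simp only [mul_assoc]
    _ = p.2 • ((1 + d) * isotypic (pre ++ p :: post)) := by
        rw [h2, isotypic_append, isotypic_cons]
        simp only [mul_assoc, smul_mul_assoc, mul_smul_comm]

end Projection

section Projection

variable {A : Type*} [Group A] [MulDistribMulAction A Γ] [Fintype A]

/-- Up to the factor `2 ^ l.length`, the operator `isotypic` is an orthogonal projection for the
symmetrized form. -/
lemma symForm_isotypic (l : List (A × ℝ)) (Q : Module.End ℝ (MonoidAlgebra ℝ Γ))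
    (hsq : ∀ p ∈ l, p.1 * p.1 = 1) (hs : ∀ p ∈ l, p.2 * p.2 = 1)
    (hQ : ∀ p ∈ l, act p.1 * Q = p.2 • Q) (x y : MonoidAlgebra ℝ Γ) :
    symForm A (isotypic (l.map fun p => (act (Γ := Γ) p.1, p.2)) x) (Q y)
      = (2 ^ l.length : ℝ) • symForm A x (Q y) := by
  induction l with
  | nil => simp [isotypic]
  | cons p l ih =>
    have ih' := ih (fun q hq => hsq q (by simp [hq])) (fun q hq => hs q (by simp [hq]))
      (fun q hq => hQ q (by simp [hq]))
    set z := isotypic (l.map fun p => (act (Γ := Γ) p.1, p.2)) x with hz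
    have h1 : symForm A (act p.1 z) (Q y) = p.2 • symForm A z (Q y) := by
      have h2 : act p.1 (act p.1 z) = z := by
        rw [← act_mul_apply, hsq p (by simp), act_one_end]; rfl
      have h3 : act p.1 (Q y) = p.2 • Q y := LinearMap.congr_fun (hQ p (by simp)) y
      rw [← symForm_act p.1, h2, h3, map_smul]
    rw [List.map_cons, isotypic_cons, Module.End.mul_apply, ← hz, LinearMap.add_apply,
      LinearMap.smul_apply, Module.End.one_apply, map_add, map_smul, LinearMap.add_apply,
      LinearMap.smul_apply, h1, smul_smul, hs p (by simp), one_smul, ← two_smul ℝ, ih', smul_smul,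
      List.length_cons, pow_succ']

end Projection

/-! ### Certified gaps from symmetrized sums of squares -/

section Certified

variable {A : Type*} [Group A] [MulDistribMulAction A Γ] [Fintype A]

lemma act_laplacian {S : Finset Γ} (hA : ∀ a : A, ∀ s ∈ S, a • s ∈ S) (a : A) :
    act a (laplacian S) = laplacian S := by
  rw [laplacian, map_sub, act_single, smul_one, map_sum]
  congr 1
  refine Finset.sum_bij (fun s _ => a • s) (hA a) (fun x _ y _ h => smul_left_cancel a h)
    (fun s hs => ⟨a⁻¹ • s, hA _ s hs, smul_inv_smul a s⟩) fun s _ => act_single _ _ _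

lemma smul_mem_wordBall {S : Finset Γ} (hA : ∀ a : A, ∀ s ∈ S, a • s ∈ S) (a : A) {d : ℕ} {g : Γ}
    (hg : g ∈ wordBall S d) : a • g ∈ wordBall S d := by
  obtain ⟨l, hl, hlS, rfl⟩ := hg
  refine ⟨l.map (a • ·), by simpa using hl, ?_, ?_⟩
  · intro s hs
    obtain ⟨t, ht, rfl⟩ := List.mem_map.1 hs
    exact hA a t (hlS t ht)
  · exact (map_list_prod (MulDistribMulAction.toMonoidHom Γ a) l).symm

lemma SupportedInBall.act {S : Finset Γ} (hA : ∀ a : A, ∀ s ∈ S, a • s ∈ S) (a : A) {d : ℕ}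
    {x : MonoidAlgebra ℝ Γ} (hx : SupportedInBall S d x) :
    SupportedInBall S d (KazhdanBounds.act a x) := by
  rw [eq_sum_single x, map_sum]
  refine .sum fun g hg => ?_
  rw [act_single]
  exact supportedInBall_single (smul_mem_wordBall hA a (hx g (by simpa using hg))) _

/-- It suffices to decompose `Δ² - ε₀ Δ` after symmetrization: the error is then a combination of
orbit sums, and its `ℓ¹`-norm is bounded by the coefficients of that combination. -/
lemma isCertifiedGap_of_symmetrize {S : Finset Γ} (hS : ∀ s ∈ S, s⁻¹ ∈ S)
    (hA : ∀ a : A, ∀ s ∈ S, a • s ∈ S) {d D : ℕ} (hd : d + d ≤ 2 ^ D) (hD : 2 ≤ 2 ^ D)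
    {ι κ : Type*} [Fintype ι] [Fintype κ] (u : ι → MonoidAlgebra ℝ Γ)
    (hu : ∀ i, SupportedInBall S d (u i)) (hu0 : ∀ i, augmentation (u i) = 0)
    (C : κ → ℝ) (r : κ → Γ) {q ε₀ ε : ℝ} (hq : 0 < q) (hε₀ : 0 < ε₀)
    (hsum : q • symmetrize A (laplacian S ^ 2 - ε₀ • laplacian S) - ∑ i, symForm A (u i) (u i)
      = ∑ k, C k • orbitSum A (r k))
    (hε : ε ≤ ε₀ - 2 ^ (2 * D - 1) * ((∑ k, |C k|) / q)) : IsCertifiedGap S d D ε := by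
  set N : ℝ := (Fintype.card A : ℝ) with hN
  have hN0 : 0 < N := by
    rw [hN]; exact_mod_cast Fintype.card_pos
  set w : ℝ := 1 / (N * q) with hw
  have hw0 : 0 ≤ w := by positivity
  let e := Fintype.equivFin (ι × A)
  let b : Fin (Fintype.card (ι × A)) → MonoidAlgebra ℝ Γ :=
    fun i => √w • act (e.symm i).2 (u (e.symm i).1)
  have hb : ∑ i, adj (b i) * b i = (w / 2) • ∑ i, symForm A (u i) (u i) := by
    have h1 : ∑ i, adj (b i) * b i
        = ∑ p : ι × A, w • (adj (act p.2 (u p.1)) * act p.2 (u p.1)) := by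
      refine Fintype.sum_equiv e.symm _ _ fun i => ?_
      rw [adj_smul, smul_mul_smul_comm, Real.mul_self_sqrt hw0]
    rw [h1, Fintype.sum_prod_type, Finset.smul_sum]
    refine Finset.sum_congr rfl fun i _ => ?_
    rw [symForm_self, ← Finset.smul_sum, smul_smul, div_mul_cancel₀ _ two_ne_zero]
  have hsymm : symmetrize A (laplacian S ^ 2 - ε₀ • laplacian S)
      = (2 * N) • (laplacian S ^ 2 - ε₀ • laplacian S) := by
    refine symmetrize_of_invariant (fun a => ?_) ?_
    · rw [map_sub, map_smul, sq, act_map_mul, act_laplacian hA]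
    · rw [adj_sub, adj_smul, sq, adj_mul, adj_laplacian hS]
  have hc : laplacian S ^ 2 - ε₀ • laplacian S - ∑ i, adj (b i) * b i
      = (w / 2) • ∑ k, C k • orbitSum A (r k) := by
    rw [hb, ← hsum, hsymm, smul_sub, smul_smul, smul_smul]
    congr 1
    rw [show w / 2 * q * (2 * N) = 1 by rw [hw]; field_simp, one_smul]
  have hbsupp : ∀ i, SupportedInBall S d (b i) := fun i => ((hu _).act hA _).smul _
  refine ⟨ε₀, _, b, _, hε₀, hbsupp, ?_, rfl, ?_, ?_⟩
  · rw [augmentation_sum]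
    refine Finset.sum_eq_zero fun i _ => ?_
    rw [augmentation_mul, augmentation_smul, augmentation_act, hu0]
    ring
  · have h1 : SupportedInBall S (2 ^ D) (laplacian S ^ 2) := by
      rw [sq]
      exact ((supportedInBall_laplacian S).mul (supportedInBall_laplacian S)).mono hD
    have h2 : SupportedInBall S (2 ^ D) (ε₀ • laplacian S) :=
      ((supportedInBall_laplacian S).mono (by omega)).smul ε₀
    have h3 : SupportedInBall S (2 ^ D) (∑ i, adj (b i) * b i) :=
      .sum fun i _ => (((hbsupp i).adj hS).mul (hbsupp i)).mono hd
    exact (h1.sub h2).sub h3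
  · refine hε.trans ?_
    rw [hc, l1Norm_smul, abs_of_nonneg (by positivity)]
    gcongr
    calc w / 2 * l1Norm (∑ k, C k • orbitSum A (r k))
        ≤ w / 2 * ∑ k, |C k| * (2 * N) := by
          gcongr
          refine (l1Norm_sum_le _ _).trans (Finset.sum_le_sum fun k _ => ?_)
          rw [l1Norm_smul]
          gcongr
          exact l1Norm_orbitSum_le _
      _ = (∑ k, |C k|) / q := by
          rw [← Finset.sum_mul, hw]
          field_simp

end Certified

end

section

/-! ### Integer codes for words in elementary matrices -/

/-- The row `i` of the letter `i + 4 j + 16 s`, which stands for the elementary matrix with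
entry `(-1) ^ s` at the place `(i, j)`. The operations `Nat.mod`, `Nat.div`, … are written without
the usual notation in this part, since these definitions are evaluated by the kernel. -/
def rowIdx (l : ℕ) : ℕ := Nat.mod l 4

/-- The column of a letter. -/
def colIdx (l : ℕ) : ℕ := Nat.mod (Nat.div l 4) 4

/-- The sign bit of a letter. -/
def signBit (l : ℕ) : ℕ := Nat.mod (Nat.div l 16) 2

/-- The letter with given row, column and sign bit. -/
def mkLetter (i j s : ℕ) : ℕ := Nat.add i (Nat.add (Nat.mul 4 j) (Nat.mul 16 s))

/-- A signed permutation of at most four coordinates, possibly composed with the inverse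
transpose. The permutation is packed in base `4`, the signs in base `2`, and `dual` is `0` if the
inverse transpose is not applied. -/
structure SignedPerm where
  perm : ℕ
  signs : ℕ
  dual : ℕ

/-- The image of `i` under the permutation packed in `p`. -/
def permAt (p i : ℕ) : ℕ := Nat.mod (Nat.div p (Nat.pow 4 i)) 4

/-- The `i`-th binary digit. -/
def bitAt (e i : ℕ) : ℕ := Nat.mod (Nat.div e (Nat.pow 2 i)) 2

/-- The action of a signed permutation on letters. -/
def SignedPerm.act (γ : SignedPerm) (l : ℕ) : ℕ :=
  (fun i j s => Nat.rec (mkLetter i j (Nat.mod (Nat.add s (Nat.add (bitAt γ.signs i)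
        (bitAt γ.signs j))) 2))
      (fun _ _ => mkLetter j i (Nat.mod (Nat.add 1 (Nat.add s (Nat.add (bitAt γ.signs i)
        (bitAt γ.signs j)))) 2)) γ.dual)
    (permAt γ.perm (rowIdx l)) (permAt γ.perm (colIdx l)) (signBit l)

/-- The effect of left multiplication by a letter on a packed column vector: the entries are
residues modulo `2 ^ 32`, and they are the digits in base `2 ^ 32`. -/
def rowOp (l N : ℕ) : ℕ :=
  (fun P x y => Nat.sub (Nat.add N (Nat.mul P (Nat.mod (Nat.rec (Nat.add x y)
      (fun _ _ => Nat.add x (Nat.sub 4294967296 y)) (signBit l)) 4294967296))) (Nat.mul P x))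
    (Nat.pow 4294967296 (rowIdx l))
    (Nat.mod (Nat.div N (Nat.pow 4294967296 (rowIdx l))) 4294967296)
    (Nat.mod (Nat.div N (Nat.pow 4294967296 (colIdx l))) 4294967296)

/-- The packed vector obtained by applying a word. -/
def wordKey (w : List ℕ) (N : ℕ) : ℕ := w.foldr rowOp N

/-- The packed vector obtained by applying the inverse of a word. -/
def invWordKey (w : List ℕ) (N : ℕ) : ℕ := w.foldl (fun N l => rowOp (Nat.xor 16 l) N) N

/-- The first `m` digits in base `2 ^ 18`. They serve as witnesses: each of them describes a group
element by its class and an automorphism, see `Frame.signedPerm`. -/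
def witnesses : ℕ → ℕ → List ℕ
  | 0, _ => []
  | m + 1, k => Nat.mod k 262144 :: witnesses m (Nat.div k 262144)

/-- A word of length at most the first argument, packed in base `32`. The number `0` is not a
letter, so that it marks the end of the word. -/
def unpackWord : ℕ → ℕ → List ℕ
  | 0, _ => []
  | m + 1, W => bif Nat.beq W 0 then [] else Nat.mod W 32 :: unpackWord m (Nat.div W 32)

/-- The data that are shared by all parts of a certificate: a table of classes, which are orbits of
group elements under the automorphisms and the inversion, and a list of automorphisms that are
involutions and commute modulo the central one. Their characters block-diagonalise the Gram
matrix. -/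
structure Frame where
  /-- The packed vector `(1, 256, …)`. -/
  start : ℕ
  /-- The permutations, packed in base `256`. -/
  perms : ℕ
  /-- The words that represent the classes of group elements, packed in base `2 ^ 20`. -/
  reps : ℕ
  /-- The number of classes. -/
  classes : ℕ
  /-- The number of characters. -/
  chars : ℕ
  /-- An involution modulo which the involutions in `gens` commute. -/
  central : SignedPerm
  /-- Further involutions with their signs under the characters. -/
  gens : List (SignedPerm × List ℤ)

/-- All involutions with their signs. The characters are trivial on the central involution. -/
def Frame.group (F : Frame) : List (SignedPerm × List ℤ) :=
  (F.central, List.replicate F.chars 1) :: F.gens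

/-- The word that represents a class. -/
def Frame.rep (F : Frame) (c : ℕ) : List ℕ :=
  unpackWord 4 (Nat.mod (Nat.div F.reps (Nat.pow 2 (Nat.mul 20 c))) 1048576)

/-- The signed permutation of a witness. A witness is the number `1024 c + 32 p + 4 e + 2 t + v`,
where `c` is a class, `p` the index of a permutation in the table `F.perms`, the signs are the
binary digits of `2 e` (the sign of the first coordinate can be taken to be trivial), and the bits
`t` and `v` tell whether the inverse transpose and the inverse are applied. -/
def Frame.signedPerm (F : Frame) (d : ℕ) : SignedPerm :=
  ⟨Nat.mod (Nat.div F.perms (Nat.pow 256 (Nat.mod (Nat.div d 32) 32))) 256,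
    Nat.mul 2 (Nat.mod (Nat.div d 4) 8), Nat.mod (Nat.div d 2) 2⟩

/-- The class of a witness. -/
def classIdx (d : ℕ) : ℕ := Nat.div d 1024

/-- The word of a witness: the representative of the class, transformed by the signed
permutation. -/
def Frame.witnessWord (F : Frame) (d : ℕ) : List ℕ :=
  (F.rep (classIdx d)).map (F.signedPerm d).act

/-- The packed vector of the group element of a witness. The last binary digit tells whether
the word or its inverse is meant. -/
def Frame.witnessKey (F : Frame) (d : ℕ) : ℕ :=
  Nat.rec (wordKey (F.witnessWord d) F.start) (fun _ _ => invWordKey (F.witnessWord d) F.start)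
    (Nat.mod d 2)

/-! ### Certificates -/

/-- The sum of two vectors of integers; missing entries are zero. -/
def addVec : List ℤ → List ℤ → List ℤ
  | x :: a, y :: b => Int.add x y :: addVec a b
  | [], b => b
  | a, [] => a

/-- The entrywise product of two vectors of integers. -/
def mulVec : List ℤ → List ℤ → List ℤ
  | x :: a, y :: b => Int.mul x y :: mulVec a b
  | _, _ => []

/-- The scalar product of two vectors of integers. -/
def dotVec : List ℤ → List ℤ → ℤ
  | x :: a, y :: b => Int.add (Int.mul x y) (dotVec a b)
  | _, _ => 0

/-- The representative of an orbit with its rows in the factors of the Gram matrices. -/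
structure OrbitRep where
  /-- A word of at most two letters. -/
  word : List ℕ
  /-- A witness for the word. -/
  cert : ℕ
  /-- For each character, the row of the factor. -/
  rows : List (List ℤ)
  /-- The witnesses for the quotients by the elements of this orbit of this representative and of
  the later ones. -/
  pairCerts : List ℕ

/-- The entries of the Gram matrices at a pair of representatives, for each character. -/
def gram (a b : List (List ℤ)) : List ℤ := List.zipWith dotVec a b

/-- The terms of the product of the operators `1 + s γ`, applied to a word. -/
def expand (m : ℕ) : List (SignedPerm × List ℤ) → List ℕ → List (List ℤ × List ℕ)
  | [], w => [(List.replicate m 1, w)]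
  | (γ, s) :: gs, w =>
    (fun E => E ++ E.map fun p => (mulVec s p.1, p.2.map γ.act)) (expand m gs w)

/-- Adds the vector `s` to the entry for the key `k`. -/
def insertKey (k : ℕ) (s : List ℤ) : List (ℕ × List ℤ) → List (ℕ × List ℤ)
  | [] => [(k, s)]
  | p :: t => bif Nat.beq k p.1 then (p.1, addVec s p.2) :: t else p :: insertKey k s t

/-- Collects the terms with the same key. -/
def collect (N : ℕ) (E : List (List ℤ × List ℕ)) : List (ℕ × List ℤ) :=
  E.foldr (fun p acc => insertKey (wordKey p.2 N) p.1 acc) []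

/-- The keys of the orbit of a representative, each with the sums of the signs over the characters
of the operators that map the representative to it. -/
def Frame.orbit (F : Frame) (r : OrbitRep) : List (ℕ × List ℤ) :=
  collect F.start (expand F.chars F.group r.word)

/-- The sum of the values of `φ` at a list of terms, which are pairs of a coefficient and a
class. -/
def sumTerms (φ : ℤ → ℕ → ℤ) : List (ℤ × ℕ) → ℤ
  | [] => 0
  | p :: l => Int.add (φ p.1 p.2) (sumTerms φ l)

/-- The terms for the quotients of the elements of an orbit by a representative. -/
def orbitTerms (M : List ℤ) (ys : List (ℕ × List ℤ)) (k : ℕ) : List (ℤ × ℕ) :=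
  List.zipWith (fun y d => (dotVec M y.2, classIdx d)) ys (witnesses ys.length k)

/-- The terms for a pair of representatives, as in `symForm_diff`. -/
def pairTerms (f : ℤ) (cr cc : ℕ) (M : List ℤ) (ys : List (ℕ × List ℤ)) (k : ℕ) : List (ℤ × ℕ) :=
  (fun t => (fun s => (s, 0) :: (Int.neg s, cr) :: (Int.neg s, cc) :: t)
   (sumTerms (fun z _ => z) t)) (orbitTerms (M.map (Int.mul f)) ys k)

/-- The sum over the terms for the pairs of `c` with a list of representatives. The factor is `f`
for the first one and `-2` for the others, which stand for two pairs each. -/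
def rowsTotal (φ : ℤ → ℕ → ℤ) (c : OrbitRep) (ys : List (ℕ × List ℤ)) :
    ℤ → List OrbitRep → List ℕ → ℤ
  | f, r :: rs, k :: ks =>
    Int.add
      (sumTerms φ (pairTerms f (classIdx r.cert) (classIdx c.cert) (gram r.rows c.rows) ys k))
      (rowsTotal φ c ys (-2) rs ks)
  | _, _, _ => 0

/-- The sum over the terms for the negative of the sum of squares. -/
def Frame.total (F : Frame) (φ : ℤ → ℕ → ℤ) : List OrbitRep → ℤ
  | [] => 0
  | r :: rs => Int.add (rowsTotal φ r (F.orbit r) (-1) (r :: rs) r.pairCerts) (F.total φ rs)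

/-- The test of a list of witnesses for the quotients of the elements of an orbit by the
representative `r`. -/
def Frame.quotientsOk (F : Frame) (r : OrbitRep) : List (ℕ × List ℤ) → List ℕ → Bool
  | y :: ys, d :: ds => Nat.blt (classIdx d) F.classes &&
      (Nat.beq (wordKey r.word (F.witnessKey d)) y.1 && F.quotientsOk r ys ds)
  | _, _ => true

/-- The test of the witnesses for the pairs of an orbit with a list of representatives. -/
def Frame.rowsOk (F : Frame) (ys : List (ℕ × List ℤ)) : List OrbitRep → List ℕ → Bool
  | r :: rs, k :: ks => F.quotientsOk r ys (witnesses ys.length k) && F.rowsOk ys rs ks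
  | [], [] => true
  | _, _ => false

/-- The test of all witnesses for pairs. -/
def Frame.pairsOk (F : Frame) : List OrbitRep → Bool
  | [] => true
  | r :: rs => F.rowsOk (F.orbit r) (r :: rs) r.pairCerts && F.pairsOk rs

/-- Encodes a coefficient `z` at the class `c`, so that the sum of the codes determines the sum of
the coefficients in each class: they are the balanced digits in base `2 ^ 96`. The absolute values
are added up above the `K` digits, which bounds the digits. -/
def packTerm (K : ℕ) (z : ℤ) (c : ℕ) : ℤ :=
  Int.add (Int.mul z (Int.ofNat (Nat.pow 2 (Nat.mul 96 c))))
    (Int.ofNat (Nat.mul z.natAbs (Nat.pow 2 (Nat.mul 96 K))))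

/-- The sum of the absolute values of the first balanced digits in base `2 ^ 96`; here
`39614081257132168796771975168` is `2 ^ 95`. -/
def absDigits : ℕ → ℕ → ℕ
  | 0, _ => 0
  | k + 1, T => (fun U => Nat.add (Nat.add
      (Nat.sub (Nat.mod U 79228162514264337593543950336) 39614081257132168796771975168)
      (Nat.sub 39614081257132168796771975168 (Nat.mod U 79228162514264337593543950336)))
        (absDigits k (Nat.div U 79228162514264337593543950336)))
    (Nat.add T 39614081257132168796771975168)

end

section

variable {Γ : Type v} [Group Γ]
open Matrix

/-! ### Automorphisms that preserve the generators -/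

section Aut

open scoped Pointwise

/-- The group of the automorphisms of `Γ` that map `S` onto itself. -/
abbrev AutStabilizer (S : Finset Γ) : Subgroup (MulAut Γ) :=
  MulAction.stabilizer (MulAut Γ) (S : Set Γ)

lemma mem_autStabilizer {S : Finset Γ} {a : MulAut Γ} :
    a ∈ AutStabilizer S ↔ ∀ s ∈ S, a s ∈ S :=
  MulAction.mem_stabilizer_set' S.finite_toSet

/-- An automorphism is determined by its values on a generating set. -/
lemma AutStabilizer.ext {S : Finset Γ} (hgen : Subgroup.closure (S : Set Γ) = ⊤)
    {a b : AutStabilizer S} (h : ∀ s ∈ S, a • s = b • s) : a = b := by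
  refine Subtype.ext (MulEquiv.toMonoidHom_injective ?_)
  exact MonoidHom.eq_of_eqOn_dense hgen fun s hs => h s hs

/-- The automorphisms that preserve a finite generating set embed in the maps of that set to
itself. -/
lemma AutStabilizer.finite {S : Finset Γ} (hgen : Subgroup.closure (S : Set Γ) = ⊤) :
    Finite (AutStabilizer S) := by
  refine Finite.of_injective
    (fun a : AutStabilizer S => fun s : S => (⟨a • s.1, mem_autStabilizer.1 a.2 _ s.2⟩ : S))
    fun a b hab => ?_
  exact AutStabilizer.ext hgen fun s hs => congrArg Subtype.val (congrFun hab ⟨s, hs⟩)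

end Aut

variable {n : ℕ}

/-- The automorphism of `SL(n, ℤ)` that permutes the coordinates. -/
def permAut (σ : Equiv.Perm (Fin n)) : MulAut (SpecialLinearGroup (Fin n) ℤ) where
  toFun M := ⟨M.1.submatrix σ.symm σ.symm, by rw [det_submatrix_equiv_self, M.2]⟩
  invFun M := ⟨M.1.submatrix σ σ, by rw [det_submatrix_equiv_self, M.2]⟩
  left_inv M := Subtype.ext (by simp)
  right_inv M := Subtype.ext (by simp)
  map_mul' M N := Subtype.ext (submatrix_mul_equiv M.1 N.1 σ.symm σ.symm σ.symm).symm

lemma permAut_transvection (σ : Equiv.Perm (Fin n)) {i j : Fin n} (h : i ≠ j) (a : ℤ) :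
    permAut σ (SpecialLinearGroup.transvection h a)
      = SpecialLinearGroup.transvection (σ.injective.ne h) a := by
  refine Subtype.ext ?_
  change (1 + single i j a).submatrix σ.symm σ.symm = 1 + single (σ i) (σ j) a
  ext k l
  simp [submatrix_apply, Matrix.add_apply, one_apply, single_apply, Equiv.eq_symm_apply]

lemma diagonal_signs_mul_self (e : Fin n → ℤˣ) :
    diagonal (fun i => (e i : ℤ)) * diagonal (fun i => (e i : ℤ)) = 1 := by
  rw [diagonal_mul_diagonal, ← diagonal_one]
  congr 1
  ext i
  rw [← Units.val_mul, Int.units_mul_self, Units.val_one]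

lemma diagonal_signs_conj_conj (e : Fin n → ℤˣ) (M : Matrix (Fin n) (Fin n) ℤ) :
    diagonal (fun i => (e i : ℤ)) * (diagonal (fun i => (e i : ℤ)) * M *
      diagonal (fun i => (e i : ℤ))) * diagonal (fun i => (e i : ℤ)) = M := by
  have h := diagonal_signs_mul_self e
  rw [mul_assoc, mul_assoc, mul_assoc, h, mul_one, ← mul_assoc, h, one_mul]

/-- Conjugation of `SL(n, ℤ)` by a diagonal matrix of signs. -/
def signAut (e : Fin n → ℤˣ) : MulAut (SpecialLinearGroup (Fin n) ℤ) where
  toFun M := ⟨diagonal (fun i => (e i : ℤ)) * M.1 * diagonal (fun i => (e i : ℤ)), by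
    rw [det_mul_comm, ← mul_assoc, diagonal_signs_mul_self, one_mul, M.2]⟩
  invFun M := ⟨diagonal (fun i => (e i : ℤ)) * M.1 * diagonal (fun i => (e i : ℤ)), by
    rw [det_mul_comm, ← mul_assoc, diagonal_signs_mul_self, one_mul, M.2]⟩
  left_inv M := Subtype.ext (diagonal_signs_conj_conj e M.1)
  right_inv M := Subtype.ext (diagonal_signs_conj_conj e M.1)
  map_mul' M N := Subtype.ext <| by
    change _ * (M.1 * N.1) * _ = _ * M.1 * _ * (_ * N.1 * _)
    have h := diagonal_signs_mul_self e
    simp only [mul_assoc]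
    rw [← mul_assoc (diagonal _) (diagonal _), h, one_mul]

lemma signAut_transvection (e : Fin n → ℤˣ) {i j : Fin n} (h : i ≠ j) (a : ℤ) :
    signAut e (SpecialLinearGroup.transvection h a)
      = SpecialLinearGroup.transvection h (e i * a * e j) := by
  refine Subtype.ext ?_
  change diagonal _ * (1 + single i j a) * diagonal _ = 1 + single i j _
  rw [mul_add, add_mul, mul_one, diagonal_signs_mul_self]
  congr 1
  ext k l
  rw [mul_diagonal, diagonal_mul]
  by_cases hk : i = k <;> by_cases hl : j = l <;> simp [hk, hl]

lemma transpose_inv_transpose_inv (M : SpecialLinearGroup (Fin n) ℤ) :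
    M⁻¹.transpose⁻¹.transpose = M := by
  refine Subtype.ext ?_
  change (adjugate ((adjugate M.1)ᵀ))ᵀ = M.1
  rw [← adjugate_transpose, transpose_transpose]
  exact congrArg Subtype.val (inv_inv M)

/-- The inverse transpose. -/
def dualAut : MulAut (SpecialLinearGroup (Fin n) ℤ) where
  toFun M := M⁻¹.transpose
  invFun M := M⁻¹.transpose
  left_inv M := transpose_inv_transpose_inv M
  right_inv M := transpose_inv_transpose_inv M
  map_mul' M N := Subtype.ext <| by
    rw [_root_.mul_inv_rev]
    exact transpose_mul (N⁻¹).1 (M⁻¹).1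

lemma dualAut_transvection {i j : Fin n} (h : i ≠ j) (a : ℤ) :
    dualAut (SpecialLinearGroup.transvection h a)
      = SpecialLinearGroup.transvection h.symm (-a) := by
  refine Subtype.ext ?_
  change ((SpecialLinearGroup.transvection h a)⁻¹).1ᵀ = 1 + single j i (-a)
  rw [SpecialLinearGroup.transvection_inv]
  change (1 + single i j (-a))ᵀ = _
  rw [transpose_add, transpose_one, transpose_single]

/-! ### Letters and signed permutations -/

/-- The codes of the elementary `n × n` matrices. -/
def IsLetter (n l : ℕ) : Prop :=
  rowIdx l < n ∧ colIdx l < n ∧ rowIdx l ≠ colIdx l ∧ l < 32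

instance (n l : ℕ) : Decidable (IsLetter n l) := by unfold IsLetter; infer_instance

/-- The elementary matrix for a letter; the identity matrix for a number that is not a letter. -/
def letter (n l : ℕ) : SpecialLinearGroup (Fin n) ℤ :=
  if h : IsLetter n l then
    SpecialLinearGroup.transvection (i := ⟨rowIdx l, h.1⟩) (j := ⟨colIdx l, h.2.1⟩)
      (fun e => h.2.2.1 (congrArg Fin.val e)) (((-1) ^ signBit l : ℤˣ) : ℤ)
  else 1

lemma letter_mk (hn : n ≤ 4) {i j : Fin n} (h : i ≠ j) {s : ℕ} (hs : s < 2) :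
    IsLetter n (mkLetter i j s) ∧ letter n (mkLetter i j s)
      = SpecialLinearGroup.transvection h (((-1) ^ s : ℤˣ) : ℤ) := by
  have hi : rowIdx (mkLetter i j s) = i := by
    change (i + (4 * j + 16 * s)) % 4 = (i : ℕ)
    omega
  have hj : colIdx (mkLetter i j s) = j := by
    change (i + (4 * j + 16 * s)) / 4 % 4 = (j : ℕ)
    omega
  have hs' : signBit (mkLetter i j s) = s := by
    change (i + (4 * j + 16 * s)) / 16 % 2 = s
    omega
  have hl : IsLetter n (mkLetter i j s) := by
    refine ⟨by rw [hi]; exact i.2, by rw [hj]; exact j.2, ?_, ?_⟩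
    · rw [hi, hj]; exact fun e => h (Fin.ext e)
    · change i + (4 * j + 16 * s) < 32
      omega
  refine ⟨hl, ?_⟩
  rw [letter, dif_pos hl]
  simp only [hi, hj, hs']

lemma IsLetter.eq_mk {l : ℕ} (h : IsLetter n l) :
    l = mkLetter (rowIdx l) (colIdx l) (signBit l) := by
  change l = l % 4 + (4 * (l / 4 % 4) + 16 * (l / 16 % 2))
  have := h.2.2.2
  omega

lemma letter_mem {l : ℕ} (h : IsLetter n l) : letter n l ∈ elementaryMatrices n := by
  rw [letter, dif_pos h]
  exact mem_elementaryMatrices.2 ⟨_, _, _, _, rfl⟩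

lemma exists_letter (hn : n ≤ 4) {g : SpecialLinearGroup (Fin n) ℤ}
    (hg : g ∈ elementaryMatrices n) : ∃ l, IsLetter n l ∧ letter n l = g := by
  obtain ⟨i, j, h, a, rfl⟩ := mem_elementaryMatrices.1 hg
  rcases Int.units_eq_one_or a with rfl | rfl
  · exact ⟨_, (letter_mk hn h (s := 0) (by norm_num)).imp_right fun e => by rw [e, pow_zero]⟩
  · exact ⟨_, (letter_mk hn h (s := 1) (by norm_num)).imp_right fun e => by rw [e, pow_one]⟩

/-- The group of automorphisms of `SL(n, ℤ)` that preserve the set of elementary matrices. -/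
abbrev Aut (n : ℕ) := AutStabilizer (elementaryMatrices n)

instance : Finite (Aut n) := AutStabilizer.finite closure_elementaryMatrices

instance : Fintype (Aut n) := Fintype.ofFinite _

/-- The packed number `p` is a permutation of the numbers less than `n`. -/
def IsPerm (n p : ℕ) : Prop :=
  (∀ i < n, permAt p i < n) ∧ ∀ i < n, ∀ j < n, permAt p i = permAt p j → i = j

instance (n p : ℕ) : Decidable (IsPerm n p) := by unfold IsPerm; infer_instance

lemma mem_aut_of_transvection {a : MulAut (SpecialLinearGroup (Fin n) ℤ)}
    (h : ∀ (i j : Fin n) (h : i ≠ j) (e : ℤˣ), ∃ (k l : Fin n) (h' : k ≠ l) (e' : ℤˣ),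
      a (SpecialLinearGroup.transvection h (e : ℤ)) =
        SpecialLinearGroup.transvection h' (e' : ℤ)) : a ∈ Aut n := by
  refine mem_autStabilizer.2 fun s hs => ?_
  obtain ⟨i, j, hij, e, rfl⟩ := mem_elementaryMatrices.1 hs
  obtain ⟨k, l, hkl, e', h'⟩ := h i j hij e
  exact mem_elementaryMatrices.2 ⟨k, l, hkl, e', h'.symm⟩

/-- Signed permutations, with or without the inverse transpose, are automorphisms of `SL(n, ℤ)`,
and their effect on the elementary matrices is the action on letters. -/
lemma SignedPerm.exists_aut (hn : n ≤ 4) (γ : SignedPerm) (hγ : IsPerm n γ.perm) :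
    ∃ a : Aut n, ∀ l, IsLetter n l →
      IsLetter n (γ.act l) ∧ a • letter n l = letter n (γ.act l) := by
  let f : Fin n → Fin n := fun i => ⟨permAt γ.perm i, hγ.1 i i.2⟩
  have hf : Function.Injective f := fun i j h =>
    Fin.ext (hγ.2 i i.2 j j.2 (congrArg Fin.val h))
  let σ : Equiv.Perm (Fin n) := Equiv.ofBijective f (Finite.injective_iff_bijective.1 hf)
  let e : Fin n → ℤˣ := fun i => (-1) ^ bitAt γ.signs i
  have hb : permAut σ ∈ Aut n := mem_aut_of_transvection fun i j h s =>
    ⟨_, _, _, s, permAut_transvection σ h s⟩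
  have hc : signAut e ∈ Aut n := mem_aut_of_transvection fun i j h s =>
    ⟨_, _, h, e i * s * e j, by rw [signAut_transvection]; push_cast; rfl⟩
  have hd : dualAut ∈ Aut n := mem_aut_of_transvection fun i j h s =>
    ⟨_, _, h.symm, -s, by rw [dualAut_transvection]; push_cast; rfl⟩
  have hodd : ∀ m : ℕ, ((-1) ^ (m % 2) : ℤˣ) = (-1) ^ m := fun m =>
    (Int.units_pow_eq_pow_mod_two _ m).symm
  have key : ∀ l (hl : IsLetter n l), ∃ h : σ ⟨rowIdx l, hl.1⟩ ≠ σ ⟨colIdx l, hl.2.1⟩,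
      signAut e (permAut σ (letter n l)) = SpecialLinearGroup.transvection h
        (((-1) ^ (signBit l + (bitAt γ.signs (permAt γ.perm (rowIdx l)) +
          bitAt γ.signs (permAt γ.perm (colIdx l)))) : ℤˣ) : ℤ) := by
    intro l hl
    refine ⟨σ.injective.ne fun h => hl.2.2.1 (congrArg Fin.val h), ?_⟩
    rw [letter, dif_pos hl, permAut_transvection, signAut_transvection]
    congr 1
    rw [pow_add, pow_add]
    push_cast
    change (((-1) ^ bitAt γ.signs (permAt γ.perm (rowIdx l)) : ℤˣ) : ℤ) * _ *
      (((-1) ^ bitAt γ.signs (permAt γ.perm (colIdx l)) : ℤˣ) : ℤ) = _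
    push_cast
    ring
  rcases hdual : γ.dual with _ | m
  · refine ⟨⟨signAut e, hc⟩ * ⟨permAut σ, hb⟩, fun l hl => ?_⟩
    obtain ⟨h, hh⟩ := key l hl
    obtain ⟨h1, h2⟩ := letter_mk hn h (s := (signBit l + (bitAt γ.signs (permAt γ.perm (rowIdx l)) +
          bitAt γ.signs (permAt γ.perm (colIdx l)))) % 2) (Nat.mod_lt _ two_pos)
    have hact : γ.act l = mkLetter (σ ⟨rowIdx l, hl.1⟩) (σ ⟨colIdx l, hl.2.1⟩)
        ((signBit l + (bitAt γ.signs (permAt γ.perm (rowIdx l)) +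
          bitAt γ.signs (permAt γ.perm (colIdx l)))) % 2) := by
      rw [SignedPerm.act, hdual]; rfl
    rw [hact]
    refine ⟨h1, ?_⟩
    rw [h2, hodd]
    exact hh
  · refine ⟨⟨dualAut, hd⟩ * (⟨signAut e, hc⟩ * ⟨permAut σ, hb⟩), fun l hl => ?_⟩
    obtain ⟨h, hh⟩ := key l hl
    obtain ⟨h1, h2⟩ := letter_mk hn h.symm (s := (1 + (signBit l +
      (bitAt γ.signs (permAt γ.perm (rowIdx l)) +
          bitAt γ.signs (permAt γ.perm (colIdx l))))) % 2) (Nat.mod_lt _ two_pos)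
    have hact : γ.act l = mkLetter (σ ⟨colIdx l, hl.2.1⟩) (σ ⟨rowIdx l, hl.1⟩)
        ((1 + (signBit l + (bitAt γ.signs (permAt γ.perm (rowIdx l)) +
          bitAt γ.signs (permAt γ.perm (colIdx l))))) % 2) := by
      rw [SignedPerm.act, hdual]; rfl
    rw [hact]
    refine ⟨h1, ?_⟩
    rw [h2, hodd, pow_add]
    change dualAut (signAut e (permAut σ (letter n l))) = _
    rw [hh, dualAut_transvection]
    congr 1
    push_cast
    ring

/-- The automorphism given by a signed permutation. -/
def SignedPerm.aut (n : ℕ) (γ : SignedPerm) : Aut n :=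
  if h : n ≤ 4 ∧ IsPerm n γ.perm then (γ.exists_aut h.1 h.2).choose else 1

lemma SignedPerm.aut_spec (hn : n ≤ 4) {γ : SignedPerm} (hγ : IsPerm n γ.perm) {l : ℕ}
    (hl : IsLetter n l) : IsLetter n (γ.act l) ∧ γ.aut n • letter n l = letter n (γ.act l) := by
  rw [SignedPerm.aut, dif_pos ⟨hn, hγ⟩]
  exact (γ.exists_aut hn hγ).choose_spec l hl

end

section

variable {Γ : Type v} [Group Γ]
open Matrix
variable {n : ℕ}

/-! ### Words and their keys -/

/-- The product of the letters of a word. -/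
def word (n : ℕ) (w : List ℕ) : SpecialLinearGroup (Fin n) ℤ := (w.map (letter n)).prod

lemma word_nil : word n [] = 1 := rfl

lemma word_cons (l : ℕ) (w : List ℕ) : word n (l :: w) = letter n l * word n w := rfl

lemma isLetter_map_act (hn : n ≤ 4) {γ : SignedPerm} (hγ : IsPerm n γ.perm) {w : List ℕ}
    (hw : ∀ l ∈ w, IsLetter n l) : ∀ l ∈ w.map γ.act, IsLetter n l := by
  intro l hl
  obtain ⟨k, hk, rfl⟩ := List.mem_map.1 hl
  exact (SignedPerm.aut_spec hn hγ (hw k hk)).1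

lemma smul_word (hn : n ≤ 4) {γ : SignedPerm} (hγ : IsPerm n γ.perm) {w : List ℕ}
    (hw : ∀ l ∈ w, IsLetter n l) : γ.aut n • word n w = word n (w.map γ.act) := by
  induction w with
  | nil => exact smul_one _
  | cons l w ih =>
    rw [word_cons, smul_mul', ih fun k hk => hw k (by simp [hk]),
      (SignedPerm.aut_spec hn hγ (hw l (by simp))).2, List.map_cons, word_cons]

lemma word_mem_wordBall {w : List ℕ} (hw : ∀ l ∈ w, IsLetter n l) :
    word n w ∈ wordBall (elementaryMatrices n) w.length := by
  refine ⟨w.map (letter n), by simp, fun s hs => ?_, rfl⟩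
  obtain ⟨l, hl, rfl⟩ := List.mem_map.1 hs
  exact letter_mem (hw l hl)

/-- The entries of a product of `d` elementary matrices are bounded by `2 ^ d`. -/
lemma abs_le_of_mem_wordBall {d : ℕ} {g : SpecialLinearGroup (Fin n) ℤ}
    (hg : g ∈ wordBall (elementaryMatrices n) d) (i j : Fin n) : |g.1 i j| ≤ 2 ^ d := by
  obtain ⟨l, hl, hS, rfl⟩ := hg
  refine le_trans ?_ (pow_le_pow_right₀ one_le_two hl)
  clear hl
  induction l generalizing i with
  | nil =>
    change |(1 : Matrix (Fin n) (Fin n) ℤ) i j| ≤ _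
    rw [one_apply]
    split_ifs <;> simp
  | cons s l ih =>
    obtain ⟨k, m, h, a, rfl⟩ := mem_elementaryMatrices.1 (hS s (by simp))
    have ih := fun i => ih i fun t ht => hS t (by simp [ht])
    rw [List.prod_cons, transvection_mul_apply, List.length_cons, pow_succ, mul_two]
    refine (abs_add_le _ _).trans (add_le_add (ih i) ?_)
    split_ifs
    · rw [abs_mul, show |(a : ℤ)| = 1 by rcases Int.units_eq_one_or a with rfl | rfl <;> rfl,
        one_mul]
      exact ih m
    · simp

/-- The `i`-th entry of the product of `g` with the vector `(1, 256, 256², …)`. When the entries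
of `g` are small, they are the balanced digits of this number in base `256`. -/
def rowValue (g : SpecialLinearGroup (Fin n) ℤ) (i : Fin n) : ℤ :=
  ∑ j : Fin n, g.1 i j * 256 ^ (j : ℕ)

/-- The number with digits `k 0, …, k 3` in base `2 ^ 32`. -/
def packDigits (k : ℕ → ℕ) : ℕ :=
  k 0 + 4294967296 * k 1 + 18446744073709551616 * k 2 + 79228162514264337593543950336 * k 3

/-- The packed vector `N` consists of the residues of the entries `rowValue g i`. -/
def IsKey (g : SpecialLinearGroup (Fin n) ℤ) (N : ℕ) : Prop :=
  ∃ k : ℕ → ℕ, (∀ i, k i < 4294967296) ∧ N = packDigits k ∧ (∀ i, n ≤ i → k i = 0) ∧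
    ∀ i : Fin n, (k i : ℤ) ≡ rowValue g i [ZMOD 4294967296]

lemma packDigits_div_mod {k : ℕ → ℕ} (hk : ∀ i, k i < 4294967296) {i : ℕ} (hi : i < 4) :
    packDigits k / 4294967296 ^ i % 4294967296 = k i := by
  have h0 := hk 0
  have h1 := hk 1
  have h2 := hk 2
  have h3 := hk 3
  unfold packDigits
  interval_cases i <;> norm_num only <;> omega

lemma packDigits_update (k : ℕ → ℕ) {i : ℕ} (hi : i < 4) (z : ℕ) :
    packDigits k + 4294967296 ^ i * z - 4294967296 ^ i * k i
      = packDigits (Function.update k i z) := by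
  unfold packDigits
  interval_cases i <;> simp only [Function.update_apply] <;> norm_num <;> omega

lemma rowValue_transvection_mul {i j : Fin n} (h : i ≠ j) (a : ℤ)
    (g : SpecialLinearGroup (Fin n) ℤ) (r : Fin n) :
    rowValue (SpecialLinearGroup.transvection h a * g) r
      = rowValue g r + if r = i then a * rowValue g j else 0 := by
  simp only [rowValue, transvection_mul_apply]
  split_ifs
  · simp only [add_mul, Finset.sum_add_distrib, Finset.mul_sum, mul_assoc]
  · simp only [add_zero]

/-- The definition of `rowOp` in the usual notation. -/
lemma rowOp_eq (l N : ℕ) : rowOp l N = N + 4294967296 ^ rowIdx l *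
    ((if signBit l = 0 then N / 4294967296 ^ rowIdx l % 4294967296 +
        N / 4294967296 ^ colIdx l % 4294967296
      else N / 4294967296 ^ rowIdx l % 4294967296 +
        (4294967296 - N / 4294967296 ^ colIdx l % 4294967296)) % 4294967296) -
    4294967296 ^ rowIdx l * (N / 4294967296 ^ rowIdx l % 4294967296) := by
  unfold rowOp
  rcases signBit l with _ | m <;> rfl

/-- The operation `rowOp` on keys is left multiplication by an elementary matrix. -/
lemma IsKey.rowOp (hn : n ≤ 4) {g : SpecialLinearGroup (Fin n) ℤ} {N : ℕ} (hg : IsKey g N) {l : ℕ}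
    (hl : IsLetter n l) : IsKey (letter n l * g) (rowOp l N) := by
  obtain ⟨k, hk, rfl, hk0, hgk⟩ := hg
  have hi := hl.1
  have hj := hl.2.1
  rw [rowOp_eq, packDigits_div_mod hk (hi.trans_le hn), packDigits_div_mod hk (hj.trans_le hn),
    packDigits_update k (hi.trans_le hn)]
  refine ⟨_, fun i => ?_, rfl, fun i hni => ?_, fun i => ?_⟩
  · rw [Function.update_apply]
    split_ifs
    exacts [Nat.mod_lt _ (by norm_num), Nat.mod_lt _ (by norm_num), hk i]
  · rw [Function.update_of_ne (by omega), hk0 i hni]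
  · rw [letter, dif_pos hl, rowValue_transvection_mul, Function.update_apply]
    by_cases h : i = ⟨rowIdx l, hi⟩
    · have h' : (i : ℕ) = rowIdx l := congrArg Fin.val h
      rw [if_pos h, if_pos h', ← h']
      have hkj := hgk ⟨colIdx l, hj⟩
      have hki := hgk i
      split_ifs with hs
      · rw [hs]
        push_cast
        rw [one_mul]
        exact (Int.mod_modEq _ _).trans (hki.add hkj)
      · have hs' : signBit l = 1 := by
          have : signBit l < 2 := Nat.mod_lt _ two_pos
          omega
        rw [hs', Int.natCast_mod, Nat.cast_add, Nat.cast_sub (hk _).le]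
        refine (Int.mod_modEq _ _).trans (hki.add ?_)
        have h1 : ((4294967296 : ℕ) : ℤ) - (k (colIdx l) : ℤ) ≡ 0 - rowValue g ⟨colIdx l, hj⟩
            [ZMOD 4294967296] := by
          refine Int.ModEq.sub ?_ hkj
          exact (Int.modEq_zero_iff_dvd).2 (dvd_refl _)
        simpa using h1
    · have h' : (i : ℕ) ≠ rowIdx l := fun e => h (Fin.ext e)
      rw [if_neg h, if_neg h', add_zero]
      exact hgk i

lemma IsKey.wordKey (hn : n ≤ 4) {g : SpecialLinearGroup (Fin n) ℤ} {N : ℕ} (hg : IsKey g N)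
    {w : List ℕ} (hw : ∀ l ∈ w, IsLetter n l) : IsKey (word n w * g) (wordKey w N) := by
  induction w with
  | nil => rwa [word_nil, one_mul]
  | cons l w ih =>
    rw [word_cons, mul_assoc]
    exact (ih fun k hk => hw k (by simp [hk])).rowOp hn (hw l (by simp))

/-- The inverse of an elementary matrix has the opposite sign bit, which has the place value
`16`. -/
lemma xor_letter (hn : n ≤ 4) {l : ℕ} (hl : IsLetter n l) :
    IsLetter n (Nat.xor 16 l) ∧ letter n (Nat.xor 16 l) = (letter n l)⁻¹ := by
  have key : ∀ l < 32, Nat.xor 16 l = mkLetter (rowIdx l) (colIdx l) (1 - signBit l) := by decide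
  have h2 : signBit l < 2 := Nat.mod_lt _ two_pos
  have hne : (⟨rowIdx l, hl.1⟩ : Fin n) ≠ ⟨colIdx l, hl.2.1⟩ := fun e =>
    hl.2.2.1 (congrArg Fin.val e)
  obtain ⟨h3, h4⟩ := letter_mk hn hne (s := 1 - signBit l) (by omega)
  rw [key l hl.2.2.2]
  refine ⟨h3, h4.trans ?_⟩
  rw [letter, dif_pos hl, SpecialLinearGroup.transvection_inv]
  congr 1
  interval_cases signBit l <;> rfl

lemma IsKey.invWordKey (hn : n ≤ 4) {g : SpecialLinearGroup (Fin n) ℤ} {N : ℕ} (hg : IsKey g N)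
    {w : List ℕ} (hw : ∀ l ∈ w, IsLetter n l) : IsKey ((word n w)⁻¹ * g) (invWordKey w N) := by
  induction w generalizing g N with
  | nil => rwa [word_nil, inv_one, one_mul]
  | cons l w ih =>
    obtain ⟨h1, h2⟩ := xor_letter hn (hw l (by simp))
    rw [word_cons, _root_.mul_inv_rev, mul_assoc, ← h2]
    exact ih (hg.rowOp hn h1) fun k hk => hw k (by simp [hk])

/-- A matrix is determined by its key when its entries are small: two products of at most six
elementary matrices have entries of absolute value at most `64`. -/
lemma IsKey.eq (hn : n ≤ 4) {g h : SpecialLinearGroup (Fin n) ℤ} {N : ℕ} (hg : IsKey g N)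
    (hh : IsKey h N) (hgb : g ∈ wordBall (elementaryMatrices n) 6)
    (hhb : h ∈ wordBall (elementaryMatrices n) 6) : g = h := by
  obtain ⟨k, hk, rfl, -, hgk⟩ := hg
  obtain ⟨m, hm, hkm, -, hhm⟩ := hh
  refine Subtype.ext (Matrix.ext fun i j => ?_)
  have hki : k i = m i := by
    rw [← packDigits_div_mod hk (i.2.trans_le hn), hkm, packDigits_div_mod hm (i.2.trans_le hn)]
  have h1 : (4294967296 : ℤ) ∣ rowValue h i - rowValue g i :=
    ((hgk i).symm.trans (hki ▸ hhm i)).dvd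
  -- Extending the row by zeros, `d` is the row of the difference.
  let d : ℕ → ℤ := fun j => if hj : j < n then h.1 i ⟨j, hj⟩ - g.1 i ⟨j, hj⟩ else 0
  have hd : ∀ j, |d j| ≤ 128 := fun j => by
    by_cases hj : j < n
    · have := abs_le_of_mem_wordBall hgb i ⟨j, hj⟩
      have := abs_le_of_mem_wordBall hhb i ⟨j, hj⟩
      simp only [d, dif_pos hj]
      refine (abs_sub _ _).trans ?_
      linarith
    · simp [d, hj]
  have hsum : rowValue h i - rowValue g i = d 0 + d 1 * 256 + d 2 * 256 ^ 2 + d 3 * 256 ^ 3 := by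
    have h2 : rowValue h i - rowValue g i = ∑ j ∈ Finset.range n, d j * 256 ^ j := by
      rw [rowValue, rowValue, ← Finset.sum_sub_distrib, ← Fin.sum_univ_eq_sum_range
        (fun j => d j * 256 ^ j)]
      refine Finset.sum_congr rfl fun j _ => ?_
      simp [d, sub_mul]
    have h3 : ∑ j ∈ Finset.range n, d j * 256 ^ j = ∑ j ∈ Finset.range 4, d j * 256 ^ j := by
      refine Finset.sum_subset (Finset.range_mono hn) fun j _ hj => ?_
      simp [d, show ¬ j < n by simpa using hj]
    rw [h2, h3]
    simp [Finset.sum_range_succ]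
  rw [hsum] at h1
  have h0 := abs_le.1 (hd 0)
  have h4 := abs_le.1 (hd 1)
  have h2 := abs_le.1 (hd 2)
  have h3 := abs_le.1 (hd 3)
  -- Since `|d j| ≤ 128`, the combination is too small to be a non-zero multiple of `2 ^ 32`. It
  -- therefore vanishes, and so does each `d j` in turn, since it is divisible by `256`.
  have hz : d 0 = 0 ∧ d 1 = 0 ∧ d 2 = 0 ∧ d 3 = 0 := by
    norm_num at h1
    omega
  have hdj : d j = 0 := by
    have hj4 : (j : ℕ) < 4 := j.2.trans_le hn
    obtain ⟨z0, z1, z2, z3⟩ := hz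
    generalize (j : ℕ) = m at hj4
    interval_cases m <;> assumption
  simp only [d, dif_pos j.2] at hdj
  exact (sub_eq_zero.1 hdj).symm

end

section

variable {Γ : Type v} [Group Γ]
open Matrix
variable {n : ℕ}

/-! ### The group elements in a certificate -/

/-- The part of a frame that determines group elements is meaningful. -/
structure Frame.IsValid (F : Frame) (n : ℕ) : Prop where
  le_four : n ≤ 4
  start_eq : F.start = packDigits fun i => if i < n then 256 ^ i else 0
  isPerm : ∀ i < 32, IsPerm n (Nat.mod (Nat.div F.perms (Nat.pow 256 i)) 256)
  isLetter : ∀ c < F.classes, ∀ l ∈ F.rep c, IsLetter n l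
  isPerm_group : ∀ p ∈ F.group, IsPerm n p.1.perm

variable {F : Frame}

lemma isKey_one (hF : F.IsValid n) : IsKey (1 : SpecialLinearGroup (Fin n) ℤ) F.start := by
  have hn := hF.le_four
  refine ⟨_, fun i => ?_, hF.start_eq, fun i hi => if_neg hi.not_gt, fun i => ?_⟩
  · split_ifs with h
    · calc 256 ^ i ≤ 256 ^ 3 := Nat.pow_le_pow_right (by norm_num) (by omega)
        _ < 4294967296 := by norm_num
    · norm_num
  · have : rowValue (1 : SpecialLinearGroup (Fin n) ℤ) i = 256 ^ (i : ℕ) := by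
      have h1 : ∀ j, (1 : SpecialLinearGroup (Fin n) ℤ).1 i j = if i = j then 1 else 0 :=
        fun j => one_apply
      simp [rowValue, h1]
    rw [this, if_pos i.2]
    push_cast
    rfl

lemma isKey_word (hF : F.IsValid n) {w : List ℕ} (hw : ∀ l ∈ w, IsLetter n l) :
    IsKey (word n w) (wordKey w F.start) := by
  have := (isKey_one hF).wordKey hF.le_four hw
  rwa [mul_one] at this

/-- The group element of a witness. -/
def Frame.witnessElem (F : Frame) (n d : ℕ) : SpecialLinearGroup (Fin n) ℤ :=
  if d % 2 = 0 then word n (F.witnessWord d) else (word n (F.witnessWord d))⁻¹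

lemma length_unpackWord_le (k W : ℕ) : (unpackWord k W).length ≤ k := by
  induction k generalizing W with
  | zero => exact le_rfl
  | succ k ih =>
    rw [unpackWord]
    cases Nat.beq W 0
    · exact Nat.succ_le_succ (ih _)
    · exact Nat.zero_le _

section Witness

variable {d : ℕ}

lemma isPerm_signedPerm (hF : F.IsValid n) : IsPerm n (F.signedPerm d).perm :=
  hF.isPerm _ (Nat.mod_lt _ (by norm_num))

lemma isLetter_witnessWord (hF : F.IsValid n) (hd : classIdx d < F.classes) :
    ∀ l ∈ F.witnessWord d, IsLetter n l :=
  isLetter_map_act hF.le_four (isPerm_signedPerm hF) (hF.isLetter _ hd)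

lemma isKey_witness (hF : F.IsValid n) (hd : classIdx d < F.classes) :
    IsKey (F.witnessElem n d) (F.witnessKey d) := by
  have hw := isLetter_witnessWord hF hd
  rw [Frame.witnessElem, Frame.witnessKey]
  change IsKey _ (Nat.rec _ _ (d % 2))
  rcases Nat.mod_two_eq_zero_or_one d with h | h
  · rw [if_pos h, h]
    exact isKey_word hF hw
  · rw [h, if_neg one_ne_zero]
    have := (isKey_one hF).invWordKey hF.le_four hw
    rwa [mul_one] at this

lemma witnessElem_mem_wordBall (hF : F.IsValid n) (hd : classIdx d < F.classes) :
    F.witnessElem n d ∈ wordBall (elementaryMatrices n) 4 := by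
  have h : word n (F.witnessWord d) ∈ wordBall (elementaryMatrices n) 4 :=
    wordBall_mono _ (by rw [Frame.witnessWord, List.length_map]; exact length_unpackWord_le 4 _)
      (word_mem_wordBall (isLetter_witnessWord hF hd))
  rw [Frame.witnessElem]
  split_ifs
  · exact h
  · exact inv_mem_wordBall (fun _ => inv_mem_elementaryMatrices) h

/-- A witness stands for an element in the orbit of the representative of its class, or in the
orbit of the inverse. -/
lemma orbitSum_witnessElem (hF : F.IsValid n) (hd : classIdx d < F.classes) :
    orbitSum (Aut n) (F.witnessElem n d) = orbitSum (Aut n) (word n (F.rep (classIdx d))) := by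
  have h : word n (F.witnessWord d) = (F.signedPerm d).aut n • word n (F.rep (classIdx d)) :=
    (smul_word hF.le_four (isPerm_signedPerm hF) (hF.isLetter _ hd)).symm
  rw [Frame.witnessElem]
  split_ifs
  · rw [h, orbitSum_smul]
  · rw [orbitSum_inv, h, orbitSum_smul]

end Witness

/-- The matrix with small entries and the given key; the identity matrix if there is none. -/
def keyElem (n N : ℕ) : SpecialLinearGroup (Fin n) ℤ := by
  classical
  exact if h : ∃ g : SpecialLinearGroup (Fin n) ℤ, g ∈ wordBall (elementaryMatrices n) 6 ∧ IsKey g N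
    then h.choose else 1

lemma keyElem_eq (hn : n ≤ 4) {g : SpecialLinearGroup (Fin n) ℤ} {N : ℕ}
    (hg : g ∈ wordBall (elementaryMatrices n) 6) (hN : IsKey g N) : keyElem n N = g := by
  have h : ∃ g : SpecialLinearGroup (Fin n) ℤ, g ∈ wordBall (elementaryMatrices n) 6 ∧ IsKey g N :=
    ⟨g, hg, hN⟩
  rw [keyElem, dif_pos h]
  exact IsKey.eq hn h.choose_spec.2 hN h.choose_spec.1 hg

/-! ### Orbits with signs -/

lemma getD_mulVec (a b : List ℤ) (i : ℕ) : (mulVec a b).getD i 0 = a.getD i 0 * b.getD i 0 := by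
  induction a generalizing b i with
  | nil => simp [mulVec]
  | cons x a ih =>
    cases b with
    | nil => simp [mulVec]
    | cons y b =>
      cases i with
      | zero => rfl
      | succ i => simpa [mulVec] using ih b i

lemma getD_addVec (a b : List ℤ) (i : ℕ) : (addVec a b).getD i 0 = a.getD i 0 + b.getD i 0 := by
  induction a generalizing b i with
  | nil => cases b <;> simp [addVec]
  | cons x a ih =>
    cases b with
    | nil => simp [addVec]
    | cons y b =>
      cases i with
      | zero => rfl
      | succ i => simpa [addVec] using ih b i

/-- The linear combination of the values of `f` with the coefficients at the index `χ`. -/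
def vecSum {α V : Type*} [AddCommGroup V] [Module ℝ V] (χ : ℕ) (f : α → V)
    (l : List (α × List ℤ)) : V :=
  (l.map fun y => ((y.2.getD χ 0 : ℤ) : ℝ) • f y.1).sum

section

variable {V : Type*} [AddCommGroup V] [Module ℝ V] (χ : ℕ)

lemma vecSum_insertKey (f : ℕ → V) (k : ℕ) (s : List ℤ) (l : List (ℕ × List ℤ)) :
    vecSum χ f (insertKey k s l) = ((s.getD χ 0 : ℤ) : ℝ) • f k + vecSum χ f l := by
  induction l with
  | nil => simp [insertKey, vecSum]
  | cons p l ih =>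
    rw [insertKey]
    cases h : Nat.beq k p.1
    · simp only [cond_false, vecSum, List.map_cons, List.sum_cons] at ih ⊢
      rw [ih, add_left_comm]
    · have hk : k = p.1 := Nat.eq_of_beq_eq_true h
      simp only [cond_true, vecSum, List.map_cons, List.sum_cons, getD_addVec, hk]
      push_cast
      rw [add_smul, add_assoc]

/-- Collecting terms does not change the sum. -/
lemma vecSum_collect (f : ℕ → V) (N : ℕ) (E : List (List ℤ × List ℕ)) :
    vecSum χ f (collect N E)
      = (E.map fun p => ((p.1.getD χ 0 : ℤ) : ℝ) • f (wordKey p.2 N)).sum := by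
  induction E with
  | nil => rfl
  | cons p E ih =>
    rw [List.map_cons, List.sum_cons, ← ih, ← vecSum_insertKey]
    rfl

end

lemma mem_insertKey {k : ℕ} {s : List ℤ} {l : List (ℕ × List ℤ)} {y : ℕ × List ℤ}
    (hy : y ∈ insertKey k s l) : y.1 = k ∨ ∃ z ∈ l, z.1 = y.1 := by
  induction l with
  | nil => exact .inl (by rw [List.mem_singleton.1 hy])
  | cons p l ih =>
    rw [insertKey] at hy
    cases h : Nat.beq k p.1 <;> rw [h] at hy <;> rcases List.mem_cons.1 hy with rfl | hy
    · exact .inr ⟨y, by simp, rfl⟩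
    · exact (ih hy).imp_right fun ⟨z, hz, e⟩ => ⟨z, by simp [hz], e⟩
    · exact .inr ⟨p, by simp, rfl⟩
    · exact .inr ⟨y, by simp [hy], rfl⟩

lemma mem_collect {N : ℕ} {E : List (List ℤ × List ℕ)} {y : ℕ × List ℤ} (hy : y ∈ collect N E) :
    ∃ p ∈ E, y.1 = wordKey p.2 N := by
  induction E generalizing y with
  | nil => simp [collect] at hy
  | cons p E ih =>
    rcases mem_insertKey hy with h | ⟨z, hz, e⟩
    · exact ⟨p, by simp, h⟩
    · obtain ⟨q, hq, h⟩ := ih hz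
      exact ⟨q, by simp [hq], e ▸ h⟩

lemma mem_expand (hn : n ≤ 4) {m : ℕ} {gs : List (SignedPerm × List ℤ)}
    (hgs : ∀ p ∈ gs, IsPerm n p.1.perm) {w : List ℕ} (hw : ∀ l ∈ w, IsLetter n l)
    {q : List ℤ × List ℕ} (hq : q ∈ expand m gs w) :
    (∀ l ∈ q.2, IsLetter n l) ∧ ∃ a : Aut n, word n q.2 = a • word n w := by
  induction gs generalizing q with
  | nil =>
    rw [List.mem_singleton.1 hq]
    exact ⟨hw, 1, (one_smul _ _).symm⟩
  | cons p gs ih =>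
    have ih := fun q => @ih (fun p hp => hgs p (by simp [hp])) q
    rcases List.mem_append.1 hq with h | h
    · exact ih q h
    · obtain ⟨q', hq', rfl⟩ := List.mem_map.1 h
      obtain ⟨h1, a, ha⟩ := ih q' hq'
      have hp := hgs p (by simp)
      refine ⟨isLetter_map_act hn hp h1, p.1.aut n * a, ?_⟩
      rw [mul_smul, ← ha, smul_word hn hp h1]

/-- The operator `isotypic` for the character with index `χ`. -/
def charOp (n : ℕ) (gs : List (SignedPerm × List ℤ)) (χ : ℕ) :
    Module.End ℝ (MonoidAlgebra ℝ (SpecialLinearGroup (Fin n) ℤ)) :=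
  isotypic (gs.map fun p => (act (p.1.aut n), ((p.2.getD χ 0 : ℤ) : ℝ)))

lemma charOp_diff_word (hn : n ≤ 4) {m χ : ℕ} (hχ : χ < m) {gs : List (SignedPerm × List ℤ)}
    (hgs : ∀ p ∈ gs, IsPerm n p.1.perm) {w : List ℕ} (hw : ∀ l ∈ w, IsLetter n l) :
    charOp n gs χ (diff (word n w))
      = ((expand m gs w).map fun q => ((q.1.getD χ 0 : ℤ) : ℝ) • diff (word n q.2)).sum := by
  induction gs with
  | nil => simp [charOp, isotypic, expand, hχ]
  | cons p gs ih =>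
    have hgs' : ∀ p ∈ gs, IsPerm n p.1.perm := fun p hp => hgs p (by simp [hp])
    have ih := ih hgs'
    rw [charOp] at ih ⊢
    rw [List.map_cons, isotypic_cons, Module.End.mul_apply, ih, LinearMap.add_apply,
      Module.End.one_apply, LinearMap.smul_apply, expand]
    rw [List.map_append, List.sum_append, map_list_sum, List.smul_sum, List.map_map, List.map_map,
      List.map_map]
    congr 2
    refine List.map_congr_left fun q hq => ?_
    obtain ⟨h1, -⟩ := mem_expand hn hgs' hw hq
    simp only [Function.comp_apply, getD_mulVec, map_smul, act_diff,
      smul_word hn (hgs p (by simp)) h1]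
    push_cast
    rw [mul_smul]

section Orbit

variable {r : OrbitRep}

/-- The keys in the orbit of a representative are the keys of elements of that orbit. -/
lemma mem_orbit (hF : F.IsValid n) (hr : ∀ l ∈ r.word, IsLetter n l) (hr2 : r.word.length ≤ 2)
    {y : ℕ × List ℤ} (hy : y ∈ F.orbit r) : IsKey (keyElem n y.1) y.1 ∧
      keyElem n y.1 ∈ wordBall (elementaryMatrices n) 2 ∧
      ∃ a : Aut n, keyElem n y.1 = a • word n r.word := by
  obtain ⟨q, hq, hyq⟩ := mem_collect hy
  obtain ⟨h1, a, ha⟩ := mem_expand hF.le_four hF.isPerm_group hr hq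
  have h2 : word n q.2 ∈ wordBall (elementaryMatrices n) 2 := by
    rw [ha]
    exact smul_mem_wordBall (fun a s hs => mem_autStabilizer.1 a.2 s hs) a
      (wordBall_mono _ hr2 (word_mem_wordBall hr))
  have h3 : keyElem n y.1 = word n q.2 :=
    keyElem_eq hF.le_four (wordBall_mono _ (by norm_num) h2) (hyq ▸ isKey_word hF h1)
  rw [h3]
  exact ⟨hyq ▸ isKey_word hF h1, h2, a, ha⟩

/-- The list `Frame.orbit` describes the image of the difference `g - 1` under the operators of all
characters at once. -/
lemma charOp_diff_eq_orbit (hF : F.IsValid n) {χ : ℕ} (hχ : χ < F.chars)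
    (hr : ∀ l ∈ r.word, IsLetter n l) (hr2 : r.word.length ≤ 2) :
    charOp n F.group χ (diff (word n r.word))
      = vecSum χ (fun N => diff (keyElem n N)) (F.orbit r) := by
  rw [Frame.orbit, vecSum_collect, charOp_diff_word hF.le_four hχ hF.isPerm_group hr]
  congr 1
  refine List.map_congr_left fun q hq => ?_
  obtain ⟨h1, a, ha⟩ := mem_expand hF.le_four hF.isPerm_group hr hq
  rw [keyElem_eq hF.le_four (wordBall_mono _ (show 2 ≤ 6 by norm_num) ?_) (isKey_word hF h1)]
  rw [ha]
  exact smul_mem_wordBall (d := 2) (fun a s hs => mem_autStabilizer.1 a.2 s hs) a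
    (wordBall_mono _ hr2 (word_mem_wordBall hr))

end Orbit

end

section

variable {Γ : Type v} [Group Γ]
open Matrix
variable {n : ℕ} {F : Frame}

/-! ### The terms of a sum of squares -/

/-- The group element that represents a class. -/
def Frame.classElem (F : Frame) (n c : ℕ) : SpecialLinearGroup (Fin n) ℤ := word n (F.rep c)

/-- The combination of orbit sums given by a list of terms. -/
def Frame.termSum (F : Frame) (n : ℕ) (ts : List (ℤ × ℕ)) :
    MonoidAlgebra ℝ (SpecialLinearGroup (Fin n) ℤ) :=
  (ts.map fun t => (t.1 : ℝ) • orbitSum (Aut n) (F.classElem n t.2)).sum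

lemma termSum_nil : F.termSum n [] = 0 := rfl

lemma termSum_cons (t : ℤ × ℕ) (ts : List (ℤ × ℕ)) : F.termSum n (t :: ts)
    = (t.1 : ℝ) • orbitSum (Aut n) (F.classElem n t.2) + F.termSum n ts := by
  simp [Frame.termSum]

lemma termSum_append (ts ts' : List (ℤ × ℕ)) :
    F.termSum n (ts ++ ts') = F.termSum n ts + F.termSum n ts' := by
  simp [Frame.termSum]

/-- The representative and its witness are meaningful. -/
structure OrbitRep.IsValid (r : OrbitRep) (F : Frame) (n : ℕ) : Prop where
  isLetter : ∀ l ∈ r.word, IsLetter n l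
  length_word : r.word.length ≤ 2
  class_lt : classIdx r.cert < F.classes
  cert : F.witnessKey r.cert = wordKey r.word F.start
  length_rows : r.rows.length ≤ F.chars

instance (r : OrbitRep) (F : Frame) (n : ℕ) : Decidable (r.IsValid F n) :=
  decidable_of_iff ((∀ l ∈ r.word, IsLetter n l) ∧ r.word.length ≤ 2 ∧
      classIdx r.cert < F.classes ∧ F.witnessKey r.cert = wordKey r.word F.start ∧
      r.rows.length ≤ F.chars)
    ⟨fun ⟨h1, h2, h3, h4, h5⟩ => ⟨h1, h2, h3, h4, h5⟩, fun ⟨h1, h2, h3, h4, h5⟩ =>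
      ⟨h1, h2, h3, h4, h5⟩⟩

/-- The group element of a representative. -/
def OrbitRep.elem (r : OrbitRep) (n : ℕ) : SpecialLinearGroup (Fin n) ℤ :=
  KazhdanBounds.word n r.word

lemma OrbitRep.IsValid.elem_mem {r : OrbitRep} (hr : r.IsValid F n) :
    r.elem n ∈ wordBall (elementaryMatrices n) 2 :=
  wordBall_mono _ hr.length_word (word_mem_wordBall hr.isLetter)

lemma OrbitRep.IsValid.orbitSum_elem {r : OrbitRep} (hF : F.IsValid n) (hr : r.IsValid F n) :
    orbitSum (Aut n) (r.elem n) = orbitSum (Aut n) (F.classElem n (classIdx r.cert)) := by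
  have h : r.elem n = F.witnessElem n r.cert := by
    refine IsKey.eq hF.le_four (isKey_word hF hr.isLetter) (hr.cert ▸ isKey_witness hF hr.class_lt)
      (wordBall_mono _ (by norm_num) hr.elem_mem)
      (wordBall_mono _ (by norm_num) (witnessElem_mem_wordBall hF hr.class_lt))
  rw [h, orbitSum_witnessElem hF hr.class_lt, Frame.classElem]

lemma getD_map_mul (f : ℤ) (M : List ℤ) (i : ℕ) :
    (M.map (Int.mul f)).getD i 0 = f * M.getD i 0 := by
  induction M generalizing i with
  | nil => simp
  | cons x M ih =>
    cases i with
    | zero => rfl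
    | succ i => simpa using ih i

lemma dotVec_eq_sum (a b : List ℤ) {m : ℕ} (ha : a.length ≤ m) :
    dotVec a b = ∑ i ∈ Finset.range m, a.getD i 0 * b.getD i 0 := by
  induction a generalizing b m with
  | nil => simp [dotVec]
  | cons x a ih =>
    cases b with
    | nil => simp [dotVec]
    | cons y b =>
      obtain ⟨m, rfl⟩ : ∃ k, m = k + 1 := ⟨m - 1, by simp at ha; omega⟩
      rw [Finset.sum_range_succ']
      simp only [List.getD_cons_succ, List.getD_cons_zero]
      rw [← ih b (by simpa using ha), add_comm]
      rfl

lemma dotVec_comm (a b : List ℤ) : dotVec a b = dotVec b a := by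
  induction a generalizing b with
  | nil => cases b <;> rfl
  | cons x a ih =>
    cases b with
    | nil => rfl
    | cons y b =>
      change x * y + dotVec a b = y * x + dotVec b a
      rw [ih, mul_comm]

lemma gram_comm (a b : List (List ℤ)) : gram a b = gram b a := by
  rw [gram, gram, List.zipWith_comm]
  congr 1
  funext x y
  exact dotVec_comm y x

lemma getD_gram (a b : List (List ℤ)) (i : ℕ) :
    (gram a b).getD i 0 = dotVec (a.getD i []) (b.getD i []) := by
  induction a generalizing b i with
  | nil => simp [gram, dotVec]
  | cons x a ih =>
    cases b with
    | nil =>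
      rw [dotVec_comm]
      simp [gram, dotVec]
    | cons y b =>
      cases i with
      | zero => rfl
      | succ i => simpa [gram] using ih b i

/-- The form on a pair of representatives, summed over the characters with the entries of the Gram
matrices as coefficients. -/
def Frame.pairForm (F : Frame) (n : ℕ) (r c : OrbitRep) :
    MonoidAlgebra ℝ (SpecialLinearGroup (Fin n) ℤ) :=
  ∑ χ ∈ Finset.range F.chars, (((gram r.rows c.rows).getD χ 0 : ℤ) : ℝ) •
    symForm (Aut n) (diff (r.elem n)) (charOp n F.group χ (diff (c.elem n)))

lemma map_vecSum {α V W : Type*} [AddCommGroup V] [Module ℝ V] [AddCommGroup W] [Module ℝ W]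
    (T : V →ₗ[ℝ] W) (χ : ℕ) (f : α → V) (l : List (α × List ℤ)) :
    T (vecSum χ f l) = vecSum χ (fun x => T (f x)) l := by
  simp only [vecSum, map_list_sum, List.map_map]
  congr 1
  refine List.map_congr_left fun y _ => ?_
  simp

/-- By `symForm_diff`, the form on the difference for `r` and a combination of differences for the
orbit of `c` is a combination of orbit sums. A valid witness `d` for `y` represents the quotient of
`y` by `r`. -/
lemma termSum_orbitTerms (hF : F.IsValid n) {r c : OrbitRep} (hr : r.IsValid F n)
    {M : List ℤ} (hM : M.length ≤ F.chars) (ys : List (ℕ × List ℤ)) (k : ℕ)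
    (hys : ∀ y ∈ ys, IsKey (keyElem n y.1) y.1 ∧
      keyElem n y.1 ∈ wordBall (elementaryMatrices n) 2 ∧
      ∃ a : Aut n, keyElem n y.1 = a • word n c.word)
    (hok : F.quotientsOk r ys (witnesses ys.length k) = true) :
    F.termSum n (orbitTerms M ys k) + ((sumTerms (fun z _ => z) (orbitTerms M ys k) : ℤ) : ℝ) •
        (orbitSum (Aut n) 1 - orbitSum (Aut n) (r.elem n) - orbitSum (Aut n) (c.elem n))
      = ∑ χ ∈ Finset.range F.chars, ((M.getD χ 0 : ℤ) : ℝ) •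
        vecSum χ (fun N => symForm (Aut n) (diff (r.elem n)) (diff (keyElem n N))) ys := by
  induction ys generalizing k with
  | nil => simp [orbitTerms, termSum_nil, sumTerms, vecSum]
  | cons y ys ih =>
    obtain ⟨h1, h2, a, h3⟩ := hys y (by simp)
    rw [List.length_cons, witnesses, Frame.quotientsOk, Bool.and_eq_true, Bool.and_eq_true] at hok
    obtain ⟨hd, hkey, hok⟩ := hok
    have ih := ih _ (fun y hy => hys y (by simp [hy])) hok
    set d := Nat.mod k 262144 with hd'
    have hd : classIdx d < F.classes := by simpa [Nat.blt_eq] using hd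
    have hkey : wordKey r.word (F.witnessKey d) = y.1 := Nat.eq_of_beq_eq_true hkey
    have helem : keyElem n y.1 = r.elem n * F.witnessElem n d := by
      refine IsKey.eq hF.le_four h1 (hkey ▸ (isKey_witness hF hd).wordKey hF.le_four hr.isLetter)
        (wordBall_mono _ (by norm_num) h2) ?_
      exact mul_mem_wordBall (d := 2) (e := 4) hr.elem_mem (witnessElem_mem_wordBall hF hd)
    have hform : symForm (Aut n) (diff (r.elem n)) (diff (keyElem n y.1))
        = orbitSum (Aut n) (F.classElem n (classIdx d)) +
          (orbitSum (Aut n) 1 - orbitSum (Aut n) (r.elem n) - orbitSum (Aut n) (c.elem n)) := by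
      rw [symForm_diff, h3, orbitSum_smul, ← h3, helem, inv_mul_cancel_left,
        orbitSum_witnessElem hF hd, Frame.classElem, OrbitRep.elem]
      simp only [OrbitRep.elem]
      abel
    have hterms : orbitTerms M (y :: ys) k
        = (dotVec M y.2, classIdx d) :: orbitTerms M ys (Nat.div k 262144) := rfl
    rw [hterms, termSum_cons]
    change _ + ((dotVec M y.2 +
      sumTerms (fun z _ => z) (orbitTerms M ys (Nat.div k 262144)) : ℤ) : ℝ) • _ = _
    have hvec : ∀ χ, vecSum χ (fun N => symForm (Aut n) (diff (r.elem n)) (diff (keyElem n N)))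
        (y :: ys) = ((y.2.getD χ 0 : ℤ) : ℝ) •
          symForm (Aut n) (diff (r.elem n)) (diff (keyElem n y.1)) +
          vecSum χ (fun N => symForm (Aut n) (diff (r.elem n)) (diff (keyElem n N))) ys :=
      fun χ => by simp [vecSum]
    simp only [hvec, smul_add, Finset.sum_add_distrib, ← ih, smul_smul, ← Finset.sum_smul]
    have hdot : (dotVec M y.2 : ℝ)
        = ∑ χ ∈ Finset.range F.chars, ((M.getD χ 0 : ℤ) : ℝ) * ((y.2.getD χ 0 : ℤ) : ℝ) := by
      rw [dotVec_eq_sum M y.2 hM]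
      push_cast
      rfl
    rw [← hdot, hform]
    push_cast
    module

lemma length_gram_le (a b : List (List ℤ)) : (gram a b).length ≤ a.length := by
  rw [gram, List.length_zipWith]
  exact min_le_left _ _

/-- The terms for a pair of representatives add up to a multiple of the form on that pair. -/
lemma termSum_pairTerms (hF : F.IsValid n) (hone : F.rep 0 = []) {r c : OrbitRep}
    (hr : r.IsValid F n) (hc : c.IsValid F n) (f : ℤ) (k : ℕ)
    (hok : F.quotientsOk r (F.orbit c) (witnesses (F.orbit c).length k) = true) :
    F.termSum n (pairTerms f (classIdx r.cert) (classIdx c.cert) (gram r.rows c.rows) (F.orbit c) k)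
      = (f : ℝ) • F.pairForm n r c := by
  have hlen : ((gram r.rows c.rows).map (Int.mul f)).length ≤ F.chars := by
    rw [List.length_map]
    exact (length_gram_le _ _).trans hr.length_rows
  have h := termSum_orbitTerms hF hr hlen (F.orbit c) k
    (fun y hy => mem_orbit hF hc.isLetter hc.length_word hy) hok
  have h1 : F.classElem n 0 = 1 := by rw [Frame.classElem, hone, word_nil]
  have h2 : F.termSum n (pairTerms f (classIdx r.cert) (classIdx c.cert) (gram r.rows c.rows)
      (F.orbit c) k) = F.termSum n (orbitTerms ((gram r.rows c.rows).map (Int.mul f)) (F.orbit c) k)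
      + ((sumTerms (fun z _ => z) (orbitTerms ((gram r.rows c.rows).map (Int.mul f)) (F.orbit c) k)
        : ℤ) : ℝ) •
        (orbitSum (Aut n) 1 - orbitSum (Aut n) (r.elem n) - orbitSum (Aut n) (c.elem n)) := by
    rw [pairTerms, termSum_cons, termSum_cons, termSum_cons, h1, hr.orbitSum_elem hF,
      hc.orbitSum_elem hF]
    simp only [show ∀ s : ℤ, Int.neg s = -s from fun _ => rfl, Int.cast_neg]
    module
  rw [h2, h, Frame.pairForm, Finset.smul_sum]
  refine Finset.sum_congr rfl fun χ hχ => ?_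
  rw [OrbitRep.elem, OrbitRep.elem,
    charOp_diff_eq_orbit hF (Finset.mem_range.1 hχ) hc.isLetter hc.length_word,
    map_vecSum, getD_map_mul, smul_smul]
  push_cast
  rfl

/-! ### Summation over all pairs -/

/-- The list of the terms in `rowsTotal`. -/
def rowsTerms (c : OrbitRep) (ys : List (ℕ × List ℤ)) : ℤ → List OrbitRep → List ℕ → List (ℤ × ℕ)
  | f, r :: rs, k :: ks =>
    pairTerms f (classIdx r.cert) (classIdx c.cert) (gram r.rows c.rows) ys k ++
      rowsTerms c ys (-2) rs ks
  | _, _, _ => []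

/-- The list of the terms in `Frame.total`. -/
def Frame.terms (F : Frame) : List OrbitRep → List (ℤ × ℕ)
  | [] => []
  | r :: rs => rowsTerms r (F.orbit r) (-1) (r :: rs) r.pairCerts ++ F.terms rs

lemma sumTerms_append (φ : ℤ → ℕ → ℤ) (ts ts' : List (ℤ × ℕ)) :
    sumTerms φ (ts ++ ts') = sumTerms φ ts + sumTerms φ ts' := by
  induction ts with
  | nil => exact (zero_add _).symm
  | cons t ts ih =>
    change φ t.1 t.2 + sumTerms φ (ts ++ ts') = φ t.1 t.2 + sumTerms φ ts + sumTerms φ ts'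
    rw [ih, add_assoc]

lemma rowsTotal_eq (φ : ℤ → ℕ → ℤ) (c : OrbitRep) (ys : List (ℕ × List ℤ)) (f : ℤ)
    (rs : List OrbitRep) (ks : List ℕ) :
    rowsTotal φ c ys f rs ks = sumTerms φ (rowsTerms c ys f rs ks) := by
  induction rs generalizing f ks with
  | nil => rfl
  | cons r rs ih =>
    cases ks with
    | nil => rfl
    | cons k ks =>
      rw [rowsTerms, sumTerms_append, ← ih]
      rfl

lemma total_eq (φ : ℤ → ℕ → ℤ) (rs : List OrbitRep) :
    F.total φ rs = sumTerms φ (F.terms rs) := by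
  induction rs with
  | nil => rfl
  | cons r rs ih =>
    rw [Frame.terms, sumTerms_append, ← ih, ← rowsTotal_eq]
    rfl

/-- The terms for the pairs of `c` with a list of representatives. The pairs after the first one are
counted twice. -/
lemma termSum_rowsTerms (hF : F.IsValid n) (hone : F.rep 0 = []) {c : OrbitRep}
    (hc : c.IsValid F n) (f : ℤ) (r : OrbitRep) (rs : List OrbitRep)
    (hrs : ∀ r' ∈ r :: rs, r'.IsValid F n) (ks : List ℕ)
    (hok : F.rowsOk (F.orbit c) (r :: rs) ks = true) :
    F.termSum n (rowsTerms c (F.orbit c) f (r :: rs) ks)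
      = (f : ℝ) • F.pairForm n r c - (2 : ℝ) • (rs.map fun r' => F.pairForm n r' c).sum := by
  induction rs generalizing r f ks with
  | nil =>
    cases ks with
    | nil => simp [Frame.rowsOk] at hok
    | cons k ks =>
      rw [Frame.rowsOk, Bool.and_eq_true] at hok
      have h : rowsTerms c (F.orbit c) (-2) [] ks = [] := by cases ks <;> rfl
      rw [rowsTerms, termSum_append, h, termSum_nil,
        termSum_pairTerms hF hone (hrs r (by simp)) hc f k hok.1]
      simp
  | cons r' rs ih =>
    cases ks with
    | nil => simp [Frame.rowsOk] at hok
    | cons k ks =>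
      rw [Frame.rowsOk, Bool.and_eq_true] at hok
      rw [rowsTerms, termSum_append, ih (-2) r' (fun r'' h => hrs r'' (by simp [h])) ks hok.2,
        termSum_pairTerms hF hone (hrs r (by simp)) hc f k hok.1, List.map_cons, List.sum_cons]
      push_cast
      module

/-- A symmetric double sum over a list. -/
lemma sum_sum_of_symm {α V : Type*} [AddCommGroup V] (B : α → α → V)
    (hB : ∀ a b, B a b = B b a) (a : α) (l : List α) :
    ((a :: l).map fun c => ((a :: l).map fun r => B r c).sum).sum
      = B a a + 2 • (l.map fun r => B r a).sum +
        (l.map fun c => (l.map fun r => B r c).sum).sum := by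
  simp only [List.map_cons, List.sum_cons, List.sum_map_add, hB a]
  rw [two_nsmul]
  abel

/-- All terms together add up to the negative of the double sum over the representatives, which is
a sum of squares by `exists_squares_of_pairForm`. -/
lemma termSum_terms (hF : F.IsValid n) (hone : F.rep 0 = [])
    (hsymm : ∀ r c : OrbitRep, F.pairForm n r c = F.pairForm n c r) (rs : List OrbitRep)
    (hrs : ∀ r ∈ rs, r.IsValid F n) (hok : F.pairsOk rs = true) :
    F.termSum n (F.terms rs)
      = -(rs.map fun c => (rs.map fun r => F.pairForm n r c).sum).sum := by
  induction rs with
  | nil => simp [Frame.terms, termSum_nil]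
  | cons r rs ih =>
    rw [Frame.pairsOk, Bool.and_eq_true] at hok
    rw [Frame.terms, termSum_append, ih (fun r' h => hrs r' (by simp [h])) hok.2,
      sum_sum_of_symm _ hsymm, termSum_rowsTerms hF hone (hrs r (by simp)) _ r rs hrs _ hok.1,
      ← Nat.cast_smul_eq_nsmul ℝ]
    push_cast
    module

end

section

variable {Γ : Type v} [Group Γ]
open Matrix
variable {n : ℕ} {F : Frame}

/-! ### The projections to the characters -/

/-- The signed permutations of a frame are involutions that commute modulo the central one, and
their signs are `1` or `-1`. -/
structure Frame.HasCharacters (F : Frame) (n : ℕ) : Prop where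
  central_sq : ∀ l < 32, IsLetter n l → F.central.act (F.central.act l) = l
  gens_sq : ∀ p ∈ F.gens, ∀ l < 32, IsLetter n l → p.1.act (p.1.act l) = l
  gens_central : ∀ p ∈ F.gens, ∀ l < 32, IsLetter n l →
    p.1.act (F.central.act l) = F.central.act (p.1.act l)
  gens_comm : ∀ p ∈ F.gens, ∀ q ∈ F.gens,
    (∀ l < 32, IsLetter n l → p.1.act (q.1.act l) = q.1.act (p.1.act l)) ∨
      ∀ l < 32, IsLetter n l → p.1.act (q.1.act l) = q.1.act (p.1.act (F.central.act l))
  signs_sq : ∀ p ∈ F.gens, ∀ χ < F.chars, p.2.getD χ 0 * p.2.getD χ 0 = 1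

lemma aut_ext (hn : n ≤ 4) {a b : Aut n}
    (h : ∀ l < 32, IsLetter n l → a • letter n l = b • letter n l) : a = b := by
  refine AutStabilizer.ext closure_elementaryMatrices fun s hs => ?_
  obtain ⟨l, hl, rfl⟩ := exists_letter hn hs
  exact h l hl.2.2.2 hl

lemma getD_replicate_one {m χ : ℕ} (h : χ < m) : (List.replicate m (1 : ℤ)).getD χ 0 = 1 := by
  simp [h]

lemma aut_mul_smul_letter (hn : n ≤ 4) {γ δ : SignedPerm} (hγ : IsPerm n γ.perm)
    (hδ : IsPerm n δ.perm) {l : ℕ} (hl : IsLetter n l) :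
    (γ.aut n * δ.aut n) • letter n l = letter n (γ.act (δ.act l)) := by
  obtain ⟨h1, h2⟩ := SignedPerm.aut_spec hn hδ hl
  rw [mul_smul, h2, (SignedPerm.aut_spec hn hγ h1).2]

lemma aut_mul_self (hn : n ≤ 4) {γ : SignedPerm} (hγ : IsPerm n γ.perm)
    (h : ∀ l < 32, IsLetter n l → γ.act (γ.act l) = l) : γ.aut n * γ.aut n = 1 :=
  aut_ext hn fun l hl hl' => by rw [aut_mul_smul_letter hn hγ hγ hl', h l hl hl', one_smul]

lemma aut_mul_comm (hn : n ≤ 4) {γ δ : SignedPerm} (hγ : IsPerm n γ.perm) (hδ : IsPerm n δ.perm)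
    (h : ∀ l < 32, IsLetter n l → γ.act (δ.act l) = δ.act (γ.act l)) :
    γ.aut n * δ.aut n = δ.aut n * γ.aut n :=
  aut_ext hn fun l hl hl' => by
    rw [aut_mul_smul_letter hn hγ hδ hl', aut_mul_smul_letter hn hδ hγ hl', h l hl hl']

lemma aut_mul_comm_mul (hn : n ≤ 4) {γ δ ζ : SignedPerm} (hγ : IsPerm n γ.perm)
    (hδ : IsPerm n δ.perm) (hζ : IsPerm n ζ.perm)
    (h : ∀ l < 32, IsLetter n l → γ.act (δ.act l) = δ.act (γ.act (ζ.act l))) :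
    γ.aut n * δ.aut n = δ.aut n * γ.aut n * ζ.aut n :=
  aut_ext hn fun l hl hl' => by
    obtain ⟨h1, h2⟩ := SignedPerm.aut_spec hn hζ hl'
    rw [aut_mul_smul_letter hn hγ hδ hl', mul_smul, h2, aut_mul_smul_letter hn hδ hγ h1, h l hl hl']

/-- The image of the operator of a character consists of eigenvectors of the involutions, with the
signs of the character as eigenvalues. -/
lemma act_mul_charOp (hF : F.IsValid n) (hG : F.HasCharacters n) {χ : ℕ} (hχ : χ < F.chars)
    {p : SignedPerm × List ℤ} (hp : p ∈ F.group) :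
    act (p.1.aut n) * charOp n F.group χ
      = ((p.2.getD χ 0 : ℤ) : ℝ) • charOp n F.group χ := by
  have hn := hF.le_four
  have hperm : ∀ q ∈ F.gens, IsPerm n q.1.perm := fun q hq =>
    hF.isPerm_group q (List.mem_cons_of_mem _ hq)
  have hcent : IsPerm n F.central.perm :=
    hF.isPerm_group (F.central, List.replicate F.chars (1 : ℤ)) List.mem_cons_self
  have hone : (((List.replicate F.chars (1 : ℤ)).getD χ 0 : ℤ) : ℝ) = 1 := by
    rw [getD_replicate_one hχ, Int.cast_one]
  have he : charOp n F.group χ = isotypic ((act (F.central.aut n), (1 : ℝ)) ::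
      F.gens.map fun q => (act (q.1.aut n), ((q.2.getD χ 0 : ℤ) : ℝ))) := by
    rw [charOp, Frame.group, List.map_cons, hone]
  have hmem : (act (p.1.aut n), ((p.2.getD χ 0 : ℤ) : ℝ)) ∈
      (act (Γ := SpecialLinearGroup (Fin n) ℤ) (F.central.aut n), (1 : ℝ)) ::
      F.gens.map fun q => (act (q.1.aut n), ((q.2.getD χ 0 : ℤ) : ℝ)) := by
    rcases List.mem_cons.1 hp with rfl | hp
    · rw [hone]
      exact List.mem_cons_self
    · exact List.mem_cons_of_mem _ (List.mem_map.2 ⟨p, hp, rfl⟩)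
  rw [he]
  refine mul_isotypic ?_ ?_ ?_ ?_ ?_ _ hmem
  · rw [← act_mul_end, aut_mul_self hn hcent hG.central_sq, act_one_end]
  · rw [List.forall_mem_map]
    intro q hq
    rw [← act_mul_end, aut_mul_self hn (hperm q hq) (hG.gens_sq q hq), act_one_end]
  · rw [List.forall_mem_map]
    intro q hq
    dsimp only
    exact_mod_cast hG.signs_sq q hq χ hχ
  · rw [List.forall_mem_map]
    intro q hq
    rw [← act_mul_end, ← act_mul_end, aut_mul_comm hn (hperm q hq) hcent (hG.gens_central q hq)]
  · rw [List.forall_mem_map]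
    intro q hq
    rw [List.forall_mem_map]
    intro q' hq'
    rw [← act_mul_end, ← act_mul_end, ← act_mul_end]
    exact (hG.gens_comm q hq q' hq').imp
      (fun h => by rw [aut_mul_comm hn (hperm q hq) (hperm q' hq') h])
      fun h => by rw [aut_mul_comm_mul hn (hperm q hq) (hperm q' hq') hcent h]

/-- Up to the factor `2 ^ F.group.length`, the operator `charOp` is an orthogonal projection. -/
lemma symForm_charOp_charOp (hF : F.IsValid n) (hG : F.HasCharacters n) {χ : ℕ} (hχ : χ < F.chars)
    (x y : MonoidAlgebra ℝ (SpecialLinearGroup (Fin n) ℤ)) :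
    symForm (Aut n) (charOp n F.group χ x) (charOp n F.group χ y)
      = (2 ^ F.group.length : ℝ) • symForm (Aut n) x (charOp n F.group χ y) := by
  have hn := hF.le_four
  have h := symForm_isotypic (A := Aut n)
    (F.group.map fun p => (p.1.aut n, ((p.2.getD χ 0 : ℤ) : ℝ))) (charOp n F.group χ) ?_ ?_ ?_ x y
  · rw [List.map_map, List.length_map] at h
    exact h
  · intro p hp
    obtain ⟨q, hq, rfl⟩ := List.mem_map.1 hp
    refine aut_ext hn fun l hl hl' => ?_
    obtain ⟨h1, h2⟩ := SignedPerm.aut_spec hn (hF.isPerm_group q hq) hl'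
    rw [mul_smul, h2, (SignedPerm.aut_spec hn (hF.isPerm_group q hq) h1).2, one_smul]
    congr 1
    rcases List.mem_cons.1 hq with rfl | hq
    · exact hG.central_sq l hl hl'
    · exact hG.gens_sq q hq l hl hl'
  · intro p hp
    obtain ⟨q, hq, rfl⟩ := List.mem_map.1 hp
    rcases List.mem_cons.1 hq with rfl | hq
    · dsimp only
      rw [getD_replicate_one hχ]
      norm_num
    · dsimp only
      exact_mod_cast hG.signs_sq q hq χ hχ
  · intro p hp
    obtain ⟨q, hq, rfl⟩ := List.mem_map.1 hp
    exact act_mul_charOp hF hG hχ hq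

lemma symForm_charOp_comm (hF : F.IsValid n) (hG : F.HasCharacters n) {χ : ℕ} (hχ : χ < F.chars)
    (x y : MonoidAlgebra ℝ (SpecialLinearGroup (Fin n) ℤ)) :
    symForm (Aut n) x (charOp n F.group χ y) = symForm (Aut n) y (charOp n F.group χ x) := by
  have h1 := symForm_charOp_charOp hF hG hχ x y
  rw [symForm_comm, symForm_charOp_charOp hF hG hχ y x] at h1
  exact (smul_right_injective _ (pow_ne_zero _ two_ne_zero) h1).symm

lemma pairForm_comm (hF : F.IsValid n) (hG : F.HasCharacters n) (r c : OrbitRep) :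
    F.pairForm n r c = F.pairForm n c r := by
  refine Finset.sum_congr rfl fun χ hχ => ?_
  rw [gram_comm, symForm_charOp_comm hF hG (Finset.mem_range.1 hχ)]

/-- The combination of the differences `g - 1` whose coefficients form the column `j` of the factor
of the Gram matrix for `χ`. -/
def columnVector (n : ℕ) (rs : List OrbitRep) (χ j : ℕ) :
    MonoidAlgebra ℝ (SpecialLinearGroup (Fin n) ℤ) :=
  (rs.map fun r => ((((r.rows.getD χ []).getD j 0 : ℤ)) : ℝ) • diff (r.elem n)).sum

lemma list_sum_finset_sum {α ι V : Type*} [AddCommMonoid V] (l : List α) (s : Finset ι)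
    (f : α → ι → V) :
    (l.map fun a => ∑ i ∈ s, f a i).sum = ∑ i ∈ s, (l.map fun a => f a i).sum := by
  induction l with
  | nil => simp
  | cons a l ih => simp [ih, Finset.sum_add_distrib]

/-- The double sum over the representatives is a sum of squares. -/
lemma sum_pairForm (rs : List OrbitRep) {J : ℕ}
    (hJ : ∀ r ∈ rs, ∀ χ, (r.rows.getD χ []).length ≤ J) :
    (rs.map fun c => (rs.map fun r => F.pairForm n r c).sum).sum
      = ∑ χ ∈ Finset.range F.chars, ∑ j ∈ Finset.range J, symForm (Aut n) (columnVector n rs χ j)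
          (charOp n F.group χ (columnVector n rs χ j)) := by
  have h1 : ∀ χ j, symForm (Aut n) (columnVector n rs χ j)
      (charOp n F.group χ (columnVector n rs χ j)) = (rs.map fun c => (rs.map fun r =>
        ((((r.rows.getD χ []).getD j 0 * (c.rows.getD χ []).getD j 0 : ℤ)) : ℝ) •
          symForm (Aut n) (diff (r.elem n)) (charOp n F.group χ (diff (c.elem n)))).sum).sum := by
    intro χ j
    nth_rw 2 [columnVector]
    rw [map_list_sum, map_list_sum, List.map_map, List.map_map]
    congr 1
    refine List.map_congr_left fun c _ => ?_
    rw [Function.comp_apply, Function.comp_apply, map_smul, map_smul, columnVector,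
      ← LinearMap.flip_apply, map_list_sum, List.smul_sum, List.map_map, List.map_map]
    congr 1
    refine List.map_congr_left fun r _ => ?_
    simp only [Function.comp_apply, map_smul, LinearMap.flip_apply, smul_smul]
    push_cast
    rw [mul_comm]
  simp only [h1, ← list_sum_finset_sum]
  congr 1
  refine List.map_congr_left fun c _ => ?_
  congr 1
  refine List.map_congr_left fun r hr => ?_
  refine Finset.sum_congr rfl fun χ _ => ?_
  rw [getD_gram, dotVec_eq_sum _ _ (hJ r hr χ), ← Finset.sum_smul]
  push_cast
  rfl

lemma exists_length_rows_le (rs : List OrbitRep) :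
    ∃ J : ℕ, ∀ r ∈ rs, ∀ χ, (r.rows.getD χ []).length ≤ J := by
  induction rs with
  | nil => exact ⟨0, by simp⟩
  | cons r rs ih =>
    obtain ⟨J, hJ⟩ := ih
    refine ⟨J + (r.rows.map List.length).sum, fun r' hr' χ => ?_⟩
    rcases List.mem_cons.1 hr' with rfl | h
    · refine le_add_left ?_
      rw [List.getD_eq_getElem?_getD]
      rcases hx : r'.rows[χ]? with _ | x
      · simp
      · exact List.le_sum_of_mem (List.mem_map_of_mem (List.mem_of_getElem? hx))
    · exact (hJ r' h χ).trans (Nat.le_add_right _ _)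

section Support

lemma supportedInBall_isotypic {A : Type*} [Group A] [MulDistribMulAction A Γ] [Fintype A]
    {S : Finset Γ} (hA : ∀ a : A, ∀ s ∈ S, a • s ∈ S) {d : ℕ} (l : List (A × ℝ))
    {x : MonoidAlgebra ℝ Γ} (hx : SupportedInBall S d x) :
    SupportedInBall S d (isotypic (l.map fun p => (act (Γ := Γ) p.1, p.2)) x) := by
  induction l with
  | nil => simpa [isotypic] using hx
  | cons p l ih =>
    rw [List.map_cons, isotypic_cons, Module.End.mul_apply]
    exact ih.add ((ih.act hA p.1).smul p.2)

lemma augmentation_isotypic {A : Type*} [Group A] [MulDistribMulAction A Γ] [Fintype A]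
    (l : List (A × ℝ)) {x : MonoidAlgebra ℝ Γ} (hx : augmentation x = 0) :
    augmentation (isotypic (l.map fun p => (act (Γ := Γ) p.1, p.2)) x) = 0 := by
  induction l with
  | nil => simpa [isotypic] using hx
  | cons p l ih =>
    rw [List.map_cons, isotypic_cons, Module.End.mul_apply]
    change augmentation (_ + p.2 • act (Γ := Γ) p.1 _) = 0
    rw [augmentation_add, augmentation_smul, augmentation_act, ih, mul_zero, add_zero]
    exact ih

end Support

lemma smul_mem_elementaryMatrices (a : Aut n) (s : SpecialLinearGroup (Fin n) ℤ)
    (hs : s ∈ elementaryMatrices n) : a • s ∈ elementaryMatrices n :=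
  mem_autStabilizer.1 a.2 s hs

lemma columnVector_mem {rs : List OrbitRep} (hrs : ∀ r ∈ rs, r.IsValid F n) (χ j : ℕ) :
    SupportedInBall (elementaryMatrices n) 2 (columnVector n rs χ j) ∧
      augmentation (columnVector n rs χ j) = 0 := by
  induction rs with
  | nil => exact ⟨supportedInBall_zero _ _, by simp [columnVector, augmentation_zero]⟩
  | cons r rs ih =>
    obtain ⟨h1, h2⟩ := ih fun r' h => hrs r' (by simp [h])
    have h3 : columnVector n (r :: rs) χ j
        = ((((r.rows.getD χ []).getD j 0 : ℤ)) : ℝ) • diff (r.elem n) + columnVector n rs χ j := rfl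
    rw [h3]
    refine ⟨SupportedInBall.add (.smul ?_ _) h1, ?_⟩
    · exact .sub (supportedInBall_single (hrs r (by simp)).elem_mem _)
        (supportedInBall_single (one_mem_wordBall _ _) _)
    · rw [augmentation_add, augmentation_smul, augmentation_diff, h2]
      simp

/-- The double sum over the representatives is a sum of values of the symmetrized form on elements
of the augmentation ideal that are supported in the ball of radius `2`. -/
lemma exists_squares_of_pairForm (hF : F.IsValid n) (hG : F.HasCharacters n) {rs : List OrbitRep}
    (hrs : ∀ r ∈ rs, r.IsValid F n) :
    ∃ (ι : Type) (_ : Fintype ι) (x : ι → MonoidAlgebra ℝ (SpecialLinearGroup (Fin n) ℤ)),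
      (∀ i, SupportedInBall (elementaryMatrices n) 2 (x i)) ∧ (∀ i, augmentation (x i) = 0) ∧
      (rs.map fun c => (rs.map fun r => F.pairForm n r c).sum).sum
        = ∑ i, symForm (Aut n) (x i) (x i) := by
  obtain ⟨J, hJ⟩ := exists_length_rows_le rs
  set t : ℝ := 1 / 2 ^ F.group.length with ht
  have ht0 : 0 ≤ t := by positivity
  have hop : ∀ χ, charOp n F.group χ = isotypic ((F.group.map fun p =>
      (p.1.aut n, ((p.2.getD χ 0 : ℤ) : ℝ))).map fun p => (act p.1, p.2)) := fun χ => by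
    rw [List.map_map]; rfl
  refine ⟨Fin F.chars × Fin J, inferInstance,
    fun i => √t • charOp n F.group i.1 (columnVector n rs i.1 i.2), fun i => ?_, fun i => ?_, ?_⟩
  · dsimp only
    rw [hop]
    exact (supportedInBall_isotypic smul_mem_elementaryMatrices _
      (columnVector_mem hrs _ _).1).smul _
  · rw [augmentation_smul, hop, augmentation_isotypic _ (columnVector_mem hrs _ _).2, mul_zero]
  · rw [sum_pairForm rs hJ, Fintype.sum_prod_type, Finset.sum_range]
    refine Finset.sum_congr rfl fun χ _ => ?_
    rw [Finset.sum_range]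
    refine Finset.sum_congr rfl fun j _ => ?_
    rw [map_smul, map_smul, LinearMap.smul_apply, smul_smul, Real.mul_self_sqrt ht0,
      symForm_charOp_charOp hF hG χ.2, smul_smul, ht, one_div,
      inv_mul_cancel₀ (pow_ne_zero _ two_ne_zero), one_smul]

end

section

variable {Γ : Type v} [Group Γ]
open Matrix

/-! ### The symmetrized Laplacian -/

section Laplacian

variable {A : Type*} [Group A] [MulDistribMulAction A Γ] [Fintype A]

lemma laplacian_eq_neg_sum_diff (S : Finset Γ) : laplacian S = -∑ s ∈ S, diff s := by
  simp only [laplacian, diff, Finset.sum_sub_distrib, Finset.sum_const, neg_sub]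
  rw [MonoidAlgebra.one_def, ← Nat.cast_smul_eq_nsmul ℝ, MonoidAlgebra.smul_single, smul_eq_mul,
    mul_one]

/-- When the automorphisms act transitively on the generators, the symmetrizations of `Δ` and `Δ²`
reduce to a single generator. -/
lemma symmetrize_laplacian {S : Finset Γ} {s₀ : Γ} (htrans : ∀ s ∈ S, ∃ a : A, a • s₀ = s) :
    symmetrize A (laplacian S) = (S.card : ℝ) • (orbitSum A 1 - orbitSum A s₀) := by
  rw [laplacian_eq_neg_sum_diff, map_neg, map_sum]
  have h : ∀ s ∈ S, symmetrize A (diff s) = orbitSum A s₀ - orbitSum A 1 := fun s hs => by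
    obtain ⟨a, rfl⟩ := htrans s hs
    rw [diff, map_sub, MonoidAlgebra.one_def, ← orbitSum, ← orbitSum, orbitSum_smul]
  rw [Finset.sum_congr rfl h, Finset.sum_const, ← Nat.cast_smul_eq_nsmul ℝ, ← smul_neg, neg_sub]

lemma symmetrize_laplacian_sq {S : Finset Γ} (hS : ∀ s ∈ S, s⁻¹ ∈ S)
    (hA : ∀ a : A, ∀ s ∈ S, a • s ∈ S) {s₀ : Γ} (htrans : ∀ s ∈ S, ∃ a : A, a • s₀ = s) :
    symmetrize A (laplacian S ^ 2) = (S.card : ℝ) • (∑ t ∈ S, orbitSum A (s₀⁻¹ * t) +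
      (S.card : ℝ) • (orbitSum A 1 - (2 : ℝ) • orbitSum A s₀)) := by
  have h1 : symmetrize A (laplacian S ^ 2) = symForm A (laplacian S) (laplacian S) := by
    rw [symForm_apply, adj_laplacian hS, sq]
  have h2 : ∀ s ∈ S, symForm A (diff s) (laplacian S) = symForm A (diff s₀) (laplacian S) := by
    intro s hs
    obtain ⟨a, rfl⟩ := htrans s hs
    rw [← act_diff, ← symForm_act a (diff s₀), act_laplacian hA]
  have h3 : ∀ t ∈ S, symForm A (diff s₀) (diff t) = orbitSum A (s₀⁻¹ * t) +
      (orbitSum A 1 - (2 : ℝ) • orbitSum A s₀) := by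
    intro t ht
    rw [symForm_diff]
    obtain ⟨a, ha⟩ := htrans t ht
    rw [show orbitSum A t = orbitSum A s₀ by rw [← ha, orbitSum_smul]]
    module
  have h4 : symForm A (diff s₀) (laplacian S) = -(∑ t ∈ S, orbitSum A (s₀⁻¹ * t) +
      (S.card : ℝ) • (orbitSum A 1 - (2 : ℝ) • orbitSum A s₀)) := by
    rw [laplacian_eq_neg_sum_diff, map_neg, map_sum, Finset.sum_congr rfl h3,
      Finset.sum_add_distrib, Finset.sum_const, ← Nat.cast_smul_eq_nsmul ℝ]
  have h5 : symForm A (laplacian S) (laplacian S)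
      = -∑ s ∈ S, symForm A (diff s) (laplacian S) := by
    conv_lhs => rw [symForm_comm]
    nth_rw 2 [laplacian_eq_neg_sum_diff]
    rw [map_neg, map_sum]
    congr 1
    exact Finset.sum_congr rfl fun s _ => symForm_comm _ _
  rw [h1, h5, Finset.sum_congr rfl h2, Finset.sum_const, ← Nat.cast_smul_eq_nsmul ℝ, h4, smul_neg,
    neg_neg]

end Laplacian

variable {n : ℕ} {F : Frame}

/-- The list of all letters. -/
def letters (n : ℕ) : List ℕ := (List.range 32).filter (IsLetter n ·)

lemma mem_letters {l : ℕ} : l ∈ letters n ↔ IsLetter n l := by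
  rw [letters, List.mem_filter, List.mem_range]
  simp only [decide_eq_true_eq]
  exact ⟨fun h => h.2, fun h => ⟨h.2.2.2, h⟩⟩

lemma letter_injOn {k l : ℕ} (hk : IsLetter n k) (hl : IsLetter n l) (h : letter n k = letter n l) :
    k = l := by
  rw [letter, letter, dif_pos hk, dif_pos hl] at h
  have hne : ∀ s : ℕ, (((-1) ^ s : ℤˣ) : ℤ) ≠ 0 := fun s => Units.ne_zero _
  have h1 := transvection_apply_same (fun e => hk.2.2.1 (congrArg Fin.val e) :
    (⟨rowIdx k, hk.1⟩ : Fin n) ≠ ⟨colIdx k, hk.2.1⟩) (((-1) ^ signBit k : ℤˣ) : ℤ)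
  rw [h] at h1
  rw [SpecialLinearGroup.transvection_coe, Matrix.add_apply,
    one_apply_ne (fun e => hk.2.2.1 (congrArg Fin.val e)), zero_add, single_apply] at h1
  split_ifs at h1 with hij
  · have hi : rowIdx l = rowIdx k := congrArg Fin.val hij.1
    have hj : colIdx l = colIdx k := congrArg Fin.val hij.2
    have hs : signBit l = signBit k := by
      have hsl : signBit l < 2 := Nat.mod_lt _ two_pos
      have hsk : signBit k < 2 := Nat.mod_lt _ two_pos
      generalize signBit l = a at *
      generalize signBit k = b at *
      interval_cases a <;> interval_cases b <;> first | rfl | (norm_num at h1)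
    rw [hk.eq_mk, hl.eq_mk, hi, hj, hs]
  · exact absurd h1.symm (hne _)

lemma sum_elementaryMatrices (hn : n ≤ 4) {V : Type*} [AddCommMonoid V]
    (f : SpecialLinearGroup (Fin n) ℤ → V) :
    ∑ s ∈ elementaryMatrices n, f s = ((letters n).map fun l => f (letter n l)).sum := by
  have hnd : (letters n).Nodup := List.nodup_range.filter _
  have himg : elementaryMatrices n = (letters n).toFinset.image (letter n) := by
    ext g
    simp only [Finset.mem_image, List.mem_toFinset, mem_letters]
    exact ⟨fun h => exists_letter hn h, fun ⟨l, hl, e⟩ => e ▸ letter_mem hl⟩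
  rw [himg, Finset.sum_image, List.sum_toFinset _ hnd]
  intro k hk l hl h
  exact letter_injOn (mem_letters.1 (by simpa using hk)) (mem_letters.1 (by simpa using hl)) h

lemma card_elementaryMatrices_eq (hn : n ≤ 4) :
    (elementaryMatrices n).card = (letters n).length := by
  rw [Finset.card_eq_sum_ones, sum_elementaryMatrices hn]
  simp

/-- The terms for the symmetrization of `q Δ² - e Δ`, where `N` is the number of generators. -/
def lapTerms (N q e k : ℕ) : List (ℤ × ℕ) :=
  ((q : ℤ) * N ^ 2 - e * N, 0) :: (-2 * (q : ℤ) * N ^ 2 + e * N, 1) ::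
    (witnesses N k).map fun d => ((q : ℤ) * N, classIdx d)

/-- The witnesses for the letters: the signed permutations in `t` move the letter `s` to all other
letters, and the digits of `k` describe the quotients of the letters by `s`. -/
structure Frame.HasLetters (F : Frame) (n s t k : ℕ) : Prop where
  isLetter : IsLetter n s
  rep_zero : F.rep 0 = []
  rep_one : F.rep 1 = [s]
  trans : ∀ l ∈ letters n, ∃ d ∈ witnesses (letters n).length t, (F.signedPerm d).act s = l
  quotient : ∀ p ∈ (letters n).zip (witnesses (letters n).length k), classIdx p.2 < F.classes ∧
    wordKey [s] (F.witnessKey p.2) = wordKey [p.1] F.start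

lemma length_witnesses (m k : ℕ) : (witnesses m k).length = m := by
  induction m generalizing k with
  | zero => rfl
  | succ m ih => rw [witnesses, List.length_cons, ih]

lemma word_singleton (l : ℕ) : word n [l] = letter n l := by
  rw [word_cons, word_nil, mul_one]

lemma map_eq_map_of_zip {α β γ : Type*} {f : α → γ} {g : β → γ} {l : List α} {l' : List β}
    (hl : l.length = l'.length) (h : ∀ p ∈ l.zip l', f p.1 = g p.2) : l.map f = l'.map g := by
  conv_lhs => rw [← List.map_fst_zip hl.le, List.map_map]
  conv_rhs => rw [← List.map_snd_zip hl.ge (l₁ := l), List.map_map]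
  exact List.map_congr_left h

/-- The terms in `lapTerms` represent the symmetrization of `q (Δ² - ε₀ Δ)`. -/
lemma termSum_lapTerms (hF : F.IsValid n) {s t k : ℕ} (hL : F.HasLetters n s t k) (q e : ℕ)
    {ε₀ : ℝ} (he : ε₀ * q = e) :
    F.termSum n (lapTerms (letters n).length q e k) = (q : ℝ) • symmetrize (Aut n)
      (laplacian (elementaryMatrices n) ^ 2 - ε₀ • laplacian (elementaryMatrices n)) := by
  have hn := hF.le_four
  have htrans : ∀ g ∈ elementaryMatrices n, ∃ a : Aut n, a • letter n s = g := fun g hg => by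
    obtain ⟨l, hl, rfl⟩ := exists_letter hn hg
    obtain ⟨d, -, hd⟩ := hL.trans l (mem_letters.2 hl)
    exact ⟨_, hd ▸ (SignedPerm.aut_spec hn (isPerm_signedPerm hF) hL.isLetter).2⟩
  have h0 : F.classElem n 0 = 1 := by rw [Frame.classElem, hL.rep_zero, word_nil]
  have h1 : F.classElem n 1 = letter n s := by rw [Frame.classElem, hL.rep_one, word_singleton]
  have hquot : ∀ p ∈ (letters n).zip (witnesses (letters n).length k),
      orbitSum (Aut n) ((letter n s)⁻¹ * letter n p.1)
        = orbitSum (Aut n) (F.classElem n (classIdx p.2)) := by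
    intro p hp
    obtain ⟨hlt, hkey⟩ := hL.quotient p hp
    have hl : IsLetter n p.1 := mem_letters.1 (List.of_mem_zip hp).1
    have hs1 : ∀ l ∈ [s], IsLetter n l := by simpa using hL.isLetter
    have hl1 : ∀ l ∈ [p.1], IsLetter n l := by simpa using hl
    have helem : word n [s] * F.witnessElem n p.2 = word n [p.1] := by
      refine IsKey.eq hn ((isKey_witness hF hlt).wordKey hn hs1) (hkey ▸ isKey_word hF hl1) ?_ ?_
      · exact wordBall_mono _ (show 1 + 4 ≤ 6 by norm_num)
          (mul_mem_wordBall (word_mem_wordBall hs1) (witnessElem_mem_wordBall hF hlt))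
      · exact wordBall_mono _ (show 1 ≤ 6 by norm_num) (word_mem_wordBall hl1)
    rw [word_singleton, word_singleton] at helem
    rw [← helem, inv_mul_cancel_left, orbitSum_witnessElem hF hlt, Frame.classElem]
  have hsum : F.termSum n ((witnesses (letters n).length k).map fun d =>
      ((q : ℤ) * (letters n).length, classIdx d)) = ((q : ℝ) * (letters n).length) •
      ∑ g ∈ elementaryMatrices n, orbitSum (Aut n) ((letter n s)⁻¹ * g) := by
    rw [sum_elementaryMatrices hn, Frame.termSum, List.map_map, List.smul_sum, List.map_map]
    congr 1
    refine (map_eq_map_of_zip (length_witnesses _ k).symm fun p hp => ?_).symm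
    simp only [Function.comp_apply]
    rw [hquot p hp]
    push_cast
    rfl
  rw [map_sub, map_smul, symmetrize_laplacian htrans, symmetrize_laplacian_sq
    (fun _ => inv_mem_elementaryMatrices) smul_mem_elementaryMatrices htrans,
    card_elementaryMatrices_eq hn, lapTerms, termSum_cons, termSum_cons, hsum, h0, h1]
  push_cast
  rw [← he]
  module

end

section

open Matrix
variable {n : ℕ} {F : Frame}

/-! ### Summation over the classes -/

/-- The sum of the coefficients in a class. -/
def classSum (ts : List (ℤ × ℕ)) (c : ℕ) : ℤ := (ts.map fun t => if t.2 = c then t.1 else 0).sum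

lemma classSum_cons (t : ℤ × ℕ) (ts : List (ℤ × ℕ)) (c : ℕ) :
    classSum (t :: ts) c = (if t.2 = c then t.1 else 0) + classSum ts c := by
  simp [classSum]

lemma termSum_eq_sum_classSum {K : ℕ} {ts : List (ℤ × ℕ)} (hts : ∀ t ∈ ts, t.2 < K) :
    F.termSum n ts
      = ∑ c : Fin K, ((classSum ts c : ℤ) : ℝ) • orbitSum (Aut n) (F.classElem n c) := by
  induction ts with
  | nil => simp [termSum_nil, classSum]
  | cons t ts ih =>
    rw [termSum_cons, ih fun t' h => hts t' (by simp [h])]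
    have h : (t.1 : ℝ) • orbitSum (Aut n) (F.classElem n t.2) = ∑ c : Fin K,
        (((if t.2 = c then t.1 else 0) : ℤ) : ℝ) • orbitSum (Aut n) (F.classElem n c) := by
      rw [Finset.sum_eq_single (⟨t.2, hts t (by simp)⟩ : Fin K)]
      · simp
      · intro c _ hc
        rw [if_neg fun e => hc (Fin.ext e.symm)]
        simp
      · simp
    simp only [classSum_cons, Int.cast_add, add_smul, Finset.sum_add_distrib]
    rw [h]

/-- The function `absDigits` computes the sum of the absolute values of balanced digits, whatever
stands above these digits. -/
lemma absDigits_eq (K : ℕ) (T : ℕ) (S : ℕ → ℤ) (B : ℤ) (hS : ∀ c < K, |S c| < 2 ^ 95)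
    (hT : (T : ℤ) = ∑ c ∈ Finset.range K, S c * 2 ^ (96 * c) + B * 2 ^ (96 * K)) :
    (absDigits K T : ℤ) = ∑ c ∈ Finset.range K, |S c| := by
  induction K generalizing T S with
  | zero => simp [absDigits]
  | succ K ih =>
    set U := T + 2 ^ 95 with hU
    set R : ℤ := ∑ c ∈ Finset.range K, S (c + 1) * 2 ^ (96 * c) + B * 2 ^ (96 * K) with hR
    have hUR : (U : ℤ) = S 0 + 2 ^ 95 + 2 ^ 96 * R := by
      have h : ∀ c ∈ Finset.range K, S (c + 1) * 2 ^ (96 * (c + 1))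
          = 2 ^ 96 * (S (c + 1) * 2 ^ (96 * c)) := fun c _ => by
        rw [mul_add, pow_add]; ring
      rw [hU, Nat.cast_add, hT, Finset.sum_range_succ', Finset.sum_congr rfl h, hR,
        ← Finset.mul_sum, mul_add 96 K 1, pow_add]
      push_cast
      ring
    have h0 := abs_lt.1 (hS 0 (Nat.succ_pos K))
    have hmod : ((U % 2 ^ 96 : ℕ) : ℤ) = S 0 + 2 ^ 95 := by
      rw [Int.natCast_mod, Nat.cast_pow, Nat.cast_ofNat, hUR, Int.add_mul_emod_self_left,
        Int.emod_eq_of_lt (by linarith) (by norm_num at h0 ⊢; linarith)]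
    have hdiv : ((U / 2 ^ 96 : ℕ) : ℤ) = R := by
      rw [Int.natCast_div, Nat.cast_pow, Nat.cast_ofNat, hUR,
        Int.add_mul_ediv_left _ _ (pow_ne_zero _ two_ne_zero),
        Int.ediv_eq_zero_of_lt (by linarith) (by norm_num at h0 ⊢; linarith), zero_add]
    have hdigit : (((U % 2 ^ 96 - 2 ^ 95) + (2 ^ 95 - U % 2 ^ 96) : ℕ) : ℤ) = |S 0| := by
      generalize U % 2 ^ 96 = v at hmod
      rcases le_total v (2 ^ 95) with h | h
      · rw [Nat.sub_eq_zero_of_le h, zero_add, Nat.cast_sub h, hmod, abs_of_nonpos]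
        · push_cast
          ring
        · zify at h
          linarith
      · rw [Nat.sub_eq_zero_of_le h, add_zero, Nat.cast_sub h, hmod, abs_of_nonneg]
        · push_cast
          ring
        · zify at h
          linarith
    have habs : absDigits (K + 1) T = (U % 2 ^ 96 - 2 ^ 95) + (2 ^ 95 - U % 2 ^ 96) +
        absDigits K (U / 2 ^ 96) := rfl
    rw [habs, Nat.cast_add, hdigit, ih (U / 2 ^ 96) (fun c => S (c + 1))
      (fun c hc => hS _ (by omega)) hdiv, Finset.sum_range_succ', add_comm]

/-- The sum of the absolute values of the coefficients. -/
def absSum (ts : List (ℤ × ℕ)) : ℤ := (ts.map fun t => |t.1|).sum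

lemma absSum_cons (t : ℤ × ℕ) (ts : List (ℤ × ℕ)) : absSum (t :: ts) = |t.1| + absSum ts := by
  simp [absSum]

lemma abs_classSum_le (ts : List (ℤ × ℕ)) (c : ℕ) : |classSum ts c| ≤ absSum ts := by
  induction ts with
  | nil => simp [classSum, absSum]
  | cons t ts ih =>
    rw [classSum_cons, absSum_cons]
    refine (abs_add_le _ _).trans (add_le_add ?_ ih)
    split_ifs
    · exact le_rfl
    · simp

/-- The packed sum of a list of terms has the sums over the classes as its digits. -/
lemma sumTerms_packTerm {K : ℕ} {ts : List (ℤ × ℕ)} (hts : ∀ t ∈ ts, t.2 < K) :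
    sumTerms (packTerm K) ts
      = ∑ c ∈ Finset.range K, classSum ts c * 2 ^ (96 * c) + absSum ts * 2 ^ (96 * K) := by
  induction ts with
  | nil => simp [sumTerms, classSum, absSum]
  | cons t ts ih =>
    have h1 : sumTerms (packTerm K) (t :: ts)
        = t.1 * 2 ^ (96 * t.2) + |t.1| * 2 ^ (96 * K) + sumTerms (packTerm K) ts := by
      change packTerm K t.1 t.2 + _ = _
      congr 1
      change t.1 * ((2 ^ (96 * t.2) : ℕ) : ℤ) + ((t.1.natAbs * 2 ^ (96 * K) : ℕ) : ℤ) = _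
      push_cast
      rfl
    have h2 : t.1 * 2 ^ (96 * t.2)
        = ∑ c ∈ Finset.range K, (if t.2 = c then t.1 else 0) * 2 ^ (96 * c) := by
      rw [Finset.sum_eq_single t.2]
      · rw [if_pos rfl]
      · intro c _ hc
        rw [if_neg hc.symm, zero_mul]
      · intro h
        exact absurd (Finset.mem_range.2 (hts t (by simp))) h
    rw [h1, ih fun t' h => hts t' (by simp [h]), absSum_cons, h2]
    simp only [classSum_cons, add_mul, Finset.sum_add_distrib]
    ring

lemma two_mul_sum_pow_le (K : ℕ) : 2 * ∑ c ∈ Finset.range K, (2 : ℤ) ^ (96 * c) ≤ 2 ^ (96 * K) := by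
  induction K with
  | zero => simp
  | succ K ih =>
    rw [Finset.sum_range_succ, mul_add, show 96 * (K + 1) = 96 * K + 96 by ring, pow_add]
    have : (0 : ℤ) < 2 ^ (96 * K) := by positivity
    norm_num
    linarith

/-- The packed sum determines the sums over the classes. The bound on the packed sum bounds the sum
of the absolute values of all coefficients, and hence the digits, so that these do not overlap. -/
lemma absDigits_sumTerms {K : ℕ} {ts : List (ℤ × ℕ)} (hts : ∀ t ∈ ts, t.2 < K)
    (hlt : (sumTerms (packTerm K) ts).toNat < 2 ^ (96 * K + 90)) :
    (absDigits K (sumTerms (packTerm K) ts).toNat : ℤ)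
      = ∑ c ∈ Finset.range K, |classSum ts c| := by
  set T := sumTerms (packTerm K) ts with hT
  have hA : 0 ≤ absSum ts := (abs_nonneg _).trans (abs_classSum_le ts 0)
  have hW : (0 : ℤ) < 2 ^ (96 * K) := by positivity
  have hTeq := sumTerms_packTerm hts
  -- The digits contribute at most half of the contribution of the absolute values.
  have hbound : |∑ c ∈ Finset.range K, classSum ts c * 2 ^ (96 * c)| * 2
      ≤ absSum ts * 2 ^ (96 * K) := by
    calc |∑ c ∈ Finset.range K, classSum ts c * 2 ^ (96 * c)| * 2
        ≤ (∑ c ∈ Finset.range K, absSum ts * 2 ^ (96 * c)) * 2 := by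
          refine mul_le_mul_of_nonneg_right ?_ (by norm_num)
          refine (Finset.abs_sum_le_sum_abs _ _).trans (Finset.sum_le_sum fun c _ => ?_)
          rw [abs_mul, abs_of_pos (by positivity : (0 : ℤ) < 2 ^ (96 * c))]
          exact mul_le_mul_of_nonneg_right (abs_classSum_le ts c) (by positivity)
      _ = absSum ts * (2 * ∑ c ∈ Finset.range K, (2 : ℤ) ^ (96 * c)) := by
          rw [← Finset.mul_sum]; ring
      _ ≤ _ := mul_le_mul_of_nonneg_left (two_mul_sum_pow_le K) hA
  have hneg := neg_abs_le (∑ c ∈ Finset.range K, classSum ts c * 2 ^ (96 * c))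
  have hAW : 0 ≤ absSum ts * 2 ^ (96 * K) := mul_nonneg hA hW.le
  have hT2 : absSum ts * 2 ^ (96 * K) ≤ T * 2 := by
    rw [hT, hTeq]
    linarith
  have hT0 : 0 ≤ T := by linarith
  have hcast : (T.toNat : ℤ) = T := Int.toNat_of_nonneg hT0
  have hAlt : absSum ts < 2 ^ 91 := by
    have h1 : T < 2 ^ (96 * K) * 2 ^ 90 := by
      rw [← pow_add, ← hcast]
      exact_mod_cast hlt
    have h2 : absSum ts * 2 ^ (96 * K) < 2 ^ 91 * 2 ^ (96 * K) :=
      calc absSum ts * 2 ^ (96 * K) ≤ T * 2 := hT2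
        _ < 2 ^ (96 * K) * 2 ^ 90 * 2 := mul_lt_mul_of_pos_right h1 two_pos
        _ = 2 ^ 91 * 2 ^ (96 * K) := by ring
    exact lt_of_mul_lt_mul_right h2 hW.le
  refine absDigits_eq K _ (classSum ts) (absSum ts) (fun c _ => ?_) (by rw [hcast, hT, hTeq])
  refine (abs_classSum_le ts c).trans_lt (hAlt.trans (by norm_num))

/-! ### Certified gaps -/

lemma class_lt_of_mem_zipWith {r : OrbitRep} {f : ℕ × List ℤ → ℤ} {ys : List (ℕ × List ℤ)}
    {ds : List ℕ} (hok : F.quotientsOk r ys ds = true) {t : ℤ × ℕ}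
    (ht : t ∈ List.zipWith (fun y d => (f y, classIdx d)) ys ds) : t.2 < F.classes := by
  induction ys generalizing ds with
  | nil => simp at ht
  | cons y ys ih =>
    cases ds with
    | nil => simp at ht
    | cons d ds =>
      rw [Frame.quotientsOk, Bool.and_eq_true, Bool.and_eq_true] at hok
      rw [List.zipWith_cons_cons] at ht
      rcases List.mem_cons.1 ht with rfl | ht
      · simpa [Nat.blt_eq] using hok.1
      · exact ih hok.2.2 ht

lemma class_lt_of_mem_rowsTerms {ys : List (ℕ × List ℤ)} {c : OrbitRep} (hc : c.IsValid F n) (f : ℤ)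
    (rs : List OrbitRep) (hrs : ∀ r ∈ rs, r.IsValid F n) (ks : List ℕ)
    (hok : F.rowsOk ys rs ks = true) {t : ℤ × ℕ} (ht : t ∈ rowsTerms c ys f rs ks) :
    t.2 < F.classes := by
  induction rs generalizing f ks with
  | nil => cases ks <;> simp [rowsTerms] at ht
  | cons r rs ih =>
    cases ks with
    | nil => simp [rowsTerms] at ht
    | cons k ks =>
      rw [Frame.rowsOk, Bool.and_eq_true] at hok
      rcases List.mem_append.1 ht with ht | ht
      · have hr := hrs r (by simp)
        rcases List.mem_cons.1 ht with rfl | ht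
        · exact (Nat.zero_le _).trans_lt hr.class_lt
        rcases List.mem_cons.1 ht with rfl | ht
        · exact hr.class_lt
        rcases List.mem_cons.1 ht with rfl | ht
        · exact hc.class_lt
        exact class_lt_of_mem_zipWith hok.1 ht
      · exact ih (-2) (fun r' h => hrs r' (by simp [h])) ks hok.2 ht

lemma class_lt_of_mem_terms (rs : List OrbitRep) (hrs : ∀ r ∈ rs, r.IsValid F n)
    (hok : F.pairsOk rs = true) {t : ℤ × ℕ} (ht : t ∈ F.terms rs) : t.2 < F.classes := by
  induction rs with
  | nil => simp [Frame.terms] at ht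
  | cons r rs ih =>
    rw [Frame.pairsOk, Bool.and_eq_true] at hok
    rcases List.mem_append.1 ht with ht | ht
    · exact class_lt_of_mem_rowsTerms (hrs r (by simp)) _ _ hrs _ hok.1 ht
    · exact ih (fun r' h => hrs r' (by simp [h])) hok.2 ht

lemma class_lt_of_mem_lapTerms {s t k : ℕ} (hL : F.HasLetters n s t k) (hK : 1 < F.classes)
    {q e : ℕ} {x : ℤ × ℕ} (hx : x ∈ lapTerms (letters n).length q e k) : x.2 < F.classes := by
  rcases List.mem_cons.1 hx with rfl | hx
  · exact one_pos.trans hK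
  rcases List.mem_cons.1 hx with rfl | hx
  · exact hK
  obtain ⟨d, hd, rfl⟩ := List.mem_map.1 hx
  have hlen := length_witnesses (letters n).length k
  rw [← List.map_snd_zip hlen.le] at hd
  obtain ⟨p, hp, rfl⟩ := List.mem_map.1 hd
  exact (hL.quotient p hp).1

/-- The packed sum of all terms of the error. -/
def Frame.packedError (F : Frame) (rs : List OrbitRep) (N q e k : ℕ) : ℕ :=
  Int.toNat (Int.add (sumTerms (packTerm F.classes) (lapTerms N q e k))
    (F.total (packTerm F.classes) rs))

/-- The final inequality of a certificate, for the gap `p / q` with an error relative to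
`Δ² - (e / q) Δ`. -/
def Frame.errorOk (F : Frame) (rs : List OrbitRep) (N q e p k : ℕ) : Bool :=
  (fun T => Nat.blt T (Nat.pow 2 (Nat.add (Nat.mul 96 F.classes) 90)) &&
    Nat.ble (Nat.add p (Nat.mul 8 (absDigits F.classes T))) e) (F.packedError rs N q e k)

/-- A certificate that passes all tests proves a gap. -/
lemma isCertifiedGap_of_frame (hF : F.IsValid n) (hG : F.HasCharacters n) {s t k : ℕ}
    (hL : F.HasLetters n s t k) (hK : 1 < F.classes) {rs : List OrbitRep}
    (hrs : ∀ r ∈ rs, r.IsValid F n) (hok : F.pairsOk rs = true) {q e p : ℕ}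
    (herr : F.errorOk rs (letters n).length q e p k = true) (hq : 0 < q) (he : 0 < e) {ε : ℝ}
    (hε : ε * q = p) : IsCertifiedGap (elementaryMatrices n) 2 2 ε := by
  have hq0 : (0 : ℝ) < q := by exact_mod_cast hq
  have he0 : (0 : ℝ) < e := by exact_mod_cast he
  set ts := lapTerms (letters n).length q e k ++ F.terms rs with hts
  have hclass : ∀ x ∈ ts, x.2 < F.classes := fun x hx => by
    rcases List.mem_append.1 hx with hx | hx
    · exact class_lt_of_mem_lapTerms hL hK hx
    · exact class_lt_of_mem_terms rs hrs hok hx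
  have hpacked : F.packedError rs (letters n).length q e k
      = (sumTerms (packTerm F.classes) ts).toNat := by
    rw [hts, sumTerms_append, ← total_eq]
    rfl
  rw [Frame.errorOk, hpacked, Bool.and_eq_true] at herr
  obtain ⟨hlt, hle⟩ := herr
  have hlt : (sumTerms (packTerm F.classes) ts).toNat < 2 ^ (96 * F.classes + 90) :=
    Nat.blt_eq.mp hlt
  have hle := Nat.le_of_ble_eq_true hle
  have hdig := absDigits_sumTerms hclass hlt
  have hdig' : (absDigits F.classes (sumTerms (packTerm F.classes) ts).toNat : ℝ)
      = ∑ c : Fin F.classes, |((classSum ts c : ℤ) : ℝ)| := by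
    rw [← Int.cast_natCast, hdig, Finset.sum_range]
    push_cast
    rfl
  obtain ⟨ι, _, x, hx1, hx2, hx3⟩ := exists_squares_of_pairForm hF hG hrs
  refine isCertifiedGap_of_symmetrize (A := Aut n) (fun _ => inv_mem_elementaryMatrices)
    smul_mem_elementaryMatrices (by norm_num) (by norm_num) x hx1 hx2
    (fun c : Fin F.classes => ((classSum ts c : ℤ) : ℝ)) (fun c => F.classElem n c) hq0
    (div_pos he0 hq0) (ε₀ := e / q) ?_ ?_
  · rw [← termSum_eq_sum_classSum hclass, hts, termSum_append,
      termSum_lapTerms hF hL q e (div_mul_cancel₀ _ hq0.ne'),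
      termSum_terms hF hL.rep_zero (pairForm_comm hF hG) rs hrs hok, hx3, sub_eq_add_neg]
  · rw [← hdig', eq_div_of_mul_eq hq0.ne' hε, ← mul_div_assoc, ← sub_div]
    refine div_le_div_of_nonneg_right ?_ hq0.le
    have h : (p : ℝ) + 8 * absDigits F.classes (sumTerms (packTerm F.classes) ts).toNat ≤ e := by
      exact_mod_cast hle
    norm_num
    linarith

end

section

/-! ### The certificates -/

/-- The frame of the certificate for `SL(3, ℤ)`. -/
def frameThree : Frame where
  start := 1208925819615728686333953
  perms := 16347118480562286412739433177697116402814586070443373746746953003348153931812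
  reps := 56919253180414461576295696952608072710482387140532272601060767047523230933772313671906205962928923246583067114332741672825515139498768607499836917046439873810529605249291107295928615019106985851818988268413852295177034467689747872904646784458946797734869472207091833646276705890198055102702910503204357793383440911968825257582169397884600899406579439915060286769673300574459164193576867780197210498521998450536467932010837037450545601215603662723273864558546179850098470102284519568384982088034316087038191518148544354558075340362232994565752182257086318558929188045554520674868920320
  classes := 97
  chars := 8
  central := ⟨36, 3, 0⟩
  gens :=
   [(⟨36, 1, 0⟩, [1, -1, 1, -1, 1, -1, 1, -1]),
    (⟨33, 0, 0⟩, [1, 1, -1, -1, 1, 1, -1, -1]),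
    (⟨36, 0, 1⟩, [1, 1, 1, 1, -1, -1, -1, -1])]

/-- The orbit representatives of the certificate for `SL(3, ℤ)`. -/
def orbitRepsThree : List OrbitRep :=
  [⟨[20], 1024,
    [[12329233], [], [], [25894157], [], [26313148], [11982680], []],
    [73787187401607610368, 129127630729774105603, 166021189590340076545, 184467511176707445763,
     202987087107872271360, 239880715993316602880, 276774344878760934400, 222605123051591058432,
     332114788206927431680, 277368611191898506273, 314316702942438109325, 297076433873362224224,
     405829291292359142534]⟩,
   ⟨[20, 1], 3075,
    [[-408935, 1862399], [], [], [-1183018, 2499582], [], [-1637440, 3509336], [-768239, 1821512],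
     []],
    [442723476250683244544, 479616964541714270208, 516509115546091916289, 240475193549320369185,
     535029747076871255040, 571923375962315586560, 241611439379277972480, 627263819290482083840,
     700978878454161223680, 756319321782327727170, 793212599717672791105, 848553393995938541581]⟩,
   ⟨[20, 20], 4097,
    [[-843238, 648008, 2149464], [], [], [-628596, 2237352, 3462510], [],
     [-717235, 1234703, 3918026], [-94574, 1266342, 2045669], []],
    [903893837324105023488, 940784158878841466881, 277368822434764700705, 572517853518319352865,
     959306479259481067520, 405832173937764653056, 1014646922587647564800, 1088361981751326682112,
     1143702425079493182497, 1180594862713076723780, 1217487787911079281664]⟩,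
   ⟨[17, 20], 2049,
    [[-287410, 726263, 10678, 1502067], [], [], [443384, -2500424, 677824, 396001], [],
     [-909583, 494337, 263589, 2744624], [-35712, -1030837, 61124, 1134945], []],
    [1254380356248839127040, 332709265762931197985, 627858296846485850145, 1015241400143651331105,
     351321659578439504896, 1291349139228480051200, 1328166418024364288072,
     1383507217458449687552, 1420400072700024885257, 1457293982510690119689]⟩,
   ⟨[24], 1056,
    [[-60411, 2080349, 6713148, 13123050, 8828019], [], [17735963], [], [14599902], [],
     [-6273615, -616223, 1425791, -14621420, 10338785], []],
    [969298354322432650267898462728049237962893, 1146926373583625625999762486072472319309839,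
     1320556167520017707208396389729516121768110, 89925973770101377167836720007415359616143,
     1582489516379674549694537121448153084087470, 1051478175030888197026319236066725845020804,
     1666366407507387492050915502889496504457319, 1931021705711509930904094138724287570267208,
     87203363707998555958586810544250275772485]⟩,
   ⟨[24, 2], 3107,
    [[330160, -1384554, -434143, -841739, 1245629, 278085], [], [-820345, 3054750], [],
     [-1018390, 3002839], [], [306057, 1354794, -470898, 1367549, 125514, 1246231], []],
    [2538091117971023342289979470972952527009933, 2714953533059157692590141734930027902435439,
     1057014100071954145504913751243087510279271, 2976291408222639361010469798656397746408622,
     1138765942777137211925362823676002653713542, 3842302357191648647375841451751548896721006,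
     4021982445181670907070146579019584569913443, 964544381151654642627517141332380816544878]⟩,
   ⟨[24, 24], 4129,
    [[1306980, -848917, -1672860, 927276, -407946, -155066, 45155], [],
     [-2143768, 1159610, 3325248], [], [26526, 1833694, 1715118], [],
     [224977, 493386, -2877840, 297761, 490851, 1189319, 2561285], []],
    [4540915702168604052784093463221463844181133, 969313318916341106840448924482354222524586,
     4805656391265738370367911601192887089946798, 1931035342034410824446840682181243442845799,
     5671662011962079886596558182026314307668078, 5764225814329168117147609385660875775739054,
     1051918857332089099684516983985532463265895]⟩,
   ⟨[24, 25], 11399,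
    [[563006, 241082, -19159, -4206555, -3187108, 6963562, -518938, 1293876], [2459981], [], [],
     [-6860273, 1023617, -2776115, 4399076], [-516989, 1242392, -4136496, 802070, 1194305], [],
     []],
    [27249179024194417019959725615076163584, 3662735937376214631854958493883270584665124,
     1051903849589961685264845392657359274526889, 182482734139040794963096401457630967058432,
     1400353992183927159178358057085717476354155, 958348794256951842818441764748456195033257]⟩,
   ⟨[18, 24], 2081,
    [[1749362, -898904, 1124160, 710777, -63984, -231694, 16365, -28686, 39598], [],
     [-1665395, 1313162, -1162207, 263069], [], [-1134300, -1574532, 123374, 299412, 868355], [],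
     [-1302919, -488376, 65368, -566304, -197981, -1543899, 324725, 66570], []],
    [6109708465815926886270705269755477508299917, 1666385715783114363184745157038022355078216,
     6804130721500564256556338845848176708369511, 6896423321116211681828005376944544555808942,
     3144744804495171573077753079647829532093506]⟩,
   ⟨[20, 24], 11269,
    [[-6885764, -719433, -3913326, -3472436, 212471, -6631883, 495095, -1277470, -20215, 66977],
     [675033, 6733687], [-5835060, -1221285, -3897093, -12114044, 1814649],
     [-12821277, -5852499, -1201241, -2711662, 283002],
     [-6835589, 1029051, -2772345, -7384952, 4073304, 320567],
     [-14021892, -5249441, -3259165, -2238138, 2050892, 97637],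
     [-8301154, 1978817, -3121760, 7960334, -2843631, -1708796, -3924050, 104158, 185140],
     [3048619]],
    [608466114865287964009666642811640369770992914515429087949531290134556295145992333,
     21512281250034161791569948922139522077693330642536146655516537840311136273017492488333,
     21626109498569479693757761200755050978758329798541611698428209288453804029399993682020,
     2127240129234785857482761964238931558861700056288199020538443858201758711336259826831]⟩,
   ⟨[24, 6], 12421,
    [[2038591, 3168654, -1550933, -2777116, -2845439, -107309, -5870, -4249, -13847, 3597, 58404],
     [4327598, 96007, 5056575], [-1908996, 2203877, 2503702, -7306521, 1084428, 6756882],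
     [-661168, 5443449, -13982364, -2166238, 75278, 128942],
     [-7668483, 1720639, 1931187, -5817874, 4875415, 245408, 5108523],
     [481612, 1729748, -9599182, 9601581, 3388672, 46950, 111562],
     [3711517, -3575479, 868972, -923085, -4423597, -2732170, 789555, -16, -100161, 88176],
     [1051309, 6164967]],
    [666964416630311816576472420298601197054798136397759307362368267790920069920603211,
     27344140693433073207538040933981076931740407908096410344198932618103418508871088229505,
     37032266793156974968718349059734511311533019188038577170775873035882321476570841091168]⟩,
   ⟨[20, 9], 12361,
    [[-3977181, 222461, 2075213, -1497664, 1362876, -6017269, 427028, -1153716, 1039, 23254, -299,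
      64266],
     [-10266483, 8017804, 16505169, 366971],
     [2439809, 4328278, 1154435, -3624830, 553610, -6755795, 118193],
     [-11087165, -7168989, 2255319, 6971083, -545690, -80138, 132143],
     [5122131, -5096112, -322221, -7625469, -352711, 64164, 5105064, 184928],
     [-12739632, -1292479, 4246350, -5267887, 3149772, 119954, 3197, 100243],
     [-6824344, -1896510, 644197, 3108184, 1471016, 1851051, 1588608, -8799, 4515, -50081, 79875],
     [15750836, 5497794, 228908]],
    [667194923069942600496058216895721814464272355082213156843518275041534448711250050,
     29394509933277533284393399281497847843981264128720676913814792287491933939348514550951]⟩,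
   ⟨[25, 20], 12356,
    [[-1383574, -3676289, -2563580, 292206, -170139, 6279940, -432360, 1165336, 2997, -16804,
      -21514, -30843, 62890],
     [8742957, -7892237, -2532302, -153380, 71896],
     [4339411, 2122513, -1355286, 3699562, -533451, 6755979, -68221, 74825],
     [-2299045, 1569317, -3089590, -4464837, 363743, 50768, -64130, 52968],
     [-2576362, -3386393, 1602944, 6660189, -2433140, -237590, -5106247, -101483, 76104],
     [4425116, -207700, -7966818, 151585, -8075480, -254811, -85948, -163142, 108824],
     [2470688, -5055490, -11320, -7091176, 3375414, 3369808, -1706079, -204849, -104676, 18398,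
      -22710, 118626],
     [-7627883, 3510195, -113568, 69653]],
    [667954300493567188461138223070165514484505921924365751471536177947061777421647872]⟩]

/-- Witnesses for the transitivity of the signed permutations on the letters. -/
def letterCertsThree : ℕ :=
  449944270714391057740975967893973624670165682397106850148910082

/-- Witnesses for the products of the inverse of the letter `20` with the letters. -/
def lapCertsThree : ℕ :=
  4967464492944106797711962529186497189555913611050696607221417984

/-- The frame of the certificate for `SL(4, ℤ)`. -/
def frameFour : Frame where
  start := 1329227995786124798723422788966678529
  perms := 103531750376894480609073179127427685560986014060395858581973565591239905555684
  reps := 6601742130194390792468066154038257128625848659754705715508095561785340996008929904743552496331410746920057045651849827841990611343478076619579570919009676095334955954528588191480010155699203218487303749755127258115349184588053244673618928551511818404608735689759259600998709369959609810259629089734131290372751345589960968374978588998624871992096667836275011846871318532511182191598347311588397865881463604420732221824198099694603464889896057383925256528534818221038322827755853961990169549105583203129165854008479099105351095578269269923164623742898645952813443585351245304660517754079208733065553357098472415211698764924688472921561731472906059888819122239012234217522876504804794879868660582624856576927549762503150207600174933102944863980746650249474637610888652179000173517332881198296347382145738812168422149467454106478999568850857692230756248379206995605431173205177313834595410050067449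168994608740946435158079523236590286238770091181821301480843578002009037296322182261565883815927583078210124678048884506503363725626484042496490705939007512316312983580819943085610123658410433863580136724678626609802628205719781565851288209202520588033878605628646736462776642795781000493259121161498170004653210874569101946835076897868832690259722395471792016877566897337430704128
  classes := 212
  chars := 16
  central := ⟨228, 3, 0⟩
  gens :=
   [(⟨228, 1, 0⟩, [1, -1, -1, -1, -1, 1, -1, -1, 1, -1, -1, -1, -1, 1, -1, -1]),
    (⟨228, 4, 0⟩, [1, 1, -1, 1, 1, 1, 1, -1, 1, 1, -1, 1, 1, 1, 1, -1]),
    (⟨225, 0, 0⟩, [1, 1, 1, -1, 1, -1, -1, -1, 1, 1, 1, -1, 1, -1, -1, -1]),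
    (⟨180, 0, 0⟩, [1, 1, 1, 1, -1, -1, -1, -1, 1, 1, 1, 1, -1, -1, -1, -1]),
    (⟨228, 0, 1⟩, [1, 1, 1, 1, 1, 1, 1, 1, -1, -1, -1, -1, -1, -1, -1, -1])]

/-- The orbit representatives of the certificate for `SL(4, ℤ)`. -/
def orbitRepsFour : List OrbitRep :=
  [⟨[20], 1024,
    [[13285997], [], [], [24959537], [], [], [], [], [], [23189826], [], [], [], [], [], []],
    [73787187401607610368, 92306132212840666112, 147574445172496270339, 184468004033062241281,
     202914255250685433859, 221433831662622093312, 239880647754617992192, 258327459998308513792,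
     276774344878760934400, 313667973764205265920, 249121996944420374017, 350561602649649597440,
     387455231535093928960, 298698373365274795008, 443083849988748369920, 461242489305982592000,
     498424349667090263040, 351732331914927539265, 425574261458112364941, 373745997605638505728,
     571850280427759091078, 445318183237676195988, 444255056853788811345, 408658952639892969625,
     499595033437488835665]⟩,
   ⟨[30], 1536,
    [[-5947804, 11881520], [], [], [], [], [], [], [], [], [], [], [], [], [], [], []],
    [83010594622968692736, 230729296203143197184, 249122069374488294912, 267622924813708573184,
     156797852393857353219, 193691411529301231105, 212137662472046516739, 302805108805926928825,
     335123087616815679675, 239880575599426667521, 378339769898050015770, 426311908964213998000,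
     415233390193526987290, 456450554436143047406, 489020657035421182490, 525986343033866318362,
     444254986347341963333, 616940686239499847127, 521608631989499097355, 594422831520742408437,
     324729764907331906152, 376592296690720703553, 538289374571254020265, 487271540123702412731]⟩,
   ⟨[20, 1], 3075,
    [[-744747, 212496, 3672178], [], [], [-923522, 1927686], [], [], [], [], [],
     [-918321, 5763388], [], [], [], [], [], []],
    [645638435117674266624, 682531923411658082304, 719423300359849774081, 737944637570676989952,
     756391450364125422592, 774820252607368964096, 314838914271544099905, 793285149274981575680,
     867000208438660699175, 885519221488592404480, 922412850374036736000, 318282065238947844096,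
     978041468827691176960, 996200108144925399040, 1033381968506033070080, 1106808796194048851968,
     1162149239522215360706, 1199042517457560419521, 1254383311735826169869,
     1272902324785757885440, 1309795828395118238720, 1328242768113924382720,
     1365136396999368714240]⟩,
   ⟨[20, 20], 4097,
    [[-11207, -106738, -1352231, 1126074], [], [], [-203479, 1548481, 2076653], [], [], [], [],
     [], [-59551, -1630527, 2022256], [], [], [], [], [], []],
    [1438851456163047800832, 1475739737024203103233, 765632872052715726337,
     1494264029859725263872, 1512710842103415785472, 351732543156988431425, 886690161995931238465,
     1549529812224918426624, 1568051355869312537600, 1604944984754756869120,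
     571855342305739367424, 1660573603208411310080, 1678732242525645532160,
     1715914102886753203200, 1789340930574768946176, 1844681373902935448641,
     1881572694432705167556, 1918465619630707727360, 1936987644723755852800,
     1937942478213771011133, 1992328088051922350080, 2029221716937366681600]⟩,
   ⟨[17, 20], 2049,
    [[31374, -63853, -834309, 824520, 657870], [], [], [143018, -1284322, -447497, 1037766], [],
     [], [], [], [], [-78253, -969216, 1287573, 1540537], [], [], [], [], [], []],
    [2084484613634034499584, 784079688075991886337, 1521952264341761903105,
     2103008907156752025600, 462413429813321425985, 997371048652264233025, 2121375922747790373897,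
     1679903183032984366145, 2139902603593699676160, 481028785713188558848,
     2195531222047354117120, 2213689861364588339200, 2250871721725696010240,
     2287397391342471807176, 2342738551420095689728, 2379631054817949968393,
     2416525105366103558153, 2435051634677254328320, 2471945263562698659840,
     2508838892448142991360, 2545732521333587322880]⟩,
   ⟨[30, 11], 3587,
    [[523015, -571466, -3224156, 333329, -313906, 1696855], [], [], [], [], [], [], [], [], [],
     [], [], [], [], [], []],
    [654861842339036397568, 691755330633019165184, 728646707581210856961, 339698738309848910265,
     819315913820625220025, 876223615660021781540, 913297389218030994970, 972382441496205870514,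
     950191018103475326490, 991408173275085854446, 1023978275874363989530, 1060943962628724155930,
     1392986622597724188190, 1356092993712279856670, 1304229472233500252895,
     1300680492515196475930, 1245358205409089882650, 1212048949259320966578,
     1134494893364004583946, 1079315827419031072266]⟩,
   ⟨[30, 30], 4609,
    [[-90033, -57345, 1289639, -977082, -234698, -327139, 562338], [], [], [], [], [], [], [], [],
     [], [], [], [], [], [], []],
    [1448074863384408883200, 1484963144245564186113, 376592366576815591865, 905767364112692331640,
     1558753219721157415937, 1594082119796478532025, 1654912950867459604179,
     1632723152003157287450, 1673940307655805987566, 1706510410255084122650,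
     1743476096253529258522, 2057071941779805027870, 2020178313650277824030,
     1983861074667086130750, 1964765812453194443290, 1119548179495468244506,
     1894579112284411937209, 1817186083096798793226, 1761845287306434281994]⟩,
   ⟨[27, 30], 2561,
    [[-71166, 78, 751161, -905994, 365452, -132087, 435375, 287444], [], [], [], [], [], [], [],
     [], [], [], [], [], [], [], []],
    [2093708020855395581952, 487273253851626236345, 1022230872690569043385,
     2130599294647340414469, 1704763007071289176505, 2189868170915627952744,
     2167680771323138266650, 2208897926494748794606, 2239720625910231983545,
     2278433715848387096090, 2573582746931942796830, 2536689118046498465310,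
     2500371952112389201470, 2462829802406692918810, 426319994990516636186,
     2392637465522831157770, 2333702101308170335331, 1912755372586800005561]⟩,
   ⟨[24], 1088,
    [[-1705264, -2760218, -2648358, 646366, 4096254, -10127561, 10648149, 1824624, 9271458], [],
     [], [], [], [20494239], [], [], [31822464], [], [], [], [], [37208493], [], []],
    [9836696189315853021391192200716802699885068682365265461727043231654016989854096954465,
     23919202088736135041541224476229111318780223259793345060759917733515534053147329704267,
     47925670132673680562264553181775678921110949343217284037721229409069332251759722651982,
     25861878565400055229526257328156700102476225324862797534381916927643566662271418512739,
     52772855452006560654576568389197616546028913918342434742356059250547733563884518531241,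
     53006205532438385529642593986265609887034825275934865194046160560286034919805945143751,
     2066087107124316508558747665807141589416823791042395391514889756608625622297299136581,
     27804554636905128228207048223592996435606474993536676303853772720640957684282830108995,
     23456306234192877117208812310790975748594649789624985709007430526076732197158679479361,
     46641327885792162457358174369024582719692240507990118355981226090608619769500713380868,
     54996301561669797141528104065075719334417934146802259819998904537253999723713240785203,
     64645128349658826581490048742270577096907849881362961368669822612389043274618453645595,
     43143051914912325562681747943808960431807394289811346230268493332731162047991938057429,
     44103006929545506847330961215839798110918429938174150262912474573286993627047464306334,
     48077500794401938633299756258984673035248929932193450119087125965681303162323286393229,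
     54753470106826277281751327703331895070319306376410416634478907320348505560526658757193,
     47631637434739337516462668370991726955879392814847039247727965816078947768021263609363]⟩,
   ⟨[24, 2], 3139,
    [[-696640, -1128121, 239461, 12081, 313768, 1027946, -347671, 76293, -2187783, 1159698], [],
     [], [], [], [333332, 2121885], [], [], [-60657, 4140282], [], [], [], [],
     [-2491273, 2155307], [], []],
    [77830366792288061059253335099380133461812636516358126452986771189792680848973926539361,
     104263282918157571920049827084163156618506344767757404545109672858978932478640549057870,
     80256814859802250889563677066079858408172833069962495592379860388643298396947711305033,
     145021549916760527332184278644473278707076212480647792592702974447645688035195624172887,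
     144425848807957661815514530069451595697582015146605732075409677024154875438111177911664,
     9905291156371987003190055357998008697036673648616022691511018862258335259174864206144,
     82199491372764470856613106974936607983124820217357543960494558062382211887643130374505,
     89977792574416062846337080750830179958914469380457512078906571974491039675847436145733,
     146364715999156184878509001632958176450038454385864578147558735339296454479333192968526,
     137260330704478312513691030888755746769658991443742944238329335119102494842019446070638,
     142479363393855311343753857267640962868755941024086644124365365467645012035762751349070,
     140540496202033088722652755927524059000676343678105750248370668794288092328131569984880,
     141136199677563818369343051250223754963736695915578042788040641785305920795998793836190,
     135292993610145265582976388941914998899686392339609349276097107612610408047465700334230,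
     136664631397209494314188254940915827742934113222556433036608607417008343701857832869504,
     146415941072434742709648496107236747382723490471997183405238432976745714442130918025888]⟩,
   ⟨[20, 30], 5125,
    [[-1944250, -3147103, 22781, -117064, 243261, 161067, -348134, 21804, -955741, -957356, 349917],
     [], [7059844], [-5871479, 1154830, -2142599, 1931167, 7062926], [5675026],
     [-2466160, 852284, 3690261], [], [5122227], [],
     [-7311075, 223514, 1239107, -1452354, 9150889], [], [], [], [], [12160893], []],
    [7770986840923214650357202656487104817141524873556560074084615819266431370999940513792,
     174971772994036528860057758815535284158388827339287942013693139803530165094368536258625,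
     46761684846652167719951358645971380362649549347892486922784933403441292563376085426252,
     62631252178595987837918075541575185430002041196506879479864687479955906570077752406554,
     279783331997389583402215032844979530192594201340060302573962329319322975536602034616320,
     231309385779520116541003773933116114726525858860549382590447118577784157851314901867585,
     281818969656159221714196994248156451678944086055013950594147012140851521221891600563265,
     204058564748287045046572030905693271962948603416367125786409403880478896165865387999673,
     301145173863378344954726376295513437551472434364395455028701496475560649722805132220829,
     208245554856470686950241694542603258964532905441186052597469714066772185549017327878625,
     305029920218107502826092403080716114752547685387294995069471676143274293379573568789018,
     271387592464906400365311467928628634246549859418928115606879598246340217968262916484815,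
     29148618862347241992308711981551722426656997571764319289211074519804226371011669933056,
     300162467660952552108755073307896936703260274014289590753376402644391677078999230212622,
     144786528796216724579633381552717580256132048963709512566738660156623293285162605685274]⟩,
   ⟨[24, 24], 4161,
    [[354639, 574408, -16305, -45851, 520709, 39274, 144734, 141247, 299549, 166332, -62789,
      128930],
     [], [], [], [], [-674657, -79799, 584552, 656670], [], [], [1335155, 2999213, 1477760], [],
     [], [], [], [-1544159, 263069, 3404617], [], []],
    [157480095213172188978581694736014558718289653368367889849027904544614367663645640705121,
     214914265024835701565315551008810709452037802679973138656032836261533468917832076869278,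
     214362195714075025687775959800665168801505177226027170082501655605453363533260809158000,
     9837275810536485576790051194400079928052480523530937088435860970537522002931470089575,
     159906543237292863468658409967301863650952387892495224098498118498890814758758233753923,
     91930221271698342926502441021303218759928633206584271151294263895677022276868504032353,
     216301062825694867488933338485546877541853687029529159609314319907193987487411304249667,
     208591058664610430632926350884191466273880085093719100412905605790959639828343295681867,
     212415710299972868464910454556431007516908098881706680264196872368889968072805842530638,
     210476843108094907397497300028162767748314714460087183812566427199355536836655822517616,
     211072546583709642177356746524091683610803469957940301442318977078686568338600966600350,
     205229340516278917685407125474691063110069856893008028654927562356651418737472769206934,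
     209088111217167439404826566138820148270975439513839488757516496961484452408742572566193,
     216919532117344102235228736814438073727083884251844044552050186399725087779346100370080]⟩,
   ⟨[24, 28], 15465,
    [[115400, 918766, 358539, -1961098, -30990, 1236550, -1421118, 2585538, -1597195, -1671925,
      426974, 10543, 3253060],
     [], [], [], [], [], [], [], [-5251035, -1303440, 1119429, 1861994], [], [], [], [], [], [],
     []],
    [283828146318451824833136461897267629840199428440353022270728535326534852614667729270784,
     9837866465986977908049012344176032897541102455866567773440476550183620312402769644544,
     29873331506373527825116320428219396442514178377551335868901472041377693097153474403683,
     268869063726940358110777945552852114951748089398632786431333099742551461353237802528137,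
     144450733845075328395051277422222591648492960972492230293522180395592127959349046034825,
     64646010631139425104134042666608365650538305404601665369713946485025866523639003624787,
     239549866594877201515788036057671111379225714524503808976206554289545712965305243036676,
     328341769455234018942836431778591830877951987364598706645023704323580252979211240786203,
     31548775743349535796023138062943028353092791912759759902808614898452284547109435650048,
     297783616409520223986811483568596960142528699948468532889678533348092734588015282928640,
     43737936548862656677638196981758944432865003217656572891472870868012957915856331633162,
     278485955078627223180611331058315428397968904523546920541163369440021383448631503406406,
     47653440784715807897600661168761451774787874155884433048395707360616041157165701432713]⟩,
   ⟨[24, 25], 15751,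
    [[767016, 513725, 79513, 1144101, 1701690, 1015164, -1677229, -2475455, -1595537, -1673424,
      427164, 10618, -3227999, 403097],
     [9196903], [], [], [-853019, 2022002], [], [], [],
     [-5251041, -1303441, 1119419, -279512, 1840888],
     [456988, 934525, -485067, 1531661, 251939, 4557186], [], [], [8769681], [], [], []],
    [283822458654450521380162711355492055214739007213665386884552218193044334491861010250243,
     29325060986308810739831891886977003051427683263997729495892917453476615012666080566937,
     268273360280180688735233356119393205488973094352616873517351168340458787755286876007527,
     145016083321977707526839178804759590330952990193082906550637130386917214417093601804387,
     274129038216180399357541784168895636209615824415539026086821307470257686384556679259475,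
     281915960091611670183799645512630988456270162942805486149952667361660664999072049057817,
     301381382643933228282124147060619249288503556134982224549625333131267474798020852370990,
     298341378609758542942943800279665652016802606322269448561418143051002669523388233072154,
     32381622952059991735167870836474137421290583623200275182690744952120132324617963614746,
     48057664751662487183051610591773079799455694819482716004072848798855688712342348934870,
     109149258336212015121362906543060155669369933149637795624482365249829888254639969050126,
     297441002040819365855784407663705136232280221199497718299280792979935648007632815415881]⟩,
   ⟨[24, 29], 5188,
    [[-1003441, -1624194, 385106, 513807, -1669913, 1155052, 91069, -328737, -1490638, -1844995,
      626719, -109700, 5333, 85692, 299006],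
     [], [-3440032, 3111388], [], [], [-3672031, 143386, 1912834, 60086, 2167092], [],
     [-1226259, 7296840], [-3338895, -832520, -1974002, -1160245, -1349703, 184670], [], [116773],
     [], [], [-4848435, 976049, 650816, 4096938], [], [9966391]],
    [7892404108682280242237507105233932203334337047208887390175869468210525240901435170915,
     223535965747763343351104156285945845105893613500338951956003349341276299420367864206433,
     80281475722161478471191454101129559495174455229767678776320064401725535213269812513856,
     204172393493156156543627227250613911496539891662781308105378931052124936224001806903384,
     208602217154939945888388387049769797542636492076183478350106913450367380233753881291861,
     301266591128613157744474432167208904417340603166956076832121931342151294323218373044288,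
     297976941998786639716807118266755183098218860940404497438072581461032598984521245417882,
     297419181419638122244293240520338162497746820076541181193104102241041691002464305832032,
     303246575128839270489261865150353369578789621629487179504849650588575825048190517843341,
     208105167489912540512447139579868173107890257701380182582895165447573644832130273455230,
     204768097316244229390491761388206985480553406396197422480844934170654527161609487198646]⟩,
   ⟨[18, 24], 2113,
    [[409844, 663002, 69230, 406485, -329311, 140047, 1138197, 68689, 178043, 709679, -71732,
      -20262, -3575, -57537, 48219, 132166],
     [], [], [], [], [-680911, -502007, -154550, -1286816, 401314, 267960], [], [],
     [-1332036, -2024306, 155896, -266141, -309599, 47644, 156053], [], [], [], [],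
     [1379264, -1698819, -467733, 85180, 827326], [], []],
    [221588413210503404124265585385557711684127829021332765561454216880880463626527957174369,
     9837513206765643172547769059405353799309378946430440467899958201893694615734457775424,
     270695999387866159082342813389829575048935865720288281652520853078603823060722931870030,
     262986002811106945127834818074683795222511174877136971488855011888930070638250665056622,
     266810646782480476564978074788769613734648153024834689367851505563831492953866589839694,
     264871779590658254108901515675560188578933623417693181041312724088327035806132392306032,
     265467483066217241650136069554539496954571451794260490909996681556490735852320735241886,
     257681600695879249699000387467307806907815396299425146550513813507613641895411678058134,
     263483054755755487099458348485127617086438745278198043476754280159778767714065827633792,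
     271314468598946035788342737849844250597718834404301744791132875013340101207543259474592]⟩,
   ⟨[24, 23], 5220,
    [[944267, 1527184, 455469, -765389, -236452, 1955847, -3958132, -457298, -641368, 2449810,
      -917231, 127109, -9915, -159379, -315635, -30962, 188884],
     [], [-3617881, -3104870, 202143], [], [],
     [-1204023, -709072, -458049, -1113945, -1214063, 180938, 173614], [],
     [1464102, 3120072, 6445300], [], [], [], [], [], [], [], []],
    [8383764883499157597550400332346204806254882592634152800483203976810032287186223890432,
     29600141706782912142206343709101840812910034922745292974587976651568721752875809651938,
     29693096408344113178206734542521681904478115245102492057248675362784930601878891281706,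
     64498106245222830285285914467778911810835132437821166031378947675408051147123890095325,
     43231188724138194032234711308893687477858629909761169281211255237108471501642212595987,
     43880007648817597636507169578762674544850042485443623109358378915771970805193748011613,
     43988065326327056753769880516722781864091021667661392007273294341284754516934109977238,
     30243264212092137301499884442797027829039461881986161963263660010753295415547844378177,
     30423501924855097931197790877495023017705918322863600135328742640133735892087052189344]⟩,
   ⟨[20, 24], 15365,
    [[-7476129, 944159, -614200, -5242704, -3882168, 1277482, -499417, 2606369, 46745, 951261,
      -394964, -13022, -2010628, -23729, -28491, -17321, 40327, 1878569],
     [1412362, 8541140], [], [-12248185, -5743116, -1838562, 3739127, -688737, 3723069],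
     [2804475, 7510548, 3712186],
     [-2973116, 437406, -1408417, 3023848, -1633569, -514479, -108659, 6817511], [13079900], [],
     [-6246276, 721714, -2431701, -1123434, -5282805, 289866, 175571, 1012645],
     [-11031694, 464304, -5003723, -6189214, -5630905, -3282567, 1889288], [], [7637737],
     [6166604, 14328531], [-5008235, -5347187, 451437, -1212822, -1845391, 5865931],
     [-1909603, 1468724], []],
    [14584146327458540559407688956163624708643272541771768798226135454508458786342894614249986234097019990306664337681021434952806626155003479667026854670847592772995267809514593,
     23279374181926881994025216773541326615698066659344496751998457534599229255182450790663810203444600855765028356024059433838787543454277268352278575149666624621543960589394218,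
     4955832060594004349936175324837556144068406791000407328005872908345937928027264320074890679707595801936685852070516707894282655572219597549809138082176470105078004935311655,
     26181374276020913009522259300270609641260527992246988444265748184424821369421564519286528528597988808930179238100648260705942253709713526589601620595143732681428086616777159,
     4866200567823851524179045931747202736557430004264310612340855806360472522511271360631717767519322246933854272254771628683539572911504082027265564696395690302743736332479545,
     23274667900176187046851165506826000560964722117969064890891754831218052047464978490454284926480246596762418122483574131212394670154150311191254844302638079149340295689327072,
     48451697501803999783888705935962832458177197912709485560173877928238661835359201543531803255107628230530465408724405552918946751469896909069564835433515582397407485459064138,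
     136233560725903154515988591782471826475006200876190665993731217285482420832719449254421291427577013061949778627527294523485088425734713882608049326983328883736982438460934160]⟩,
   ⟨[24, 6], 16773,
    [[1365686, -8530, -568329, -180212, -811455, -130015, 862017, -1381513, -519920, -409494,
      224332, -66584, -2875364, 175762, 131578, 11469, -38202, 388320, 188797],
     [-1835525, -1408277, 6763604], [],
     [2941691, 1512700, -4078040, -10973800, -5123296, -5648350, 486804],
     [-4563718, 3945224, 464411, 252668],
     [-1458433, -80623, -514605, 3092488, -1446600, -515688, -105826, 4756070, 7361008],
     [121746, 6101485], [],
     [-4635242, -624424, -979372, 1494569, -3824244, 127886, 86353, 1524051, 1307971],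
     [4116304, 430769, -2856882, 10063677, -3094447, 7395236, -2035470, 360323], [],
     [-1372474, 7382872], [4720161, -1803978, 655871],
     [-2888690, -2237461, -118232, -1336530, 1126079, -992628, 4173447],
     [-3141647, 4687078, 3181971], []],
    [137283289906519663672802206751428898733554254188758546360083496143719360491216154387842979997947234039773869494766842379270245369455330982659052859848504000453826200473860109,
     31168938281828312589062288246230430113311919256765005880811846932132441855118981545084993461570637234637106951033214901677460399557976578104714656674059427690316549496795512,
     171089454733190444348305891581077901833469056863458330471517694611290235086657061051297389704928182687840493893707715217997752106325182546916491927148575938922676936988310717,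
     15127729378678345273421500765070630386762881835713966459110275204268067328699046914540474607073434868876385414130170056595299090800084112238973650519354052396518274337631575,
     27538364729361929672427589182913921658396319800659625450541289482818290988983736060712253022510213016554172342843849532090093211286588231594272607101622087996760642628762716,
     51380440854841798523677124957877858338941102655968675011117523635557219847387452185042867931093601417296401567750529203922131928136062346322674329517137240854376193827442750,
     149860377804251403431244430213871273826275206081398252145885965553950393297524203482789214423008474892875848942849368505382011979433124147070015809564074164467734496511681959]⟩,
   ⟨[20, 9], 16585,
    [[-3540095, 694501, -1320455, -1506093, -2811644, -693081, 614224, 3202672, 1219802, 1887856,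
      -534821, -16462, 1788357, -320444, -24563, 4997, 30609, 875728, -9216, 215095],
     [-2837394, 10328002, 11494425, 408845], [],
     [-10092498, -836952, -1847753, 4831303, -3729993, -839232, -154983, 450838],
     [117549, 9286430, 3263330, 126855, 238966],
     [-220028, -106562, 637018, 2366419, -462028, -386037, -92362, -2224953, 3148968, 296578],
     [4585796, 10862185, 341777], [],
     [3002729, -669444, -5919258, 1394586, -3280773, 58093, -220138, 3145843, 533773, 1227726],
     [-8960294, -3395465, -1695484, -5534838, -4801777, 2513500, 1121712, -95509, 286908], [],
     [7226298, 11341925, 363915], [14696929, 3547317, -2362873, 786434],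
     [-2119924, -1687381, 1453325, 875205, 3173974, 2958529, 890633, 3259754],
     [939612, 8693791, 1653861, 748564], []],
    [14764485864782718412256451149925608686038403925586111076713752098076532284983775970542083448474516670828635839500509235355350781111521111223843797803261974085574050710295719,
     26370124635092020717965028634237320270524303671464809722478499879904509903584015169733196773401124108892664559297905730364161573725928849458245813873818988858969347231867295,
     31124594756213797696509672725471538912245813415109837023634583803152711505665101544074576788800423024975648842781677491495269372804046735624724593204473720875345255595562132,
     152789543691214866960193917061532094237344134349425167818861693976519246891315254489523802727126462176865758946149982324059047227563475598178892108279401344079948346472707263,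
     149089237918985956666740250993156599194845364775188259050441104990245954401376439916711966458477382871659505104246638496841841546127804541853124224232751189279202236344453136,
     140102404965757966679836277446663075008512224990850687722915794276290078111195521032868380677560479292850787694350044633613805330044986345736775845761861743525694639911101959]⟩,
   ⟨[25, 20], 16580,
    [[-1491081, 2346224, -1691576, 1526739, 4636197, 1074447, -436040, -6429100, -3918, -1696431,
      317849, 82540, -3506377, 436320, -111552, -25628, 10707, -1768747, 19093, -181357, 302506],
     [-2765346, -11879399, 616925, -125940, 251690], [],
     [614882, -1755154, 2624201, -7060280, -1145375, -1456706, 231063, -300814, 247645],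
     [-3827194, -2117021, -2304704, 100558, -16835, 223522],
     [1238428, -26122, 1281998, -833746, 661637, 146226, 29871, -3490428, 2926005, 75302, 208836],
     [4101809, -652889, -6826, 173889], [],
     [-2862837, -347976, 4469668, -844509, 5963995, -218587, -11388, 2043854, 1563865, 444894,
      589859],
     [2991824, 1476136, 1842055, 9842986, 3813595, -1169505, -2732663, 226355, -208338, 264405],
     [], [-9166353, 79350, -108573, 233795], [-3991365, 3080605, -2606141, 673990, 306406],
     [2617129, 177813, 1717743, 1367532, -1455656, 1356940, -429625, 1777494, 1604081],
     [1990697, 1477882, 2949756, -297612, 267334], []],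
    [141151675285412823065622484516751087121784533248485695769036550386753883252953541284443562165289220875452364803781932056449876932857939791373270073563073912405634443931187715,
     27356271144694770969911415198952194045453015658336499663113486455834618127657581451158947721857970031241896590240889642676147240342501571484580805884092532054894174423174255,
     137206869270744077323803948061910300916189212743230832355261266440502810367335710018538302704355344062850674162554405777260716705597072457232010765935854534862008386075170397,
     167290966392280563714434776148015775885366638127145542399902611624656058704859145872863740267464772195227069149979683417499273987619893562209543317627812900983473334700682997,
     174177385945860950297531263076164634604420017506251609088005353242846017063310148710562476346942900986321785596650697800491154659778201645293713527071427145008978919320475801]⟩,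
   ⟨[28, 11], 17001,
    [[2765298, -277339, 1725625, -2688354, 775589, 297593, -1010018, 7578565, -6168, -1695220,
      317761, 82452, 3533401, -1492, -111531, -25629, 10699, 1757810, -66770, 105923, -193386,
      332056],
     [], [], [], [],
     [1237424, -26419, 1275966, -828894, 658578, 145389, 29686, 3485432, -2927145, -169900, -54946,
      213332],
     [], [],
     [-2862827, -347972, 4469696, 6023206, 60339, -218586, -11388, -2109808, -1507333, -346796,
      -416159, 389971],
     [], [], [], [],
     [2617367, 179896, 1716868, 1367436, -1456325, 1151580, 223347, -1939862, -1564848, 417806],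
     [], []],
    [141154507103311087167734494007709831054161539609608795583426651614803412574750673386948732061025845315845635815592146688014266094395444853875637171859102916335126226833668096,
     115481452760371750445731751762704456088662455145253669230262245945811519858615216955503602734611409908525127402641240949927273543612420634840436731137606912690483809300391456,
     169330786288833873451584653285508647716965490971124043039168262605632100968644626281764883838619052798601805121111178728493063990017729635349999859457471635989481610275136245,
     161617318697718635279405298189570078729689475185384798088453986329738167518114366479360503421532403239671342502904123215333464330001420829658447765522747074130425438688421171]⟩,
   ⟨[30, 24], 16808,
    [[2206785, -2858360, 942015, 2022400, -383373, -1540392, 456471, -3917874, 1220945, 1887229,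
      -534774, -16417, -1814270, -96392, -24573, 4997, 30613, -866431, 26755, -33931, 78019,
      -134431, 191110],
     [], [], [], [],
     [220759, 106747, -631293, -2369005, 464380, 386498, 92460, -2235943, 3145142, -39377, 89759,
      -21330, 230255],
     [], [],
     [3002701, -669447, -5919285, -3452963, 886281, 58093, -220138, -3234474, -462477, -809887,
      -293483, -291367, 431170],
     [], [], [], [],
     [2119887, 1682912, -1449978, -873534, -3171421, -2524515, 1322051, 3094773, 756839, 882049,
      1060569],
     [], []],
    [14856949678978883899605265058813143948238696923490236787813296863499232352164166118056540681980586448429721289517682012183324756737768038241593955023737193765541150952789089,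
     189109200696827153983658133038467274550403164964113465815687793760881640520020162130137316030687650879129448101671135695902813950530589453302224089241907270970896518270355001,
     51716894034851261726760203002822291716021360302363143079822189053426347156383557202544081362543048614009477509985673006787261573175526526536348208731212247986846992965641760]⟩,
   ⟨[24, 19], 16507,
    [[-618300, 1218042, 492707, 734357, -1157493, -650982, 289831, 1028904, -521297, -408073,
      224138, -66649, 2874989, -181896, 131573, 11469, -38200, -385347, -13716, 27578, -20930,
      -41418, 9493, 186419],
     [], [], [], [],
     [-1457851, -80180, -522996, 3081292, -1445954, -513895, -105386, -4740084, -7352302, 298058,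
      -116474, -84460, -224071, 346096],
     [], [],
     [-4635266, -624426, -979398, -4005283, 903551, 127886, 86353, -1454709, -1344354, -195928,
      -41092, -51705, -46770, 255188],
     [], [], [], [],
     [-2889070, -2234776, -122400, -1339489, 1122721, -1638788, -3945771, 100850, 84630, -120136,
      38329, 353573],
     [], []],
    [137564451942725600597340503620569477876351475023793350953137405607780004428676579197957182968134185664152170550949545745402422301516915795128096883143445490297521249001568771,
     23619975820400777949960070453080248678117936970478573571571509817852255079658023578721321796181975111700780009542054746564177107552181134794598633498473433444379934143570375]⟩,
   ⟨[24, 27], 15795,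
    [[4191278, -6266884, 985054, 5218010, -376482, -556519, -2689271, -3964792, 46185, 952626,
      -395206, -13063, 1992198, -272726, -28512, -17320, 40335, -1853145, -22711, -23281, 68208,
      -153885, 69614, 54210, 240210],
     [], [], [], [],
     [-2971552, 438005, -1405010, 3012069, -1629373, -512517, -108203, -6797434, 1828, 383164,
      8544, -154519, -107126, 193454, 230822],
     [], [],
     [-6246291, 721712, -2431720, -5054321, -1903725, 289866, 175571, -823492, -166716, -485295,
      39393, -181839, 24359, 76535, 207214],
     [], [], [], [],
     [-5008251, -5346602, 450817, -1213196, -1845887, 5753763, -929477, -426328, -438578, 88491,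
      -27196, 25325, 230076],
     [], []],
    [14856816415542466717439435332304849587102010103817994019215227614340022757703860426478512132589700701285055891656304372128792113958730689592838341361806645666866807253767265]⟩]

/-- Witnesses for the transitivity of the signed permutations on the letters. -/
def letterCertsFour : ℕ :=
  64984662865655597314084014662494554270645697077321025328796765869303484259892764697477793848922099862479555408305946821871010818

/-- Witnesses for the products of the inverse of the letter `20` with the letters. -/
def lapCertsFour : ℕ :=
  216659811209244466263848358458328720452342172050472291223015300740553354630325391256633824495007885490447105006809368433531815936

/-! ### Verification of the certificates -/

lemma frameThree_isValid : frameThree.IsValid 3 where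
  le_four := by norm_num
  start_eq := by decide +kernel
  isPerm := by decide +kernel
  isLetter := by decide +kernel
  isPerm_group := by decide +kernel

lemma frameThree_hasCharacters : frameThree.HasCharacters 3 where
  central_sq := by decide +kernel
  gens_sq := by decide +kernel
  gens_central := by decide +kernel
  gens_comm := by decide +kernel
  signs_sq := by decide +kernel

lemma frameThree_hasLetters : frameThree.HasLetters 3 20 letterCertsThree lapCertsThree where
  isLetter := by decide +kernel
  rep_zero := by decide +kernel
  rep_one := by decide +kernel
  trans := by decide +kernel
  quotient := by decide +kernel

lemma orbitRepsThree_isValid : ∀ r ∈ orbitRepsThree, r.IsValid frameThree 3 := by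
  decide +kernel

lemma pairsOk_three : frameThree.pairsOk orbitRepsThree = true := by
  decide +kernel

lemma errorOk_three : frameThree.errorOk orbitRepsThree (letters 3).length
    100000000000000 28000000000000 27864800000000 lapCertsThree = true := by
  decide +kernel

lemma isCertifiedGap_three : IsCertifiedGap (elementaryMatrices 3) 2 2 0.278648 :=
  isCertifiedGap_of_frame frameThree_isValid frameThree_hasCharacters frameThree_hasLetters
    (by decide +kernel) orbitRepsThree_isValid pairsOk_three errorOk_three (by norm_num)
    (by norm_num) (by norm_num)

lemma frameFour_isValid : frameFour.IsValid 4 where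
  le_four := by norm_num
  start_eq := by decide +kernel
  isPerm := by decide +kernel
  isLetter := by decide +kernel
  isPerm_group := by decide +kernel

lemma frameFour_hasCharacters : frameFour.HasCharacters 4 where
  central_sq := by decide +kernel
  gens_sq := by decide +kernel
  gens_central := by decide +kernel
  gens_comm := by decide +kernel
  signs_sq := by decide +kernel

lemma frameFour_hasLetters : frameFour.HasLetters 4 20 letterCertsFour lapCertsFour where
  isLetter := by decide +kernel
  rep_zero := by decide +kernel
  rep_one := by decide +kernel
  trans := by decide +kernel
  quotient := by decide +kernel

lemma orbitRepsFour_isValid : ∀ r ∈ orbitRepsFour, r.IsValid frameFour 4 := by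
  decide +kernel

lemma pairsOk_four : frameFour.pairsOk orbitRepsFour = true := by
  decide +kernel

lemma errorOk_four : frameFour.errorOk orbitRepsFour (letters 4).length
    100000000000000 130600000000000 129562000000000 lapCertsFour = true := by
  decide +kernel

lemma isCertifiedGap_four : IsCertifiedGap (elementaryMatrices 4) 2 2 1.29562 :=
  isCertifiedGap_of_frame frameFour_isValid frameFour_hasCharacters frameFour_hasLetters
    (by decide +kernel) orbitRepsFour_isValid pairsOk_four errorOk_four (by norm_num)
    (by norm_num) (by norm_num)

end

end KazhdanBounds

end

open KazhdanBounds
theorem mainTheorem1 :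
    (IsCertifiedGap (elementaryMatrices 3) 2 2 0.278648 ∧
      IsSpectralGap (elementaryMatrices 3) 0.278648 ∧
      ENNReal.ofReal (Real.sqrt (2 * 0.278648 / (elementaryMatrices 3).card)) ≤
        kazhdanConstant.{u} (elementaryMatrices 3) ∧
      ENNReal.ofReal 0.2155 ≤ kazhdanConstant.{u} (elementaryMatrices 3)) ∧
    (IsCertifiedGap (elementaryMatrices 4) 2 2 1.29562 ∧
      IsSpectralGap (elementaryMatrices 4) 1.29562 ∧
      ENNReal.ofReal (Real.sqrt (2 * 1.29562 / (elementaryMatrices 4).card)) ≤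
        kazhdanConstant.{u} (elementaryMatrices 4) ∧
      ENNReal.ofReal 0.3285 ≤ kazhdanConstant.{u} (elementaryMatrices 4)) := by
  have h3 := isCertifiedGap_three.isSpectralGap (fun _ => inv_mem_elementaryMatrices)
    (fun _ => ne_inv_of_mem_elementaryMatrices) (by norm_num) (by norm_num)
  have h4 := isCertifiedGap_four.isSpectralGap (fun _ => inv_mem_elementaryMatrices)
    (fun _ => ne_inv_of_mem_elementaryMatrices) (by norm_num) (by norm_num)
  have k3 := h3.le_kazhdanConstant.{u} (fun _ => inv_mem_elementaryMatrices)
    closure_elementaryMatrices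
  have k4 := h4.le_kazhdanConstant.{u} (fun _ => inv_mem_elementaryMatrices)
    closure_elementaryMatrices
  refine ⟨⟨isCertifiedGap_three, h3, k3, le_trans (ENNReal.ofReal_le_ofReal ?_) k3⟩,
    ⟨isCertifiedGap_four, h4, k4, le_trans (ENNReal.ofReal_le_ofReal ?_) k4⟩⟩
  · rw [card_elementaryMatrices_three]
    exact Real.le_sqrt_of_sq_le (by norm_num)
  · rw [card_elementaryMatrices_four]
    exact Real.le_sqrt_of_sq_le (by norm_num)
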